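/- **Setting.** Let $\varepsilon,\mu:\mathbb R^2\to\mathbb R$ be measurable functions of $(x,z)$ that are $2\pi$-periodic in $x$, equal to constants $\varepsilon_0,\mu_0$ for $|z|\ge L$ (where $L>0$), bounded from below and above by positive constants, and symmetric: $\varepsilon(x,-z)=\varepsilon(x,z)$, $\mu(x,-z)=\mu(x,z)$. Let $$\mathcal D=\{(\kappa,\omega)\in\mathbb R^2:\ |\kappa|<\tfrac12,\ |\kappa|<\omega\sqrt{\varepsilon_0\mu_0}<1-|\kappa|\},$$ and $\eta_m^2=\varepsilon_0\mu_0\omega^2-(m+\kappa)^2$ with $\eta_m>0$ or $\eta_m\in i\mathbb R_{>0}$, so that exactly the order $m=0$ propagates in $\mathcal D$. Let $\Omega=(-\pi,\pi)\times(-L,L)$, let $\Gamma$ be the union of its sides $z=\pm L$, let $H=H^1_{\rm per}(\Omega)$ be the space of functions in $H^1(\Omega)$ with equal traces at $x=\pm\pi$, and let $N$ be the operator on $\Gamma$ that multiplies the $m$-th Fourier coefficient in $x$ by $-i\eta_m$ on each side. With $\boldsymbol\kappa=(\kappa,0)$ put $$h(u,v)=\int_\Omega\mu^{-1}(\nabla+i\boldsymbol\kappa)u\cdot(\nabla-i\boldsymbol\kappa)\bar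 v+\mu_0^{-1}\int_\Gamma (Nu)\bar v,\qquad b_\varepsilon(u,v)=\int_\Omega\varepsilon u\bar v .$$ Let $C_1,C_2$ be the bounded operators on $H$ that represent the forms $h+b_\varepsilon$ and $-(\omega^2+1)b_\varepsilon$, and let $A(\kappa,\omega)=I+C_1^{-1}C_2$. For $(\kappa,\omega)\in\mathcal D$ the scattering problem for the incident field $u^{\rm inc}=e^{i\eta_0z}$ is $$h(u,v)-\omega^2b_\varepsilon(u,v)=\mu_0^{-1}\int_\Gamma(\partial_nu^{\rm inc}+Nu^{\rm inc})\bar v\quad\text{for all }v\in H .$$ Its solutions all have the same coefficients $R(\kappa,\omega)$, $T(\kappa,\omega)$, where the zeroth Fourier coefficient of $u$ in $x$ is $e^{-i\eta_0L}+Re^{i\eta_0L}$ on $z=-L$ and $Te^{i\eta_0L}$ on $z=L$. The transmittance is $|T|^2$. Let $U\subseteq\mathcal D$ be open and let $\tilde\ell:U\to\mathbb C$ be continuous such that, for every $(\kappa,\omega)\in U$, $\tilde\ell(\kappa,\omega)$ is an algebraically simple eigenvalue of $A(\kappa,\omega)$, and $0$ is an eigenvalue of $A(\kappa,\omega)$ only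 if $\tilde\ell(\kappa,\omega)=0$. Let $(\kappa_0,\omega_0)\in U$ be a guided-mode pair, $\tilde\ell(\kappa_0,\omega_0)=0$. Assume that the $\omega$-derivatives of $\tilde\ell$, $\tilde\ell R$ and $\tilde\ell T$ at $(\kappa_0,\omega_0)$ are nonzero. **Theorem (Total transmission and reflection).** There are a constant $C\in\mathbb C\setminus\{0\}$, complex sequences $(\ell_n),(r_n),(t_n)$, $n\ge1$, and real numbers $r_0,t_0,\gamma$ with $0<r_0<1$ and $0<|t_0|<1$ such that $\ell=C\tilde\ell$, $a=\ell R$, $b=\ell T$ satisfy near $(\kappa_0,\omega_0)$, with $\tilde\kappa=\kappa-\kappa_0$ and $\tilde\omega=\omega-\omega_0$, $$\ell=\Big(\tilde\omega+\sum_{n\ge1}\ell_n\tilde\kappa^n\Big)E_\ell,\qquad a=\Big(\tilde\omega+\sum_{n\ge1}r_n\tilde\kappa^n\Big)E_a,\qquad b=\Big(\tilde\omega+\sum_{n\ge1}t_n\tilde\kappa^n\Big)E_b,$$ with convergent series and real-analytic complex-valued functions $E_\ell,E_a,E_b$ that take the values $1$, $r_0e^{i\gamma}$, $it_0e^{i\gamma}$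 at $(\kappa_0,\omega_0)$. If moreover $\operatorname{Im}\ell_2>0$, then either the transmittance is continuous at $(\kappa_0,\omega_0)$, or there are functions $f_1,f_2$, real-analytic at $\kappa_0$, with $f_1(\kappa_0)=f_2(\kappa_0)=\omega_0$, $f_1'(\kappa_0)=f_2'(\kappa_0)$ and $f_1''(\kappa_0)\ne f_2''(\kappa_0)$, such that $|T(\kappa,f_1(\kappa))|^2=1$ and $|T(\kappa,f_2(\kappa))|^2=0$ for all $\kappa\ne\kappa_0$ near $\kappa_0$. Specifically: (i) If $r_2\ne t_2$, then all $r_n$ and $t_n$ are real and $r_1=t_1=\ell_1$. Near $(\kappa_0,\omega_0)$ the zero sets of $a$ and $b$ are the graphs of the real-analytic functions $$f_a(\kappa)=\omega_0-\ell_1\tilde\kappa-r_2\tilde\kappa^2-\cdots,\qquad f_b(\kappa)=\omega_0-\ell_1\tilde\kappa-t_2\tilde\kappa^2-\cdots,$$ which differ at every $\kappa\ne\kappa_0$ near $\kappa_0$; at every $(\kappa,\omega)\neq(\kappa_0,\omega_0)$ near $(\kappa_0,\omega_0)$ one has $|T|^2=1$ if and only if $\omega=f_a(\kappa)$, and $|T|^2=0$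 if and only if $\omega=f_b(\kappa)$. The functions $a(\kappa_0,\cdot)/\ell(\kappa_0,\cdot)$ and $b(\kappa_0,\cdot)/\ell(\kappa_0,\cdot)$ extend to continuous functions of $\omega$ in a real neighborhood of $\omega_0$ with values $r_0e^{i\gamma}$ and $it_0e^{i\gamma}$ at $\omega_0$. (ii) Let $r_2\ne t_2$, let $(c,f)$ be $(a,f_a)$ or $(b,f_b)$, and let $W\subseteq U$ be an open set with $(\kappa_0,\omega_0)\in W$ and $\overline W\cap\mathcal D\subseteq U$ (for instance $W=\mathcal D$, if $U=\mathcal D$). Then $f$ extends from a neighborhood of $\kappa_0$ to a real-analytic function $g$ on an interval $(\kappa_1,\kappa_2)\ni\kappa_0$ whose graph lies in $W$ and in the zero set of $c$, such that for $i=1,2$ the limit $\omega_i=\lim_{\kappa\to\kappa_i}g(\kappa)$ exists and either $(\kappa_i,\omega_i)\in\partial W$, or $(\kappa_i,\omega_i)\in W$ and $\frac{\partial c}{\partial\omega}(\kappa_i,\omega_i)=0$. (iii) If $r_2=t_2$, then $|a/\ell|$ and $|b/\ell|$ extend to continuous functions in a real neighborhood of $(\kappa_0,\omega_0)$ with values $|r_0|$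 and $|t_0|$ at $(\kappa_0,\omega_0)$. -/

import Mathlib

open MeasureTheory Filter Topology Set

noncomputable section

/-- A lossless two-dimensional periodic slab: real coefficients, `2π`-periodic in `x`, equal to the
constants `ε₀`, `μ₀` for `|z| ≥ L`, and bounded from below and above by positive numbers. Points of
the plane are written `(x, z)`. -/
structure PeriodicSlab where
  ε : ℝ × ℝ → ℝ
  μ : ℝ × ℝ → ℝ
  ε₀ : ℝ
  μ₀ : ℝ
  L : ℝ
  L_pos : 0 < L
  measurable_ε : Measurable ε
  measurable_μ : Measurable μ
  periodic_ε : ∀ (n : ℤ) (x z : ℝ), ε (x + 2 * Real.pi * n, z) = ε (x, z)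
  periodic_μ : ∀ (n : ℤ) (x z : ℝ), μ (x + 2 * Real.pi * n, z) = μ (x, z)
  ε_outside : ∀ x z : ℝ, L ≤ |z| → ε (x, z) = ε₀
  μ_outside : ∀ x z : ℝ, L ≤ |z| → μ (x, z) = μ₀
  bounds_ε : ∃ m M : ℝ, 0 < m ∧ ∀ p, m < ε p ∧ ε p < M
  bounds_μ : ∃ m M : ℝ, 0 < m ∧ ∀ p, m < μ p ∧ μ p < M

namespace PeriodicSlab

/-- Symmetry of the structure about the `x`-axis. -/
def IsSymmetric (S : PeriodicSlab) : Prop :=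
  ∀ x z : ℝ, S.ε (x, -z) = S.ε (x, z) ∧ S.μ (x, -z) = S.μ (x, z)

/-- The diamond of real pairs `(κ, ω)` with exactly one propagating diffraction order. -/
def diamond (S : PeriodicSlab) : Set (ℝ × ℝ) :=
  {p | |p.1| < 1 / 2 ∧ |p.1| < p.2 * √(S.ε₀ * S.μ₀) ∧ p.2 * √(S.ε₀ * S.μ₀) < 1 - |p.1|}

/-- The exponents `η_m`, `η_m² = ε₀ μ₀ ω² - (m + κ)²`, with `η_m > 0` for a propagating order and
`η_m = i |η_m|` for an evanescent one. -/
def eta (S : PeriodicSlab) (p : ℝ × ℝ) (m : ℤ) : ℂ :=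
  if 0 ≤ S.ε₀ * S.μ₀ * p.2 ^ 2 - (m + p.1) ^ 2 then
    (√(S.ε₀ * S.μ₀ * p.2 ^ 2 - (m + p.1) ^ 2) : ℂ)
  else Complex.I * (√((m + p.1) ^ 2 - S.ε₀ * S.μ₀ * p.2 ^ 2) : ℂ)

/-! ### The periodic Sobolev space on one truncated period -/

/-- One period of the slab, truncated: `(-π, π) × (-L, L)`. -/
def cell (S : PeriodicSlab) : Set (ℝ × ℝ) :=
  Ioo (-Real.pi) Real.pi ×ˢ Ioo (-S.L) S.L

/-- The space `L²` of the truncated period. -/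
abbrev L2 (S : PeriodicSlab) : Type := Lp ℂ 2 (volume.restrict S.cell)

/-- Test functions on the cylinder `(ℝ / 2πℤ) × (-L, L)`: smooth, `2π`-periodic in `x`, with
compact support in the variable `z ∈ (-L, L)`. -/
structure IsTest (S : PeriodicSlab) (φ : ℝ × ℝ → ℂ) : Prop where
  smooth : ContDiff ℝ (⊤ : ℕ∞) φ
  periodic : ∀ x z : ℝ, φ (x + 2 * Real.pi, z) = φ (x, z)
  support : ∃ δ > 0, ∀ x z : ℝ, S.L - δ ≤ |z| → φ (x, z) = 0

theorem integrable_L2_mul (S : PeriodicSlab) (f : S.L2) {ψ : ℝ × ℝ → ℂ} (hψ : Continuous ψ) :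
    Integrable (fun p => f p * ψ p) (volume.restrict S.cell) := by
  have hK : IsCompact (Icc (-Real.pi) Real.pi ×ˢ Icc (-S.L) S.L) :=
    isCompact_Icc.prod isCompact_Icc
  have hsub : S.cell ⊆ Icc (-Real.pi) Real.pi ×ˢ Icc (-S.L) S.L :=
    Set.prod_mono Ioo_subset_Icc_self Ioo_subset_Icc_self
  have : IsFiniteMeasure (volume.restrict S.cell) :=
    ⟨by simpa using (measure_mono hsub).trans_lt hK.measure_lt_top⟩
  have hf : Integrable (fun p => f p) (volume.restrict S.cell) :=
    (Lp.memLp f).integrable (by norm_num)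
  obtain ⟨C, hC⟩ := hK.exists_bound_of_continuousOn hψ.continuousOn
  refine hf.mul_bdd (c := C) hψ.aestronglyMeasurable ?_
  refine (ae_restrict_iff' (measurableSet_Ioo.prod measurableSet_Ioo)).2 (ae_of_all _ ?_)
  exact fun p hp => hC p (hsub hp)

theorem IsTest.continuous_fderiv {S : PeriodicSlab} {φ : ℝ × ℝ → ℂ} (h : S.IsTest φ)
    (v : ℝ × ℝ) : Continuous (fun p => fderiv ℝ φ p v) :=
  (h.smooth.continuous_fderiv (by simp)).clm_apply continuous_const

/-- The Hilbert space `H¹_per` of the truncated period. An element is a function `u` in `L²`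
together with its weak partial derivatives in `L²`, as the triple `(u, ∂ₓ u, ∂_z u)`. The weak
derivatives are taken on the cylinder, that is, against test functions that are periodic in `x`;
this encodes that `u` has equal traces on `x = π` and `x = -π`. The inner product inherited from
`L² × L² × L²` is the inner product of `H¹`. -/
def H1per (S : PeriodicSlab) : Submodule ℂ (PiLp 2 (fun _ : Fin 3 => S.L2)) where
  carrier := {u | ∀ φ : ℝ × ℝ → ℂ, S.IsTest φ →
    (∫ p in S.cell, u 0 p * fderiv ℝ φ p (1, 0)) = -∫ p in S.cell, u 1 p * φ p ∧
    (∫ p in S.cell, u 0 p * fderiv ℝ φ p (0, 1)) = -∫ p in S.cell, u 2 p * φ p}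
  zero_mem' := by
    intro φ _
    have h0 : ∀ (i : Fin 3) (ψ : ℝ × ℝ → ℂ),
        (∫ p in S.cell, (0 : PiLp 2 (fun _ : Fin 3 => S.L2)) i p * ψ p) = 0 := fun i ψ => by
      rw [integral_congr_ae (g := fun _ => (0 : ℂ)) ?_, integral_zero]
      filter_upwards [Lp.coeFn_zero ℂ 2 (volume.restrict S.cell)] with p hp
      rw [PiLp.zero_apply, hp, Pi.zero_apply, zero_mul]
    rw [h0, h0, h0, h0, neg_zero]
    exact ⟨rfl, rfl⟩
  add_mem' := by
    intro u v hu hv φ hφ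
    have hadd : ∀ (f g : S.L2) (ψ : ℝ × ℝ → ℂ), Continuous ψ →
        (∫ p in S.cell, (f + g : S.L2) p * ψ p)
          = (∫ p in S.cell, f p * ψ p) + ∫ p in S.cell, g p * ψ p := fun f g ψ hψ => by
      rw [← integral_add (S.integrable_L2_mul f hψ) (S.integrable_L2_mul g hψ)]
      refine integral_congr_ae ?_
      filter_upwards [Lp.coeFn_add f g] with p hp
      rw [hp, Pi.add_apply, add_mul]
    have hc := hφ.smooth.continuous
    simp only [PiLp.add_apply]
    rw [hadd _ _ _ (hφ.continuous_fderiv _), hadd _ _ _ (hφ.continuous_fderiv _),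
      hadd _ _ _ hc, hadd _ _ _ hc, (hu φ hφ).1, (hu φ hφ).2, (hv φ hφ).1, (hv φ hφ).2]
    constructor <;> ring
  smul_mem' := by
    intro c u hu φ hφ
    have hsmul : ∀ (f : S.L2) (ψ : ℝ × ℝ → ℂ),
        (∫ p in S.cell, (c • f : S.L2) p * ψ p) = c * ∫ p in S.cell, f p * ψ p := fun f ψ => by
      rw [← integral_const_mul]
      refine integral_congr_ae ?_
      filter_upwards [Lp.coeFn_smul c f] with p hp
      rw [hp, Pi.smul_apply, smul_eq_mul, mul_assoc]
    simp only [PiLp.smul_apply]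
    rw [hsmul, hsmul, hsmul, hsmul, (hu φ hφ).1, (hu φ hφ).2]
    constructor <;> ring

/-- The `m`-th Fourier coefficient `(1/2π) ∫ u(x, L) e^{-imx} dx` of the trace of `u ∈ H¹_per` on
the side `z = L`. The trace is expressed by the Gauss-Green formula: with the cut-off
`χ(z) = (z + L) / 2L` one has `u(x, L) = ∫ ∂_z (χ u) dz`. -/
def traceRight (S : PeriodicSlab) (u : S.H1per) (m : ℤ) : ℂ :=
  1 / (2 * Real.pi) * ∫ p in S.cell, Complex.exp (-Complex.I * m * p.1) *
    (((p.2 + S.L) / (2 * S.L) : ℝ) * u.1 2 p + (1 / (2 * S.L) : ℝ) * u.1 0 p)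

/-- The `m`-th Fourier coefficient `(1/2π) ∫ u(x, -L) e^{-imx} dx` of the trace of `u ∈ H¹_per` on
the side `z = -L`: with `χ(z) = (L - z) / 2L` one has `u(x, -L) = -∫ ∂_z (χ u) dz`. -/
def traceLeft (S : PeriodicSlab) (u : S.H1per) (m : ℤ) : ℂ :=
  1 / (2 * Real.pi) * ∫ p in S.cell, Complex.exp (-Complex.I * m * p.1) *
    ((1 / (2 * S.L) : ℝ) * u.1 0 p - ((S.L - p.2) / (2 * S.L) : ℝ) * u.1 2 p)

/-! ### The variational form of the scattering problem -/

/-- The pairing `∫_Γ (N u) v̄` with the Dirichlet-to-Neumann map `N`, which multiplies the `m`-th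
Fourier coefficient by `-i η_m`; the factor `2π` is the length of each side. -/
def dtnForm (S : PeriodicSlab) (p : ℝ × ℝ) (u v : S.H1per) : ℂ :=
  2 * Real.pi * ∑' m : ℤ, (-Complex.I * S.eta p m) *
    (S.traceRight u m * star (S.traceRight v m) + S.traceLeft u m * star (S.traceLeft v m))

/-- The form `h(u, v) = ∫ μ⁻¹ (∇ + iκ)u · (∇ - iκ)v̄ + μ₀⁻¹ ∫_Γ (N u) v̄`, with `κ = (κ, 0)`. -/
def hForm (S : PeriodicSlab) (p : ℝ × ℝ) (u v : S.H1per) : ℂ :=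
  (∫ q in S.cell, ((S.μ q)⁻¹ : ℂ) *
    ((u.1 1 q + Complex.I * p.1 * u.1 0 q) * star (v.1 1 q + Complex.I * p.1 * v.1 0 q)
      + u.1 2 q * star (v.1 2 q)))
  + (S.μ₀⁻¹ : ℂ) * S.dtnForm p u v

/-- The form `b(u, v) = ∫ ε u v̄`. -/
def bForm (S : PeriodicSlab) (u v : S.H1per) : ℂ :=
  ∫ q in S.cell, (S.ε q : ℂ) * (u.1 0 q * star (v.1 0 q))

/-- The source form `p(v) = μ₀⁻¹ ∫_Γ (∂_n u_inc + N u_inc) v̄` of the incident field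
`u_inc = e^{iη₀z}` coming from the left. The outward normal derivative is `∂_z` on `z = L` and
`-∂_z` on `z = -L`, and only the Fourier coefficient `m = 0` of the field is nonzero. -/
def sourceForm (S : PeriodicSlab) (p : ℝ × ℝ) (v : S.H1per) : ℂ :=
  let η₀ := S.eta p 0
  let eR := Complex.exp (Complex.I * η₀ * S.L)
  let eL := Complex.exp (-Complex.I * η₀ * S.L)
  (S.μ₀⁻¹ : ℂ) * (2 * Real.pi) *
    ((Complex.I * η₀ * eR + -Complex.I * η₀ * eR) * star (S.traceRight v 0)
      + (-(Complex.I * η₀ * eL) + -Complex.I * η₀ * eL) * star (S.traceLeft v 0))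

/-- `u` solves the scattering problem for the incident field `e^{iη₀z}`, in variational form. -/
def IsScatteringSolution (S : PeriodicSlab) (p : ℝ × ℝ) (u : S.H1per) : Prop :=
  ∀ v : S.H1per, S.hForm p u v - (p.2 : ℂ) ^ 2 * S.bForm u v = S.sourceForm p v

open Classical in
/-- A solution of the scattering problem; one exists for every pair in the diamond. -/
def scatteringSolution (S : PeriodicSlab) (p : ℝ × ℝ) : S.H1per :=
  if h : ∃ u, S.IsScatteringSolution p u then h.choose else 0

/-- The reflection coefficient `R(κ, ω)`: the propagating part of the field for `z ≤ -L` is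
`e^{iη₀z} + R e^{-iη₀z}`, here evaluated at `z = -L`. -/
def refl (S : PeriodicSlab) (p : ℝ × ℝ) : ℂ :=
  Complex.exp (-Complex.I * S.eta p 0 * S.L) *
    (S.traceLeft (S.scatteringSolution p) 0 - Complex.exp (-Complex.I * S.eta p 0 * S.L))

/-- The transmission coefficient `T(κ, ω)`: the propagating part of the field for `z ≥ L` is
`T e^{iη₀z}`, here evaluated at `z = L`. -/
def trans (S : PeriodicSlab) (p : ℝ × ℝ) : ℂ :=
  Complex.exp (-Complex.I * S.eta p 0 * S.L) * S.traceRight (S.scatteringSolution p) 0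

/-! ### The scattering operator and its simple eigenvalue -/

open Classical in
/-- The bounded operator `C` on `H¹_per` that represents a bounded sesquilinear form `c`:
`(C u, v) = c(u, v)` (Mathlib's inner product is linear in its second argument). -/
def opOfForm (S : PeriodicSlab) (c : S.H1per → S.H1per → ℂ) : S.H1per →L[ℂ] S.H1per :=
  if h : ∃ C : S.H1per →L[ℂ] S.H1per, ∀ u v, inner ℂ v (C u) = c u v then h.choose else 0

/-- The operator of the form `c₁ = h + b`. -/
def opC₁ (S : PeriodicSlab) (p : ℝ × ℝ) : S.H1per →L[ℂ] S.H1per :=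
  S.opOfForm fun u v => S.hForm p u v + S.bForm u v

/-- The operator of the form `c₂ = -(ω² + 1) b`. -/
def opC₂ (S : PeriodicSlab) (p : ℝ × ℝ) : S.H1per →L[ℂ] S.H1per :=
  S.opOfForm fun u v => -((p.2 : ℂ) ^ 2 + 1) * S.bForm u v

/-- The operator `A(κ, ω) = I + C₁⁻¹ C₂`. -/
def opA (S : PeriodicSlab) (p : ℝ × ℝ) : S.H1per →L[ℂ] S.H1per :=
  1 + Ring.inverse (S.opC₁ p) * S.opC₂ p

/-- `lam` is a continuous branch, over the set `U` of pairs `(κ, ω)`, of (algebraically) simple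
eigenvalues of `A(κ, ω)`, and it is the only eigenvalue that takes the value `0` there. -/
structure IsSimpleEigenvalueBranch (S : PeriodicSlab) (U : Set (ℝ × ℝ)) (lam : ℝ × ℝ → ℂ) :
    Prop where
  continuousOn : ContinuousOn lam U
  simple : ∀ p ∈ U,
    Module.finrank ℂ (Module.End.maxGenEigenspace (S.opA p : S.H1per →ₗ[ℂ] S.H1per) (lam p)) = 1
  unique : ∀ p ∈ U,
    Module.End.HasEigenvalue (S.opA p : S.H1per →ₗ[ℂ] S.H1per) 0 → lam p = 0

end PeriodicSlab

/-- Near `(κ₀, ω₀)`,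
`F(κ, ω) = (ω - ω₀ + s₁ (κ - κ₀) + s₂ (κ - κ₀)² + ⋯) · E(κ, ω)`
with `E` analytic and `E(κ₀, ω₀) = v`. (The value `s 0` plays no role.) -/
def HasWeierstrassExpansion (F : ℝ × ℝ → ℂ) (κ₀ ω₀ : ℝ) (s : ℕ → ℂ) (v : ℂ) : Prop :=
  ∃ E : ℝ × ℝ → ℂ, AnalyticAt ℝ E (κ₀, ω₀) ∧ E (κ₀, ω₀) = v ∧
    ∀ᶠ p : ℝ × ℝ in 𝓝 (κ₀, ω₀), ∃ w : ℂ,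
      HasSum (fun n : ℕ => s (n + 1) * ((p.1 - κ₀ : ℝ) : ℂ) ^ (n + 1)) w ∧
      F p = (((p.2 - ω₀ : ℝ) : ℂ) + w) * E p

/-- Near `(κ₀, ω₀)`, `f` is the real-analytic function
`f(κ) = ω₀ - s₁ (κ - κ₀) - s₂ (κ - κ₀)² - ⋯` (with real coefficients), and the zero set of the
function `c` is the graph of `f`. -/
def IsZeroCurve (c : ℝ × ℝ → ℂ) (κ₀ ω₀ : ℝ) (s : ℕ → ℂ) (f : ℝ → ℝ) : Prop :=
  AnalyticAt ℝ f κ₀ ∧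
  (∀ᶠ κ in 𝓝 κ₀,
    HasSum (fun n : ℕ => s (n + 1) * ((κ - κ₀ : ℝ) : ℂ) ^ (n + 1)) ((ω₀ - f κ : ℝ) : ℂ)) ∧
  ∀ᶠ p : ℝ × ℝ in 𝓝 (κ₀, ω₀), (c p = 0 ↔ p.2 = f p.1)

/-- The germ of `f` at `κ₀` extends to a real-analytic function `g` on an interval `(κ₁, κ₂)` whose
graph lies in `W` and in the zero set of `c`; at each end of the interval `g` has a limit, and the
end point of the graph lies on the boundary of `W`, or it lies in `W` and `∂c/∂ω` vanishes there. -/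
def ExtendsToBoundaryOrDegeneracy (c : ℝ × ℝ → ℂ) (W : Set (ℝ × ℝ)) (κ₀ : ℝ) (f : ℝ → ℝ) : Prop :=
  ∃ (κ₁ κ₂ ω₁ ω₂ : ℝ) (g : ℝ → ℝ), κ₁ < κ₀ ∧ κ₀ < κ₂ ∧
    AnalyticOnNhd ℝ g (Ioo κ₁ κ₂) ∧ g =ᶠ[𝓝 κ₀] f ∧
    (∀ κ ∈ Ioo κ₁ κ₂, (κ, g κ) ∈ W ∧ c (κ, g κ) = 0) ∧
    Tendsto g (𝓝[>] κ₁) (𝓝 ω₁) ∧ Tendsto g (𝓝[<] κ₂) (𝓝 ω₂) ∧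
    ((κ₁, ω₁) ∈ frontier W ∨
      ((κ₁, ω₁) ∈ W ∧ HasDerivAt (fun ω : ℝ => c (κ₁, ω)) 0 ω₁)) ∧
    ((κ₂, ω₂) ∈ frontier W ∨
      ((κ₂, ω₂) ∈ W ∧ HasDerivAt (fun ω : ℝ => c (κ₂, ω)) 0 ω₂))

end

/-!
The scattering problem is written as `A(κ, ω) u = g(κ, ω)` in `H¹_per` with `A = I + C₁⁻¹ C₂`, where
`C₁` is coercive (`exists_le_re_inner_opC₁`), `C₂` is compact by Rellich's theorem
(`isCompactOperator_component_zero`), and both depend analytically on `(κ, ω)`. For the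
Dirichlet-to-Neumann map this is proved by viewing the sequence `η_m / (1 + |m|)` as an analytic
square root in `ℓ^∞(ℤ)` (`isComplexAnalyticAt_symbol`), sandwiched between weighted trace operators
into `ℓ²(ℤ)`. Throughout, "analytic" means extendable to complex `(κ, ω)` near the given real pair.

A simple eigenvalue is studied through the bordered operator `B = A + φ ⊗ u`, which is invertible.
The number `1 - φ(B⁻¹ u)` is a nonvanishing analytic multiple of the eigenvalue
(`exists_analytic_factor`), hence the eigenvalue is analytic, and so are the products of the
eigenvalue with `R` and `T`, because guided modes carry no propagating order
(`trace_eq_zero_of_opA`). The antihermitian part of the form `h - ω² b` comes from the propagating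
order alone (`scatteringForm_sub_star`). Applied to a solution, and to a solution and its mirror
image, this gives conservation of energy `|a|² + |b|² = |ℓ|²` and the phase relation `Re(a b̄) = 0`.
Applied to a guided mode, it shows that `ℓ` is real to first order up to a constant factor.

From these relations everything else follows by local analysis (`exists_anomaly_expansion`). The
Weierstrass preparation theorem factors `ℓ`, `a` and `b`. On lines and parabolas through the
guided-mode pair, the leading terms of the two relations give `r₁ = t₁ = ℓ₁` and `Im r₂ = Im t₂`. If
`r₂ ≠ t₂` then the distance of order `(κ - κ₀)²` between the real parts of the two roots forces both
roots to be real by the phase relation (`eventually_root_real`). If `r₂ = t₂` then `r₂` is `ℓ₂` or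
its conjugate, and `Im ℓ₂ > 0` makes the cubic remainders negligible in `|a/ℓ|` and `|b/ℓ|`
(`tendsto_norm_div`). The zero curves are continued by the implicit function theorem
(`extendsToBoundaryOrDegeneracy`); they cannot oscillate at an end, since `a` or `b` would then vanish
on an open set that meets the curve.
-/

noncomputable section

/-! ### Division and Weierstrass preparation for analytic functions of two variables -/

/-- The projection `(x, y) ↦ (x, 0)`. -/
def projFst : ℂ × ℂ →L[ℂ] ℂ × ℂ :=
  (ContinuousLinearMap.inl ℂ ℂ ℂ).comp (ContinuousLinearMap.fst ℂ ℂ ℂ)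

theorem norm_projFst_le : ‖projFst‖ ≤ 1 :=
  ContinuousLinearMap.opNorm_le_bound _ zero_le_one fun v => by
    simp [projFst, Prod.norm_def]

/-- The power series of the quotient `(G(x, y) - G(x, 0)) / y`, where `p` is the power series of
`G` at the origin. The `n`-th term comes from telescoping `p (n + 1)` between `(x, y)` and `(x, 0)`:
the slot `i` receives `(0, 1)`, the slots before it `(x, y)`, and those after it `(x, 0)`. -/
def quotientSeries (p : FormalMultilinearSeries ℂ (ℂ × ℂ) ℂ) :
    FormalMultilinearSeries ℂ (ℂ × ℂ) ℂ := fun n =>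
  ∑ i : Fin (n + 1), ((p (n + 1)).curryMid i ((0, 1) : ℂ × ℂ)).compContinuousLinearMap
    fun j : Fin n => if (j : ℕ) < i then ContinuousLinearMap.id ℂ (ℂ × ℂ) else projFst

theorem norm_quotientSeries_le (p : FormalMultilinearSeries ℂ (ℂ × ℂ) ℂ) (n : ℕ) :
    ‖quotientSeries p n‖ ≤ (n + 1) * ‖p (n + 1)‖ := by
  refine (norm_sum_le _ _).trans ?_
  have : ∀ i ∈ (Finset.univ : Finset (Fin (n + 1))),
      ‖((p (n + 1)).curryMid i ((0, 1) : ℂ × ℂ)).compContinuousLinearMap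
        fun j : Fin n => if (j : ℕ) < i then ContinuousLinearMap.id ℂ (ℂ × ℂ) else projFst‖
        ≤ ‖p (n + 1)‖ := by
    intro i _
    refine (ContinuousMultilinearMap.norm_compContinuousLinearMap_le _ _).trans ?_
    have h1 : ‖(p (n + 1)).curryMid i ((0, 1) : ℂ × ℂ)‖ ≤ ‖p (n + 1)‖ := by
      refine (((p (n + 1)).curryMid i).le_opNorm _).trans ?_
      rw [ContinuousMultilinearMap.norm_curryMid]
      simp [Prod.norm_def]
    have h2 : ∏ j : Fin n, ‖if (j : ℕ) < i then ContinuousLinearMap.id ℂ (ℂ × ℂ) else projFst‖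
        ≤ 1 := by
      refine Finset.prod_le_one (fun _ _ => norm_nonneg _) fun j _ => ?_
      split_ifs
      · exact ContinuousLinearMap.norm_id_le
      · exact norm_projFst_le
    calc _ ≤ ‖p (n + 1)‖ * 1 := by gcongr
      _ = _ := mul_one _
  refine (Finset.sum_le_sum this).trans ?_
  simp

theorem mul_quotientSeries (p : FormalMultilinearSeries ℂ (ℂ × ℂ) ℂ) (n : ℕ) (v : ℂ × ℂ) :
    v.2 * quotientSeries p n (fun _ => v)
      = p (n + 1) (fun _ => v) - p (n + 1) (fun _ => projFst v) := by
  let f : ℕ → ℂ := fun k => p (n + 1) fun j => if (j : ℕ) < k then v else projFst v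
  have hf : ∀ i : Fin (n + 1), v.2 * ((p (n + 1)).curryMid i ((0, 1) : ℂ × ℂ)
      (fun j : Fin n => (if (j : ℕ) < i then ContinuousLinearMap.id ℂ (ℂ × ℂ) else projFst) v))
      = f (i + 1) - f i := by
    intro i
    have key : ∀ x : ℂ × ℂ, (p (n + 1)) (i.insertNth x (fun j : Fin n =>
        (if (j : ℕ) < i then ContinuousLinearMap.id ℂ (ℂ × ℂ) else projFst) v))
        = p (n + 1) (Function.update
          (fun j : Fin (n + 1) => if (j : ℕ) < i then v else projFst v) i x) := by
      intro x
      congr 1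
      refine (Fin.insertNth_eq_iff).2 ⟨by simp, ?_⟩
      funext j
      rw [Fin.removeNth, Function.update_of_ne (Fin.succAbove_ne i j)]
      by_cases h : (j : ℕ) < i
      · have h' : ((i.succAbove j : Fin (n + 1)) : ℕ) < i := by
          rw [Fin.succAbove_of_castSucc_lt _ _ (by simpa [Fin.lt_def] using h)]
          simpa using h
        simp [h, h']
      · have h' : ¬ ((i.succAbove j : Fin (n + 1)) : ℕ) < i := by
          rw [Fin.succAbove_of_le_castSucc _ _ (by simpa [Fin.le_def] using h)]
          simp; omega
        simp [h, h']
    have e1 : f (i + 1) = p (n + 1) (Function.update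
          (fun j : Fin (n + 1) => if (j : ℕ) < i then v else projFst v) i v) := by
      simp only [f]
      congr 1
      funext j
      by_cases hj : j = i
      · subst hj; simp
      · have : (j : ℕ) ≠ i := fun h => hj (Fin.ext h)
        rw [Function.update_of_ne hj]
        by_cases h : (j : ℕ) < i
        · rw [if_pos h, if_pos (by omega)]
        · rw [if_neg h, if_neg (by omega)]
    have e2 : f i = p (n + 1) (Function.update
          (fun j : Fin (n + 1) => if (j : ℕ) < i then v else projFst v) i (projFst v)) := by
      simp only [f]
      congr 1
      rw [eq_comm, Function.update_eq_self_iff]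
      simp
    rw [ContinuousMultilinearMap.curryMid_apply, key, e1, e2,
      ← ContinuousMultilinearMap.map_update_sub, ← smul_eq_mul,
      ← ContinuousMultilinearMap.map_update_smul]
    congr 2
    ext <;> simp [projFst]
  simp only [quotientSeries, _root_.sum_apply,
    ContinuousMultilinearMap.compContinuousLinearMap_apply, Finset.mul_sum]
  rw [Finset.sum_congr rfl fun i _ => hf i, Fin.sum_univ_eq_sum_range (fun k => f (k + 1) - f k),
    Finset.sum_range_sub]
  simp only [f, Fin.is_lt, if_true, not_lt_zero, if_false]

/-- An analytic function that vanishes on the axis `y = 0` is divisible by `y`. -/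
theorem AnalyticAt.exists_eq_snd_mul {G : ℂ × ℂ → ℂ} (hG : AnalyticAt ℂ G 0)
    (h0 : ∀ᶠ x : ℂ in 𝓝 0, G (x, 0) = 0) :
    ∃ E : ℂ × ℂ → ℂ, AnalyticAt ℂ E 0 ∧ ∀ᶠ v in 𝓝 0, G v = v.2 * E v := by
  obtain ⟨p, hp⟩ := hG
  have hrad : 0 < (quotientSeries p).radius := by
    obtain ⟨r, hr0, hr⟩ := ENNReal.lt_iff_exists_nnreal_btwn.1 hp.radius_pos
    have hr0' : (0 : ℝ) < r := by exact_mod_cast hr0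
    obtain ⟨C, hC, hCn⟩ := p.norm_mul_pow_le_of_lt_radius hr
    have : (((r / 2 : NNReal)) : ENNReal) ≤ (quotientSeries p).radius := by
      refine (quotientSeries p).le_radius_of_bound (C / r) fun n => ?_
      have h1 := hCn (n + 1)
      have h2 : ((n : ℝ) + 1) ≤ 2 ^ n := by
        exact_mod_cast Nat.lt_two_pow_self
      calc ‖quotientSeries p n‖ * ((r / 2 : NNReal) : ℝ) ^ n
          ≤ ((n + 1) * ‖p (n + 1)‖) * ((r / 2 : NNReal) : ℝ) ^ n := by
            gcongr; exact norm_quotientSeries_le p n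
        _ ≤ (2 ^ n * ‖p (n + 1)‖) * ((r / 2 : NNReal) : ℝ) ^ n := by gcongr
        _ = (‖p (n + 1)‖ * (r : ℝ) ^ (n + 1)) / r := by
            push_cast
            rw [div_pow, pow_succ]
            field_simp
        _ ≤ C / r := by gcongr
    refine lt_of_lt_of_le ?_ this
    have : (0 : NNReal) < r / 2 := by
      have : (0 : NNReal) < r := by exact_mod_cast hr0
      positivity
    exact_mod_cast this
  have hq := (quotientSeries p).hasFPowerSeriesOnBall hrad
  refine ⟨(quotientSeries p).sum, hq.analyticAt, ?_⟩
  have hcont : Tendsto projFst (𝓝 0) (𝓝 0) := by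
    simpa using projFst.continuous.tendsto 0
  have hz : ∀ᶠ v : ℂ × ℂ in 𝓝 0, G (projFst v) = 0 := by
    have : Tendsto (fun v : ℂ × ℂ => v.1) (𝓝 0) (𝓝 0) := continuous_fst.tendsto' _ _ rfl
    filter_upwards [this.eventually h0] with v hv
    simpa [projFst] using hv
  filter_upwards [hp.eventually_hasSum, hcont.eventually hp.eventually_hasSum,
    hq.hasFPowerSeriesAt.eventually_hasSum, hz] with v h1 h2 h3 h4
  simp only [zero_add] at h1 h2 h3
  rw [h4] at h2
  have h5 := h1.sub h2
  rw [sub_zero] at h5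
  have h6 := (hasSum_nat_add_iff' 1).2 h5
  have h7 := h3.mul_left v.2
  simp only [mul_quotientSeries] at h7
  have h8 := h6.unique h7
  have h9 : (p 0 fun _ => v) = p 0 fun _ => projFst v := congrArg _ (Subsingleton.elim _ _)
  simpa [h9] using h8

/-- The inclusion of real pairs into complex pairs. -/
def ofRealPair (p : ℝ × ℝ) : ℂ × ℂ := (p.1, p.2)

theorem continuous_ofRealPair : Continuous ofRealPair := by
  unfold ofRealPair; fun_prop

theorem analyticAt_ofRealPair (p : ℝ × ℝ) : AnalyticAt ℝ ofRealPair p :=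
  ((Complex.ofRealCLM.analyticAt _).comp analyticAt_fst).prod
    ((Complex.ofRealCLM.analyticAt _).comp analyticAt_snd)

/-- Near `p`, the function `F` of two real variables is the restriction of a complex-analytic
function of two complex variables. This is equivalent to real analyticity, but the extension is
what the zeros with complex `ω` are taken from. -/
def IsComplexAnalyticAt {V : Type*} [NormedAddCommGroup V] [NormedSpace ℂ V] (F : ℝ × ℝ → V)
    (p : ℝ × ℝ) : Prop :=
  ∃ G : ℂ × ℂ → V, AnalyticAt ℂ G (ofRealPair p) ∧ ∀ᶠ q in 𝓝 p, F q = G (ofRealPair q)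

theorem AnalyticAt.comp_ofRealPair {G : ℂ × ℂ → ℂ} {p : ℝ × ℝ}
    (hG : AnalyticAt ℂ G (ofRealPair p)) : AnalyticAt ℝ (fun q => G (ofRealPair q)) p :=
  (hG.restrictScalars (𝕜 := ℝ)).comp (analyticAt_ofRealPair p)

theorem IsComplexAnalyticAt.analyticAt {F : ℝ × ℝ → ℂ} {p : ℝ × ℝ}
    (h : IsComplexAnalyticAt F p) : AnalyticAt ℝ F p := by
  obtain ⟨G, hG, hFG⟩ := h
  exact hG.comp_ofRealPair.congr (hFG.mono fun _ h => h.symm)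

namespace IsComplexAnalyticAt

variable {V V' V'' : Type*} [NormedAddCommGroup V] [NormedSpace ℂ V] [NormedAddCommGroup V']
  [NormedSpace ℂ V'] [NormedAddCommGroup V''] [NormedSpace ℂ V''] {p : ℝ × ℝ}

theorem const (v : V) : IsComplexAnalyticAt (fun _ => v) p :=
  ⟨fun _ => v, analyticAt_const, .of_forall fun _ => rfl⟩

theorem congr {F F' : ℝ × ℝ → V} (h : IsComplexAnalyticAt F p) (h' : F =ᶠ[𝓝 p] F') :
    IsComplexAnalyticAt F' p := by
  obtain ⟨G, hG, hFG⟩ := h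
  refine ⟨G, hG, ?_⟩
  filter_upwards [hFG, h'] with q h1 h2
  rw [← h2, h1]

theorem prodMk {F : ℝ × ℝ → V} {F' : ℝ × ℝ → V'} (h : IsComplexAnalyticAt F p)
    (h' : IsComplexAnalyticAt F' p) : IsComplexAnalyticAt (fun q => (F q, F' q)) p := by
  obtain ⟨G, hG, hFG⟩ := h
  obtain ⟨G', hG', hFG'⟩ := h'
  refine ⟨fun q => (G q, G' q), hG.prod hG', ?_⟩
  filter_upwards [hFG, hFG'] with q h1 h2
  rw [h1, h2]

theorem comp {F : ℝ × ℝ → V} {Φ : V → V'} (hΦ : AnalyticAt ℂ Φ (F p))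
    (h : IsComplexAnalyticAt F p) : IsComplexAnalyticAt (fun q => Φ (F q)) p := by
  obtain ⟨G, hG, hFG⟩ := h
  refine ⟨fun q => Φ (G q), AnalyticAt.comp (by rwa [← hFG.self_of_nhds]) hG, ?_⟩
  filter_upwards [hFG] with q h1
  rw [h1]

theorem add {F F' : ℝ × ℝ → V} (h : IsComplexAnalyticAt F p) (h' : IsComplexAnalyticAt F' p) :
    IsComplexAnalyticAt (fun q => F q + F' q) p :=
  comp (Φ := fun v : V × V => v.1 + v.2) (analyticAt_fst.add analyticAt_snd) (h.prodMk h')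

theorem sub {F F' : ℝ × ℝ → V} (h : IsComplexAnalyticAt F p) (h' : IsComplexAnalyticAt F' p) :
    IsComplexAnalyticAt (fun q => F q - F' q) p :=
  comp (Φ := fun v : V × V => v.1 - v.2) (analyticAt_fst.sub analyticAt_snd) (h.prodMk h')

theorem smul {F : ℝ × ℝ → ℂ} {F' : ℝ × ℝ → V} (h : IsComplexAnalyticAt F p)
    (h' : IsComplexAnalyticAt F' p) : IsComplexAnalyticAt (fun q => F q • F' q) p :=
  comp (Φ := fun v : ℂ × V => v.1 • v.2) (analyticAt_fst.smul analyticAt_snd) (h.prodMk h')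

theorem mul {𝒜 : Type*} [NormedRing 𝒜] [NormedAlgebra ℂ 𝒜] {F F' : ℝ × ℝ → 𝒜}
    (h : IsComplexAnalyticAt F p) (h' : IsComplexAnalyticAt F' p) :
    IsComplexAnalyticAt (fun q => F q * F' q) p :=
  comp (Φ := fun v : 𝒜 × 𝒜 => v.1 * v.2) (analyticAt_fst.mul analyticAt_snd) (h.prodMk h')

theorem const_mul {F : ℝ × ℝ → ℂ} (h : IsComplexAnalyticAt F p) (c : ℂ) :
    IsComplexAnalyticAt (fun q => c * F q) p :=
  (const c).mul h

theorem clm_apply {F : ℝ × ℝ → V →L[ℂ] V'} {F' : ℝ × ℝ → V} (h : IsComplexAnalyticAt F p)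
    (h' : IsComplexAnalyticAt F' p) : IsComplexAnalyticAt (fun q => F q (F' q)) p :=
  comp (Φ := fun v : (V →L[ℂ] V') × V => v.1 v.2)
    (ContinuousLinearMap.analyticAt_bilinear (ContinuousLinearMap.id ℂ (V →L[ℂ] V')) _)
    (h.prodMk h')

theorem clm_comp {F : ℝ × ℝ → V} (h : IsComplexAnalyticAt F p) (Λ : V →L[ℂ] V') :
    IsComplexAnalyticAt (fun q => Λ (F q)) p :=
  comp (Λ.analyticAt _) h

theorem inverse {𝒜 : Type*} [NormedRing 𝒜] [NormedAlgebra ℂ 𝒜] [CompleteSpace 𝒜] {F : ℝ × ℝ → 𝒜}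
    (h : IsComplexAnalyticAt F p) (hu : IsUnit (F p)) :
    IsComplexAnalyticAt (fun q => Ring.inverse (F q)) p := by
  obtain ⟨u, hu⟩ := hu
  exact comp (by rw [← hu]; exact analyticAt_inverse u) h

theorem div {F F' : ℝ × ℝ → ℂ} (h : IsComplexAnalyticAt F p) (h' : IsComplexAnalyticAt F' p)
    (h0 : F' p ≠ 0) : IsComplexAnalyticAt (fun q => F q / F' q) p :=
  comp (Φ := fun v : ℂ × ℂ => v.1 / v.2) (analyticAt_fst.div analyticAt_snd h0) (h.prodMk h')

theorem ofReal_fst : IsComplexAnalyticAt (fun q => (q.1 : ℂ)) p :=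
  ⟨fun q => q.1, analyticAt_fst, .of_forall fun _ => rfl⟩

theorem ofReal_snd : IsComplexAnalyticAt (fun q => (q.2 : ℂ)) p :=
  ⟨fun q => q.2, analyticAt_snd, .of_forall fun _ => rfl⟩

theorem isBigO_sub {F : ℝ × ℝ → V} (h : IsComplexAnalyticAt F p) :
    (fun q => F q - F p) =O[𝓝 p] fun q => ‖q - p‖ := by
  obtain ⟨G, hG, hFG⟩ := h
  have h1 := (hG.differentiableAt.isBigO_sub).comp_tendsto (continuous_ofRealPair.tendsto p)
  refine h1.congr' ?_ EventuallyEq.rfl |>.trans (Asymptotics.isBigO_of_le _ fun q => ?_)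
  · filter_upwards [hFG] with q hq
    rw [hq, hFG.self_of_nhds]
    rfl
  · simp only [Function.comp_apply, ofRealPair, Prod.norm_def, Prod.fst_sub, Prod.snd_sub]
    rw [← Complex.ofReal_sub, ← Complex.ofReal_sub, Complex.norm_real, Complex.norm_real,
      Real.norm_of_nonneg (le_max_of_le_left (norm_nonneg _))]

theorem continuousAt {F : ℝ × ℝ → V} (h : IsComplexAnalyticAt F p) : ContinuousAt F p := by
  obtain ⟨G, hG, hFG⟩ := h
  exact (hG.continuousAt.comp continuous_ofRealPair.continuousAt).congr
    (hFG.mono fun _ h => h.symm)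

end IsComplexAnalyticAt

/-- The analytic implicit function theorem for a scalar equation `G(v, y) = 0`. -/
theorem AnalyticAt.exists_implicit {𝕜 V : Type*} [RCLike 𝕜] [NormedAddCommGroup V]
    [NormedSpace 𝕜 V] [CompleteSpace V] {G : V × 𝕜 → 𝕜} {v : V} {y : 𝕜}
    (hG : AnalyticAt 𝕜 G (v, y)) (h0 : G (v, y) = 0)
    (hd : deriv (fun z => G (v, z)) y ≠ 0) :
    ∃ S : V → 𝕜, AnalyticAt 𝕜 S v ∧ S v = y ∧
      ∀ᶠ q in 𝓝 (v, y), (G q = 0 ↔ S q.1 = q.2) := by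
  have cdf : ContDiffAt 𝕜 ⊤ G (v, y) := hG.contDiffAt
  have hn : (⊤ : WithTop ℕ∞) ≠ 0 := by simp
  have hder : HasDerivAt (fun z => G (v, z)) (fderiv 𝕜 G (v, y) (0, 1)) y := by
    have h1 : HasFDerivAt G (fderiv 𝕜 G (v, y)) (v, y) := hG.differentiableAt.hasFDerivAt
    have h2 : HasDerivAt (fun z : 𝕜 => (v, z)) ((0 : V), (1 : 𝕜)) y :=
      (hasDerivAt_const y v).prodMk (hasDerivAt_id y)
    exact h1.comp_hasDerivAt y h2
  rw [hder.deriv] at hd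
  have hinv : (fderiv 𝕜 G (v, y) ∘L ContinuousLinearMap.inr 𝕜 V 𝕜).IsInvertible := by
    refine ⟨ContinuousLinearEquiv.unitsEquivAut 𝕜 (Units.mk0 _ hd), ?_⟩
    ext
    simp
  refine ⟨cdf.implicitFunction hn hinv, ?_, cdf.implicitFunction_apply_self hn hinv, ?_⟩
  · exact (cdf.contDiffAt_implicitFunction hn hinv).analyticAt
  · have := cdf.eventually_apply_eq_iff_implicitFunction hn hinv
    rwa [h0] at this

/-- A Weierstrass factorisation `F(κ, ω) = (ω - ω₀ + A(κ)) E(κ, ω)` near `(κ₀, ω₀)` of a function of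
two real variables: `A` is the sum of the series `∑ sₙ (κ - κ₀)ⁿ` over `n ≥ 1`, and `E` is analytic
with value `v` at `(κ₀, ω₀)`. -/
structure WeierstrassFactorization (F : ℝ × ℝ → ℂ) (κ₀ ω₀ : ℝ) (s : ℕ → ℂ) (v : ℂ) (A : ℝ → ℂ)
    (E : ℝ × ℝ → ℂ) : Prop where
  analytic_root : AnalyticAt ℝ A κ₀
  hasSum_root : ∀ᶠ κ : ℝ in 𝓝 κ₀,
    HasSum (fun n : ℕ => s (n + 1) * ((κ - κ₀ : ℝ) : ℂ) ^ (n + 1)) (A κ)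
  root_taylor : (fun κ : ℝ => A κ - s 1 * ((κ - κ₀ : ℝ) : ℂ) - s 2 * ((κ - κ₀ : ℝ) : ℂ) ^ 2)
    =O[𝓝 κ₀] fun κ => |κ - κ₀| ^ 3
  analytic_unit : AnalyticAt ℝ E (κ₀, ω₀)
  unit_apply : E (κ₀, ω₀) = v
  eq_mul : ∀ᶠ p : ℝ × ℝ in 𝓝 (κ₀, ω₀), F p = (((p.2 - ω₀ : ℝ) : ℂ) + A p.1) * E p

theorem WeierstrassFactorization.hasWeierstrassExpansion {F : ℝ × ℝ → ℂ} {κ₀ ω₀ : ℝ}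
    {s : ℕ → ℂ} {v : ℂ} {A : ℝ → ℂ} {E : ℝ × ℝ → ℂ}
    (h : WeierstrassFactorization F κ₀ ω₀ s v A E) : HasWeierstrassExpansion F κ₀ ω₀ s v := by
  refine ⟨E, h.analytic_unit, h.unit_apply, ?_⟩
  have : Tendsto (fun p : ℝ × ℝ => p.1) (𝓝 (κ₀, ω₀)) (𝓝 κ₀) := continuous_fst.tendsto' _ _ rfl
  filter_upwards [h.eq_mul, this.eventually h.hasSum_root] with p h1 h2
  exact ⟨A p.1, h2, h1⟩

theorem IsComplexAnalyticAt.exists_weierstrassFactorization {F : ℝ × ℝ → ℂ} {κ₀ ω₀ : ℝ}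
    (hF : IsComplexAnalyticAt F (κ₀, ω₀)) (h0 : F (κ₀, ω₀) = 0)
    (hd : deriv (fun ω : ℝ => F (κ₀, ω)) ω₀ ≠ 0) :
    ∃ s A E, WeierstrassFactorization F κ₀ ω₀ s (deriv (fun ω : ℝ => F (κ₀, ω)) ω₀) A E := by
  obtain ⟨G, hG, hFG⟩ := hF
  have hG0 : G (ofRealPair (κ₀, ω₀)) = 0 := by rw [← hFG.self_of_nhds, h0]
  have hline : HasDerivAt (fun z : ℂ => G (κ₀, z))
      (fderiv ℂ G (ofRealPair (κ₀, ω₀)) (0, 1)) ω₀ := by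
    have h1 : HasFDerivAt G (fderiv ℂ G (ofRealPair (κ₀, ω₀))) ((κ₀ : ℂ), (ω₀ : ℂ)) :=
      hG.differentiableAt.hasFDerivAt
    exact h1.comp_hasDerivAt (ω₀ : ℂ) ((hasDerivAt_const (ω₀ : ℂ) (κ₀ : ℂ)).prodMk (hasDerivAt_id _))
  have hreal : HasDerivAt (fun ω : ℝ => F (κ₀, ω))
      (fderiv ℂ G (ofRealPair (κ₀, ω₀)) (0, 1)) ω₀ := by
    refine hline.comp_ofReal.congr_of_eventuallyEq ?_
    have : Tendsto (fun ω : ℝ => (κ₀, ω)) (𝓝 ω₀) (𝓝 (κ₀, ω₀)) :=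
      (by fun_prop : Continuous fun ω : ℝ => (κ₀, ω)).tendsto' _ _ rfl
    filter_upwards [this.eventually hFG] with ω h using h
  have hdG : deriv (fun z : ℂ => G (κ₀, z)) ω₀ = deriv (fun ω : ℝ => F (κ₀, ω)) ω₀ := by
    rw [hline.deriv, hreal.deriv]
  set v := deriv (fun ω : ℝ => F (κ₀, ω)) ω₀ with hv
  obtain ⟨S, hS, hS0, hSiff⟩ := AnalyticAt.exists_implicit (V := ℂ) (v := (κ₀ : ℂ)) (y := (ω₀ : ℂ))
    hG hG0 (by rwa [hdG])
  -- Straighten the complex zero set to the axis `y = 0` and divide by `y`.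
  let Ψ : ℂ × ℂ → ℂ × ℂ := fun q => (κ₀ + q.1, S (κ₀ + q.1) + q.2)
  have hΨ0 : Ψ 0 = ofRealPair (κ₀, ω₀) := by simp [Ψ, ofRealPair, hS0]
  have hΨ : AnalyticAt ℂ Ψ 0 := by
    have h1 : AnalyticAt ℂ (fun q : ℂ × ℂ => (κ₀ : ℂ) + q.1) 0 := analyticAt_const.add analyticAt_fst
    have h2 : AnalyticAt ℂ (fun q : ℂ × ℂ => S (κ₀ + q.1)) 0 :=
      AnalyticAt.comp (f := fun q : ℂ × ℂ => (κ₀ : ℂ) + q.1) (by simpa using hS) h1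
    exact h1.prod (h2.add analyticAt_snd)
  have hGΨ : AnalyticAt ℂ (fun q => G (Ψ q)) 0 := AnalyticAt.comp (by rwa [hΨ0]) hΨ
  have hvan : ∀ᶠ x : ℂ in 𝓝 0, G (Ψ (x, 0)) = 0 := by
    have ht : Tendsto (fun x : ℂ => Ψ (x, 0)) (𝓝 0) (𝓝 (ofRealPair (κ₀, ω₀))) := by
      rw [← hΨ0]
      have : Tendsto (fun x : ℂ => (x, (0 : ℂ))) (𝓝 0) (𝓝 0) :=
        (by fun_prop : Continuous fun x : ℂ => (x, (0 : ℂ))).tendsto' _ _ rfl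
      exact hΨ.continuousAt.tendsto.comp this
    filter_upwards [ht.eventually hSiff] with x hx
    exact hx.2 (by simp [Ψ])
  obtain ⟨E, hE, hGE⟩ := hGΨ.exists_eq_snd_mul hvan
  let Θ : ℂ × ℂ → ℂ × ℂ := fun q => (q.1 - κ₀, q.2 - S q.1)
  have hΘ0 : Θ (ofRealPair (κ₀, ω₀)) = 0 := by simp [Θ, ofRealPair, hS0]
  have hΘ : AnalyticAt ℂ Θ (ofRealPair (κ₀, ω₀)) := by
    have h2 : AnalyticAt ℂ (fun q : ℂ × ℂ => S q.1) (ofRealPair (κ₀, ω₀)) :=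
      AnalyticAt.comp (f := fun q : ℂ × ℂ => q.1) (by simpa [ofRealPair] using hS) analyticAt_fst
    exact (analyticAt_fst.sub analyticAt_const).prod (analyticAt_snd.sub h2)
  have hEΘ : AnalyticAt ℂ (fun q => E (Θ q)) (ofRealPair (κ₀, ω₀)) :=
    AnalyticAt.comp (by rwa [hΘ0]) hΘ
  have hfac : ∀ᶠ q in 𝓝 (ofRealPair (κ₀, ω₀)), G q = (q.2 - S q.1) * E (Θ q) := by
    have ht : Tendsto Θ (𝓝 (ofRealPair (κ₀, ω₀))) (𝓝 0) := by
      have := hΘ.continuousAt.tendsto; rwa [hΘ0] at this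
    filter_upwards [ht.eventually hGE] with q hq
    simpa [Ψ, Θ] using hq
  obtain ⟨p, hp⟩ := hS
  have hsum : ∀ᶠ x : ℂ in 𝓝 0, HasSum (fun n => p.coeff n * x ^ n) (S (κ₀ + x)) := by
    filter_upwards [hp.eventually_hasSum] with x hx
    have hfun : (fun n => p n fun _ => x) = fun n => p.coeff n * x ^ n := by
      funext n
      rw [p.apply_eq_pow_smul_coeff, smul_eq_mul, mul_comm]
    rwa [hfun] at hx
  let s : ℕ → ℂ := fun n => -p.coeff n
  have hc0 : p.coeff 0 = ω₀ := by
    have := hsum.self_of_nhds.unique (hasSum_single 0 (fun n hn => by simp [hn]))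
    simpa [hS0] using this.symm
  let A : ℝ → ℂ := fun κ => ω₀ - S κ
  have hκ : Tendsto (fun κ : ℝ => ((κ - κ₀ : ℝ) : ℂ)) (𝓝 κ₀) (𝓝 0) :=
    (by fun_prop : Continuous fun κ : ℝ => ((κ - κ₀ : ℝ) : ℂ)).tendsto' _ _ (by simp)
  refine ⟨s, A, fun q => E (Θ (ofRealPair q)), ?_, ?_, ?_, hEΘ.comp_ofRealPair, ?_, ?_⟩
  · exact analyticAt_const.sub (((hp.analyticAt).restrictScalars (𝕜 := ℝ)).comp
      (Complex.ofRealCLM.analyticAt κ₀))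
  · filter_upwards [hκ.eventually hsum] with κ h
    have h' := (hasSum_nat_add_iff' 1).2 h
    have h'' := h'.neg
    have hA : -(S (↑κ₀ + ↑(κ - κ₀)) - ∑ i ∈ Finset.range 1, p.coeff i * ((κ - κ₀ : ℝ) : ℂ) ^ i)
        = A κ := by simp [A, hc0]
    rw [hA] at h''
    simpa only [s, neg_mul] using h''
  · have hO := (hp.isBigO_sub_partialSum_pow 3)
    have := (hO.comp_tendsto hκ).neg_left
    refine (this.congr' (.of_forall fun κ => ?_) (.of_forall fun κ => ?_))
    · simp [A, s, FormalMultilinearSeries.partialSum, Finset.sum_range_succ,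
        p.apply_eq_pow_smul_coeff, hc0]
      ring
    · rw [Function.comp_apply, Complex.norm_real, Real.norm_eq_abs]
  · have : HasDerivAt (fun z : ℂ => G (κ₀, z)) (E 0) ω₀ := by
      have h1 : HasDerivAt (fun z : ℂ => (z - S κ₀) * E (Θ (κ₀, z)))
          (1 * E (Θ (κ₀, ω₀)) + ((ω₀ : ℂ) - S κ₀) * deriv (fun z : ℂ => E (Θ (κ₀, z))) ω₀) ω₀ := by
        refine ((hasDerivAt_id (ω₀ : ℂ)).sub_const _).mul (DifferentiableAt.hasDerivAt ?_)
        exact DifferentiableAt.comp (ω₀ : ℂ) (f := fun z : ℂ => ((κ₀ : ℂ), z))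
          (g := fun q => E (Θ q)) hEΘ.differentiableAt (by fun_prop)
      rw [hS0, sub_self, zero_mul, add_zero, one_mul] at h1
      have h2 : Θ (κ₀, ω₀) = 0 := hΘ0
      rw [h2] at h1
      refine h1.congr_of_eventuallyEq ?_
      have ht : Tendsto (fun z : ℂ => ((κ₀ : ℂ), z)) (𝓝 (ω₀ : ℂ)) (𝓝 (ofRealPair (κ₀, ω₀))) :=
        (by fun_prop : Continuous fun z : ℂ => ((κ₀ : ℂ), z)).tendsto' _ _ rfl
      filter_upwards [ht.eventually hfac] with z hz
      simpa [hS0] using hz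
    rw [← hdG, this.deriv, hΘ0]
  · filter_upwards [hFG, (continuous_ofRealPair.tendsto _).eventually hfac] with q h1 h2
    rw [h1, h2]
    simp [ofRealPair, A]

/-! ### Local analysis of the resonance -/

namespace WeierstrassFactorization

variable {F : ℝ × ℝ → ℂ} {κ₀ ω₀ : ℝ} {s : ℕ → ℂ} {v : ℂ} {A : ℝ → ℂ} {E : ℝ × ℝ → ℂ}

theorem root_apply (h : WeierstrassFactorization F κ₀ ω₀ s v A E) : A κ₀ = 0 := by
  have := h.hasSum_root.self_of_nhds
  simp only [sub_self, Complex.ofReal_zero, ne_eq, Nat.add_eq_zero_iff, one_ne_zero, and_false,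
    not_false_eq_true, zero_pow, mul_zero] at this
  exact this.unique hasSum_zero

theorem const_mul (h : WeierstrassFactorization F κ₀ ω₀ s v A E) (c : ℂ) :
    WeierstrassFactorization (fun p => c * F p) κ₀ ω₀ s (c * v) A (fun p => c * E p) where
  analytic_root := h.analytic_root
  hasSum_root := h.hasSum_root
  root_taylor := h.root_taylor
  analytic_unit := analyticAt_const.mul h.analytic_unit
  unit_apply := by rw [h.unit_apply]
  eq_mul := h.eq_mul.mono fun p hp => by rw [hp]; ring

/-- The remainder of the root after its linear term, on the scale `(κ - κ₀)²`. -/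
theorem tendsto_root_div_sq (h : WeierstrassFactorization F κ₀ ω₀ s v A E) :
    Tendsto (fun κ : ℝ => (A κ - s 1 * ((κ - κ₀ : ℝ) : ℂ)) / ((κ - κ₀ : ℝ) : ℂ) ^ 2)
      (𝓝[≠] κ₀) (𝓝 (s 2)) := by
  have h1 : (fun κ : ℝ => A κ - s 1 * ((κ - κ₀ : ℝ) : ℂ) - s 2 * ((κ - κ₀ : ℝ) : ℂ) ^ 2)
      =o[𝓝 κ₀] fun κ => ((κ - κ₀ : ℝ) : ℂ) ^ 2 := by
    refine h.root_taylor.trans_isLittleO ?_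
    have h2 : (fun κ : ℝ => |κ - κ₀|) =o[𝓝 κ₀] fun _ => (1 : ℝ) := by
      rw [Asymptotics.isLittleO_one_iff]
      exact (by fun_prop : Continuous fun κ : ℝ => |κ - κ₀|).tendsto' _ _ (by simp)
    have h3 : (fun κ : ℝ => |κ - κ₀| ^ 2) =O[𝓝 κ₀] fun κ => ‖((κ - κ₀ : ℝ) : ℂ) ^ 2‖ :=
      Asymptotics.isBigO_of_le _ fun κ => by
        simp only [norm_pow, Complex.norm_real, Real.norm_eq_abs, abs_abs, le_refl]
    have := h2.mul_isBigO h3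
    rw [← Asymptotics.isLittleO_norm_right]
    simpa only [← pow_succ', one_mul] using this
  have h4 := (h1.mono nhdsWithin_le_nhds).tendsto_div_nhds_zero (l := 𝓝[≠] κ₀)
  have h5 := h4.add_const (s 2)
  rw [zero_add] at h5
  refine h5.congr' ?_
  filter_upwards [self_mem_nhdsWithin] with κ hκ
  have : ((κ - κ₀ : ℝ) : ℂ) ≠ 0 := by
    exact_mod_cast sub_ne_zero.2 hκ
  field_simp
  ring

/-- A curve `ω = ω₀ + g(κ)` with `g(κ) = O(κ - κ₀)` approaches `(κ₀, ω₀)`. -/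
theorem tendsto_unit_curve (h : WeierstrassFactorization F κ₀ ω₀ s v A E) {g : ℝ → ℝ}
    (hg : Tendsto g (𝓝 κ₀) (𝓝 0)) :
    Tendsto (fun κ => E (κ, ω₀ + g κ)) (𝓝[≠] κ₀) (𝓝 v) := by
  have h1 : Tendsto (fun κ => (κ, ω₀ + g κ)) (𝓝[≠] κ₀) (𝓝 (κ₀, ω₀)) := by
    refine Tendsto.mono_left ?_ nhdsWithin_le_nhds
    have := (tendsto_id (x := 𝓝 κ₀)).prodMk_nhds (hg.const_add ω₀)
    simpa using this
  have h2 := h.analytic_unit.continuousAt.tendsto.comp h1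
  rwa [h.unit_apply] at h2

theorem eventually_curve (h : WeierstrassFactorization F κ₀ ω₀ s v A E) {g : ℝ → ℝ}
    (hg : Tendsto g (𝓝 κ₀) (𝓝 0)) :
    ∀ᶠ κ in 𝓝 κ₀, F (κ, ω₀ + g κ) = ((g κ : ℂ) + A κ) * E (κ, ω₀ + g κ) := by
  have h1 : Tendsto (fun κ => (κ, ω₀ + g κ)) (𝓝 κ₀) (𝓝 (κ₀, ω₀)) := by
    have := (tendsto_id (x := 𝓝 κ₀)).prodMk_nhds (hg.const_add ω₀)
    simpa using this
  filter_upwards [h1.eventually h.eq_mul] with κ hκ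
  simpa using hκ

/-- Linear scaling: along `ω = ω₀ - c (κ - κ₀)`, `F / (κ - κ₀)` tends to `(s₁ - c) v`. -/
theorem tendsto_linear (h : WeierstrassFactorization F κ₀ ω₀ s v A E) (c : ℝ) :
    Tendsto (fun κ => F (κ, ω₀ + -c * (κ - κ₀)) / ((κ - κ₀ : ℝ) : ℂ)) (𝓝[≠] κ₀)
      (𝓝 ((s 1 - c) * v)) := by
  have hg : Tendsto (fun κ => -c * (κ - κ₀)) (𝓝 κ₀) (𝓝 0) :=
    (by fun_prop : Continuous fun κ : ℝ => -c * (κ - κ₀)).tendsto' _ _ (by simp)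
  have hK : Tendsto (fun κ : ℝ => ((κ - κ₀ : ℝ) : ℂ)) (𝓝[≠] κ₀) (𝓝 0) :=
    ((by fun_prop : Continuous fun κ : ℝ => ((κ - κ₀ : ℝ) : ℂ)).tendsto' _ _ (by simp)).mono_left
      nhdsWithin_le_nhds
  have h1 := ((h.tendsto_root_div_sq.mul hK).const_add (s 1 - c)).mul (h.tendsto_unit_curve hg)
  rw [mul_zero, add_zero] at h1
  refine h1.congr' ?_
  filter_upwards [self_mem_nhdsWithin, nhdsWithin_le_nhds (h.eventually_curve hg)] with κ hκ h2
  have : ((κ - κ₀ : ℝ) : ℂ) ≠ 0 := by exact_mod_cast sub_ne_zero.2 hκ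
  rw [h2, Complex.ofReal_mul, Complex.ofReal_neg]
  field_simp
  ring

/-- Quadratic scaling: if `s₁` is real then along `ω = ω₀ - s₁ (κ - κ₀) + y (κ - κ₀)²` the quotient
`F / (κ - κ₀)²` tends to `(y + s₂) v`. -/
theorem tendsto_quadratic (h : WeierstrassFactorization F κ₀ ω₀ s v A E) {c : ℝ} (hc : s 1 = c)
    (y : ℝ) :
    Tendsto (fun κ => F (κ, ω₀ + (-c * (κ - κ₀) + y * (κ - κ₀) ^ 2)) / ((κ - κ₀ : ℝ) : ℂ) ^ 2)
      (𝓝[≠] κ₀) (𝓝 ((y + s 2) * v)) := by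
  have hg : Tendsto (fun κ => -c * (κ - κ₀) + y * (κ - κ₀) ^ 2) (𝓝 κ₀) (𝓝 0) :=
    (by fun_prop : Continuous fun κ : ℝ => -c * (κ - κ₀) + y * (κ - κ₀) ^ 2).tendsto' _ _ (by simp)
  have h1 := (h.tendsto_root_div_sq.const_add (y : ℂ)).mul (h.tendsto_unit_curve hg)
  refine h1.congr' ?_
  filter_upwards [self_mem_nhdsWithin, nhdsWithin_le_nhds (h.eventually_curve hg)] with κ hκ h2
  have : ((κ - κ₀ : ℝ) : ℂ) ≠ 0 := by exact_mod_cast sub_ne_zero.2 hκ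
  rw [h2, hc, Complex.ofReal_add, Complex.ofReal_mul, Complex.ofReal_mul, Complex.ofReal_neg,
    Complex.ofReal_pow]
  field_simp
  ring

theorem eventually_eq_zero_iff (h : WeierstrassFactorization F κ₀ ω₀ s v A E) (hv : v ≠ 0) :
    ∀ᶠ p : ℝ × ℝ in 𝓝 (κ₀, ω₀), (F p = 0 ↔ ((p.2 - ω₀ : ℝ) : ℂ) + A p.1 = 0) := by
  have h1 : ∀ᶠ p in 𝓝 (κ₀, ω₀), E p ≠ 0 :=
    h.analytic_unit.continuousAt.eventually_ne (by rwa [h.unit_apply])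
  filter_upwards [h.eq_mul, h1] with p h2 h3
  rw [h2, mul_eq_zero, or_iff_left h3]

/-- On the axis `κ = κ₀` the quotient of two factorised functions is the quotient of the units. -/
theorem tendsto_div_axis {F' : ℝ × ℝ → ℂ} {s' : ℕ → ℂ} {v' : ℂ} {A' : ℝ → ℂ} {E' : ℝ × ℝ → ℂ}
    (h : WeierstrassFactorization F κ₀ ω₀ s v A E)
    (h' : WeierstrassFactorization F' κ₀ ω₀ s' v' A' E') (hv' : v' ≠ 0) :
    Tendsto (fun ω => F (κ₀, ω) / F' (κ₀, ω)) (𝓝[≠] ω₀) (𝓝 (v / v')) := by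
  have hline : Tendsto (fun ω : ℝ => (κ₀, ω)) (𝓝[≠] ω₀) (𝓝 (κ₀, ω₀)) :=
    ((by fun_prop : Continuous fun ω : ℝ => (κ₀, ω)).tendsto' _ _ rfl).mono_left nhdsWithin_le_nhds
  have h1 := (h.analytic_unit.continuousAt.tendsto.comp hline).div
    (h'.analytic_unit.continuousAt.tendsto.comp hline) (by rwa [h'.unit_apply])
  rw [h.unit_apply, h'.unit_apply] at h1
  refine h1.congr' ?_
  filter_upwards [self_mem_nhdsWithin, hline.eventually h.eq_mul, hline.eventually h'.eq_mul]
    with ω hω h2 h3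
  have : ((ω - ω₀ : ℝ) : ℂ) ≠ 0 := by exact_mod_cast sub_ne_zero.2 hω
  rw [h2, h3, h.root_apply, h'.root_apply, add_zero, mul_div_mul_left _ _ this]
  rfl

end WeierstrassFactorization

/-- The coefficients of a convergent real power series that vanishes near `0` are zero. -/
theorem eq_zero_of_hasSum_zero {c : ℕ → ℝ}
    (h : ∀ᶠ x : ℝ in 𝓝 0, HasSum (fun n => c (n + 1) * x ^ (n + 1)) 0) {n : ℕ} (hn : 1 ≤ n) :
    c n = 0 := by
  let d : ℕ → ℝ := fun n => if n = 0 then 0 else c n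
  have h1 : HasFPowerSeriesAt (0 : ℝ → ℝ) (FormalMultilinearSeries.ofScalars ℝ d) 0 := by
    rw [hasFPowerSeriesAt_iff]
    filter_upwards [h] with x hx
    have h2 : HasSum (fun n => d (n + 1) * x ^ (n + 1)) 0 := by simpa [d] using hx
    have h3 := (hasSum_nat_add_iff (f := fun n => d n * x ^ n) 1).1 h2
    simpa [d, mul_comm] using h3
  have h2 := h1.eq_zero
  have h3 : (FormalMultilinearSeries.ofScalars ℝ d).coeff n = 0 := by rw [h2]; rfl
  rw [FormalMultilinearSeries.coeff_ofScalars] at h3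
  simpa [d, Nat.one_le_iff_ne_zero.1 hn] using h3

theorem IsZeroCurve.taylor {c : ℝ × ℝ → ℂ} {κ₀ ω₀ : ℝ} {s : ℕ → ℂ} {f : ℝ → ℝ}
    (h : IsZeroCurve c κ₀ ω₀ s f) :
    f κ₀ = ω₀ ∧ deriv f κ₀ = -(s 1).re ∧ iteratedDeriv 2 f κ₀ = -2 * (s 2).re := by
  obtain ⟨-, hsum, -⟩ := h
  let d : ℕ → ℝ := fun n => if n = 0 then ω₀ else -(s n).re
  have h1 : HasFPowerSeriesAt f (FormalMultilinearSeries.ofScalars ℝ d) κ₀ := by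
    rw [hasFPowerSeriesAt_iff]
    have ht : Tendsto (fun x => κ₀ + x) (𝓝 0) (𝓝 κ₀) :=
      (by fun_prop : Continuous fun x : ℝ => κ₀ + x).tendsto' _ _ (by simp)
    filter_upwards [ht.eventually hsum] with x hx
    have h2 := (Complex.hasSum_re hx).neg
    have h3 : HasSum (fun n => d (n + 1) * x ^ (n + 1)) (f (κ₀ + x) - ω₀) := by
      have e1 : -(((ω₀ - f (κ₀ + x) : ℝ) : ℂ).re) = f (κ₀ + x) - ω₀ := by
        rw [Complex.ofReal_re]; ring
      rw [e1] at h2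
      have e2 : (fun n : ℕ => -(s (n + 1) * ((κ₀ + x - κ₀ : ℝ) : ℂ) ^ (n + 1)).re)
          = fun n => d (n + 1) * x ^ (n + 1) := by
        funext n
        rw [add_sub_cancel_left, ← Complex.ofReal_pow, Complex.re_mul_ofReal]
        simp [d]
      rwa [e2] at h2
    have h4 := (hasSum_nat_add_iff (f := fun n => d n * x ^ n) 1).1 h3
    simpa [d, mul_comm] using h4
  have hco : ∀ n, iteratedDeriv n f κ₀ = n.factorial * d n := by
    intro n
    have := h1.analyticAt
    obtain ⟨r, hr⟩ := h1
    have h5 := hr.factorial_smul (1 : ℝ) n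
    rw [FormalMultilinearSeries.apply_eq_pow_smul_coeff,
      FormalMultilinearSeries.coeff_ofScalars] at h5
    rw [iteratedDeriv_eq_iteratedFDeriv, ← h5]
    simp
  refine ⟨?_, ?_, ?_⟩
  · simpa [d] using hco 0
  · simpa [d] using hco 1
  · simpa [d] using hco 2

/-- The local data of a resonance: the functions `ℓ`, `a`, `b` of the real pair `(κ, ω)` vanish at
`(κ₀, ω₀)` and are factorised there, and they satisfy the conservation of energy
`|a|² + |b|² = |ℓ|²` and the phase relation `Re(a b̄) = 0` of a symmetric scatterer. -/
structure ResonanceExpansion (ℓ a b : ℝ × ℝ → ℂ) (κ₀ ω₀ : ℝ) (l r t : ℕ → ℂ) (va vb : ℂ)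
    (Al Aa Ab : ℝ → ℂ) (El Ea Eb : ℝ × ℝ → ℂ) : Prop where
  facl : WeierstrassFactorization ℓ κ₀ ω₀ l 1 Al El
  faca : WeierstrassFactorization a κ₀ ω₀ r va Aa Ea
  facb : WeierstrassFactorization b κ₀ ω₀ t vb Ab Eb
  energy : ∀ᶠ p in 𝓝 (κ₀, ω₀), ‖a p‖ ^ 2 + ‖b p‖ ^ 2 = ‖ℓ p‖ ^ 2
  phase : ∀ᶠ p in 𝓝 (κ₀, ω₀), (a p * star (b p)).re = 0
  va_ne : va ≠ 0
  vb_ne : vb ≠ 0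

namespace ResonanceExpansion

variable {ℓ a b : ℝ × ℝ → ℂ} {κ₀ ω₀ : ℝ} {l r t : ℕ → ℂ} {va vb : ℂ} {Al Aa Ab : ℝ → ℂ}
  {El Ea Eb : ℝ × ℝ → ℂ}

/-- A limit of the energy and phase relations along a path, after division by a common factor. -/
theorem limit_relations (h : ResonanceExpansion ℓ a b κ₀ ω₀ l r t va vb Al Aa Ab El Ea Eb)
    {F : Filter ℝ} [F.NeBot] {path : ℝ → ℝ × ℝ} {d : ℝ → ℂ} {x y z : ℂ}
    (hp : Tendsto path F (𝓝 (κ₀, ω₀)))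
    (hl : Tendsto (fun κ => ℓ (path κ) / d κ) F (𝓝 x))
    (ha : Tendsto (fun κ => a (path κ) / d κ) F (𝓝 y))
    (hb : Tendsto (fun κ => b (path κ) / d κ) F (𝓝 z)) :
    ‖y‖ ^ 2 + ‖z‖ ^ 2 = ‖x‖ ^ 2 ∧ (y * star z).re = 0 := by
  constructor
  · have h1 := (ha.norm.pow 2).add (hb.norm.pow 2)
    refine tendsto_nhds_unique (h1.congr' ?_) (hl.norm.pow 2)
    filter_upwards [hp.eventually h.energy] with κ hκ
    rw [norm_div, norm_div, norm_div, div_pow, div_pow, div_pow, ← hκ]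
    ring
  · have h1 := (Complex.continuous_re.tendsto _).comp (ha.mul hb.star)
    refine tendsto_nhds_unique h1 (tendsto_const_nhds.congr' ?_)
    filter_upwards [hp.eventually h.phase] with κ hκ
    have : a (path κ) / d κ * star (b (path κ) / d κ)
        = ((‖d κ‖ ^ 2)⁻¹ : ℝ) * (a (path κ) * star (b (path κ))) := by
      rw [star_div₀]
      simp only [Complex.star_def]
      rw [div_mul_div_comm, Complex.mul_conj, Complex.normSq_eq_norm_sq]
      push_cast
      ring
    simp only [Function.comp_apply]
    rw [this, Complex.re_ofReal_mul, hκ, mul_zero]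

/-- The relations between the values of the units, obtained on the axis `κ = κ₀`. -/
theorem unit_relations (h : ResonanceExpansion ℓ a b κ₀ ω₀ l r t va vb Al Aa Ab El Ea Eb) :
    ‖va‖ ^ 2 + ‖vb‖ ^ 2 = 1 ∧ (va * star vb).re = 0 := by
  have hline : Tendsto (fun ω : ℝ => (κ₀, ω)) (𝓝[≠] ω₀) (𝓝 (κ₀, ω₀)) :=
    ((by fun_prop : Continuous fun ω : ℝ => (κ₀, ω)).tendsto' _ _ rfl).mono_left nhdsWithin_le_nhds
  have h1 := h.limit_relations hline (h.facl.tendsto_div_axis h.facl one_ne_zero)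
    (h.faca.tendsto_div_axis h.facl one_ne_zero) (h.facb.tendsto_div_axis h.facl one_ne_zero)
  simpa using h1

/-- As `v_a v̄_b` is imaginary, the two values differ in phase by `±π / 2`. -/
theorem exists_polar (h : ResonanceExpansion ℓ a b κ₀ ω₀ l r t va vb Al Aa Ab El Ea Eb) :
    ∃ r₀ t₀ γ : ℝ, 0 < r₀ ∧ r₀ < 1 ∧ 0 < |t₀| ∧ |t₀| < 1 ∧
      va = r₀ * Complex.exp (Complex.I * γ) ∧ vb = Complex.I * t₀ * Complex.exp (Complex.I * γ) := by
  obtain ⟨h1, h2⟩ := h.unit_relations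
  have ha := norm_pos_iff.2 h.va_ne
  have hb := norm_pos_iff.2 h.vb_ne
  set e := Complex.exp (Complex.I * Complex.arg va) with he
  have hva : va = ‖va‖ * e := by
    rw [he, mul_comm Complex.I, Complex.norm_mul_exp_arg_mul_I]
  have hen : ‖e‖ = 1 := by rw [he, mul_comm, Complex.norm_exp_ofReal_mul_I]
  have hee : star e * e = 1 := by
    rw [Complex.star_def, mul_comm, Complex.mul_conj, Complex.normSq_eq_norm_sq, hen]; simp
  have hre : (vb * star e).re = 0 := by
    have : (va * star vb).re = ‖va‖ * (vb * star e).re := by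
      conv_lhs => rw [hva]
      rw [mul_assoc, Complex.re_ofReal_mul]
      congr 1
      rw [← Complex.conj_re, map_mul, Complex.star_def, Complex.conj_conj, mul_comm]
    rw [this] at h2
    exact (mul_eq_zero.1 h2).resolve_left ha.ne'
  have hvb : vb = Complex.I * (vb * star e).im * e := by
    have hI : ∀ z : ℂ, z.re = 0 → z = Complex.I * z.im := fun z hz => by
      apply Complex.ext <;> simp [hz]
    have := hI _ hre
    rw [← this, mul_assoc, hee, mul_one]
  have ht : |(vb * star e).im| = ‖vb‖ := by
    have := congrArg norm hvb
    rw [norm_mul, norm_mul, hen, Complex.norm_I, Complex.norm_real, one_mul, mul_one] at this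
    exact this.symm
  refine ⟨‖va‖, (vb * star e).im, Complex.arg va, ha, by nlinarith, by rwa [ht], ?_, hva, hvb⟩
  rw [ht]; nlinarith

/-- The linear coefficients agree as soon as `ℓ₁` is real: on the line `ω = ω₀ - ℓ₁ (κ - κ₀)` the
linear part of `ℓ` vanishes, hence by the conservation of energy so do those of `a` and `b`. -/
theorem linear_coeff (h : ResonanceExpansion ℓ a b κ₀ ω₀ l r t va vb Al Aa Ab El Ea Eb)
    {c : ℝ} (hc : l 1 = c) : r 1 = c ∧ t 1 = c := by
  have hp : Tendsto (fun κ : ℝ => (κ, ω₀ + -c * (κ - κ₀))) (𝓝[≠] κ₀) (𝓝 (κ₀, ω₀)) :=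
    ((by fun_prop : Continuous fun κ : ℝ => (κ, ω₀ + -c * (κ - κ₀))).tendsto' _ _
      (by simp)).mono_left nhdsWithin_le_nhds
  have h1 := (h.limit_relations hp (h.facl.tendsto_linear c) (h.faca.tendsto_linear c)
    (h.facb.tendsto_linear c)).1
  rw [hc, sub_self, zero_mul, norm_zero, zero_pow two_ne_zero] at h1
  have e1 : ‖(r 1 - c) * va‖ = 0 := by
    nlinarith [sq_nonneg ‖(r 1 - c) * va‖, sq_nonneg ‖(t 1 - c) * vb‖]
  have e2 : ‖(t 1 - c) * vb‖ = 0 := by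
    nlinarith [sq_nonneg ‖(r 1 - c) * va‖, sq_nonneg ‖(t 1 - c) * vb‖]
  rw [norm_eq_zero, mul_eq_zero, sub_eq_zero] at e1 e2
  exact ⟨e1.resolve_right h.va_ne, e2.resolve_right h.vb_ne⟩

/-- The relations on the parabolas `ω = ω₀ - ℓ₁ (κ - κ₀) + y (κ - κ₀)²`. -/
theorem quadratic_relations (h : ResonanceExpansion ℓ a b κ₀ ω₀ l r t va vb Al Aa Ab El Ea Eb)
    {c : ℝ} (hc : l 1 = c) (y : ℝ) :
    ‖(y + r 2) * va‖ ^ 2 + ‖(y + t 2) * vb‖ ^ 2 = ‖(y + l 2)‖ ^ 2 ∧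
      ((y + r 2) * va * star ((y + t 2) * vb)).re = 0 := by
  have hp : Tendsto (fun κ : ℝ => (κ, ω₀ + (-c * (κ - κ₀) + y * (κ - κ₀) ^ 2)))
      (𝓝[≠] κ₀) (𝓝 (κ₀, ω₀)) :=
    ((by fun_prop : Continuous fun κ : ℝ =>
      (κ, ω₀ + (-c * (κ - κ₀) + y * (κ - κ₀) ^ 2))).tendsto' _ _ (by simp)).mono_left
        nhdsWithin_le_nhds
  obtain ⟨hr, ht⟩ := h.linear_coeff hc
  simpa using h.limit_relations hp (h.facl.tendsto_quadratic hc y)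
    (h.faca.tendsto_quadratic hr y) (h.facb.tendsto_quadratic ht y)

theorem im_units_ne (h : ResonanceExpansion ℓ a b κ₀ ω₀ l r t va vb Al Aa Ab El Ea Eb) :
    (va * star vb).im ≠ 0 := fun h0 => by
  have : va * star vb = 0 := Complex.ext h.unit_relations.2 h0
  rw [mul_eq_zero, star_eq_zero] at this
  exact this.elim h.va_ne h.vb_ne

/-- Since `v_a v̄_b` is imaginary, the phase relation on the parabolas says that
`(y + r₂) (y + t̄₂)` is real for all real `y`. -/
theorem im_quadratic_coeff (h : ResonanceExpansion ℓ a b κ₀ ω₀ l r t va vb Al Aa Ab El Ea Eb)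
    {c : ℝ} (hc : l 1 = c) : (r 2).im = (t 2).im := by
  have key : ∀ y : ℝ, ((y + r 2) * star ((y : ℂ) + t 2)).im = 0 := by
    intro y
    have h1 := (h.quadratic_relations hc y).2
    have h2 : (y + r 2) * va * star ((y + t 2) * vb)
        = ((y + r 2) * star ((y : ℂ) + t 2)) * (va * star vb) := by
      rw [star_mul']; ring
    rw [h2, Complex.mul_re, h.unit_relations.2, mul_zero, zero_sub, neg_eq_zero, mul_eq_zero] at h1
    exact h1.resolve_right h.im_units_ne
  have h0 := key 0
  have h1 := key 1
  simp at h0 h1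
  linarith

/-- If `a` and `b` have the same quadratic coefficient then it is `ℓ₂` or its conjugate, since
`|y + ℓ₂| = |y + r₂|` for all real `y`. -/
theorem quadratic_coeff_of_eq (h : ResonanceExpansion ℓ a b κ₀ ω₀ l r t va vb Al Aa Ab El Ea Eb)
    {c : ℝ} (hc : l 1 = c) (hrt : r 2 = t 2) (y : ℝ) : ‖(y + r 2)‖ = ‖(y + l 2)‖ := by
  have h1 := (h.quadratic_relations hc y).1
  rw [← hrt, norm_mul, norm_mul, mul_pow, mul_pow, ← mul_add, h.unit_relations.1, mul_one] at h1
  exact (pow_left_inj₀ (norm_nonneg _) (norm_nonneg _) two_ne_zero).1 h1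

/-- The root `A` of one of the two functions `a`, `b` is real if the difference `D` of the real
parts of the two roots dominates the imaginary part `β` of the other root: on the curve on which
`ω - ω₀ + A` is purely imaginary, the phase relation is `α (β Re ζ - D Im ζ) = 0` with `α = Im A`. -/
theorem eventually_im_eq_zero {α β D : ℝ → ℝ} {ζ : ℝ → ℂ} {z : ℂ} {x y : ℝ} {F : Filter ℝ}
    {d : ℝ → ℝ} (hζ : Tendsto ζ F (𝓝 z)) (hz : z.re = 0) (hz' : z.im ≠ 0)
    (hD : Tendsto (fun κ => D κ / d κ) F (𝓝 x)) (hβ : Tendsto (fun κ => β κ / d κ) F (𝓝 y))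
    (hx : x ≠ 0) (hrel : ∀ᶠ κ in F, α κ * (β κ * (ζ κ).re - D κ * (ζ κ).im) = 0) :
    ∀ᶠ κ in F, α κ = 0 := by
  have h1 := (hβ.mul ((Complex.continuous_re.tendsto _).comp hζ)).sub
    (hD.mul ((Complex.continuous_im.tendsto _).comp hζ))
  rw [hz, mul_zero, zero_sub] at h1
  have h2 := h1.eventually_ne (neg_ne_zero.2 (mul_ne_zero hx hz'))
  filter_upwards [h2, hrel] with κ h3 h4
  refine (mul_eq_zero.1 h4).resolve_right fun h5 => h3 ?_
  have : β κ / d κ * (ζ κ).re - D κ / d κ * (ζ κ).im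
      = (β κ * (ζ κ).re - D κ * (ζ κ).im) / d κ := by ring
  simp only [Function.comp_apply]
  rw [this, h5, zero_div]

theorem tendsto_root_re {F : ℝ × ℝ → ℂ} {s : ℕ → ℂ} {v : ℂ} {A : ℝ → ℂ} {E : ℝ × ℝ → ℂ}
    (h : WeierstrassFactorization F κ₀ ω₀ s v A E) {c : ℝ} (hc : s 1 = c) :
    Tendsto (fun κ => ((A κ).re - c * (κ - κ₀)) / (κ - κ₀) ^ 2) (𝓝[≠] κ₀) (𝓝 (s 2).re) ∧
      Tendsto (fun κ => (A κ).im / (κ - κ₀) ^ 2) (𝓝[≠] κ₀) (𝓝 (s 2).im) := by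
  have h1 := h.tendsto_root_div_sq
  rw [hc] at h1
  have e : ∀ κ : ℝ, (A κ - c * ((κ - κ₀ : ℝ) : ℂ)) / ((κ - κ₀ : ℝ) : ℂ) ^ 2
      = (A κ - (c * (κ - κ₀) : ℝ)) / (((κ - κ₀) ^ 2 : ℝ) : ℂ) := by
    intro κ; push_cast; rfl
  simp only [e] at h1
  constructor
  · have := (Complex.continuous_re.tendsto _).comp h1
    refine this.congr fun κ => ?_
    rw [Function.comp_apply, Complex.div_ofReal_re, Complex.sub_re, Complex.ofReal_re]
  · have := (Complex.continuous_im.tendsto _).comp h1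
    refine this.congr fun κ => ?_
    rw [Function.comp_apply, Complex.div_ofReal_im, Complex.sub_im, Complex.ofReal_im, sub_zero]

theorem tendsto_re_root {F : ℝ × ℝ → ℂ} {s : ℕ → ℂ} {v : ℂ} {A : ℝ → ℂ} {E : ℝ × ℝ → ℂ}
    (h : WeierstrassFactorization F κ₀ ω₀ s v A E) :
    Tendsto (fun κ => -(A κ).re) (𝓝 κ₀) (𝓝 0) := by
  have := ((Complex.continuous_re.tendsto _).comp h.analytic_root.continuousAt.tendsto).neg
  simpa [h.root_apply] using this

theorem tendsto_re_sub (h : ResonanceExpansion ℓ a b κ₀ ω₀ l r t va vb Al Aa Ab El Ea Eb)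
    {c : ℝ} (hc : l 1 = c) :
    Tendsto (fun κ => ((Ab κ).re - (Aa κ).re) / (κ - κ₀) ^ 2) (𝓝[≠] κ₀)
      (𝓝 ((t 2).re - (r 2).re)) := by
  obtain ⟨hr, ht⟩ := h.linear_coeff hc
  refine ((tendsto_root_re h.facb ht).1.sub (tendsto_root_re h.faca hr).1).congr fun κ => ?_
  ring

theorem re_sub_ne (h : ResonanceExpansion ℓ a b κ₀ ω₀ l r t va vb Al Aa Ab El Ea Eb)
    {c : ℝ} (hc : l 1 = c) (hrt : r 2 ≠ t 2) : (t 2).re - (r 2).re ≠ 0 := fun h0 =>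
  hrt (Complex.ext (by linarith) (h.im_quadratic_coeff hc))

/-- If the quadratic coefficients of `a` and `b` differ, then both roots are real. -/
theorem eventually_root_real (h : ResonanceExpansion ℓ a b κ₀ ω₀ l r t va vb Al Aa Ab El Ea Eb)
    {c : ℝ} (hc : l 1 = c) (hrt : r 2 ≠ t 2) :
    (∀ᶠ κ in 𝓝 κ₀, (Aa κ).im = 0) ∧ ∀ᶠ κ in 𝓝 κ₀, (Ab κ).im = 0 := by
  obtain ⟨hr, ht⟩ := h.linear_coeff hc
  have hD := h.tendsto_re_sub hc
  have hD0 := h.re_sub_ne hc hrt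
  have extend : ∀ {A : ℝ → ℂ}, A κ₀ = 0 → (∀ᶠ κ in 𝓝[≠] κ₀, (A κ).im = 0) →
      ∀ᶠ κ in 𝓝 κ₀, (A κ).im = 0 := by
    intro A h0 hA
    rw [eventually_nhdsWithin_iff] at hA
    filter_upwards [hA] with κ hκ
    by_cases hk : κ = κ₀
    · rw [hk, h0, Complex.zero_im]
    · exact hκ hk
  -- The phase relation on a curve, to be used with `g = -Re A` for each of the two roots `A`.
  have curve : ∀ {g : ℝ → ℝ}, Tendsto g (𝓝 κ₀) (𝓝 0) →
      Tendsto (fun κ => Ea (κ, ω₀ + g κ) * star (Eb (κ, ω₀ + g κ))) (𝓝[≠] κ₀) (𝓝 (va * star vb)) ∧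
      ∀ᶠ κ in 𝓝[≠] κ₀, (((g κ : ℂ) + Aa κ) * star ((g κ : ℂ) + Ab κ) *
        (Ea (κ, ω₀ + g κ) * star (Eb (κ, ω₀ + g κ)))).re = 0 := by
    intro g hg
    refine ⟨(h.faca.tendsto_unit_curve hg).mul (h.facb.tendsto_unit_curve hg).star, ?_⟩
    have hp : Tendsto (fun κ => (κ, ω₀ + g κ)) (𝓝 κ₀) (𝓝 (κ₀, ω₀)) := by
      have := (tendsto_id (x := 𝓝 κ₀)).prodMk_nhds (hg.const_add ω₀)
      simpa using this
    refine nhdsWithin_le_nhds ?_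
    filter_upwards [hp.eventually h.phase, h.faca.eventually_curve hg,
      h.facb.eventually_curve hg] with κ h1 h2 h3
    rw [h2, h3, star_mul'] at h1
    rw [← h1]
    congr 1
    ring
  constructor
  · refine extend h.faca.root_apply ?_
    obtain ⟨h1, h2⟩ := curve (tendsto_re_root h.faca)
    refine eventually_im_eq_zero h1 h.unit_relations.2 h.im_units_ne hD
      (tendsto_root_re h.facb ht).2 hD0 ?_
    filter_upwards [h2] with κ h3
    rw [← h3]
    simp [Complex.mul_re, Complex.mul_im]
    ring
  · refine extend h.facb.root_apply ?_
    obtain ⟨h1, h2⟩ := curve (tendsto_re_root h.facb)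
    refine eventually_im_eq_zero h1 h.unit_relations.2 h.im_units_ne hD
      (tendsto_root_re h.faca hr).2 hD0 ?_
    filter_upwards [h2] with κ h3
    rw [← h3]
    simp [Complex.mul_re, Complex.mul_im]
    ring

end ResonanceExpansion

namespace WeierstrassFactorization

variable {F : ℝ × ℝ → ℂ} {κ₀ ω₀ : ℝ} {s : ℕ → ℂ} {v : ℂ} {A : ℝ → ℂ} {E : ℝ × ℝ → ℂ}

theorem im_coeff_eq_zero (h : WeierstrassFactorization F κ₀ ω₀ s v A E)
    (hA : ∀ᶠ κ in 𝓝 κ₀, (A κ).im = 0) {n : ℕ} (hn : 1 ≤ n) : (s n).im = 0 := by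
  refine eq_zero_of_hasSum_zero (c := fun n => (s n).im) ?_ hn
  have ht : Tendsto (fun x => κ₀ + x) (𝓝 0) (𝓝 κ₀) :=
    (by fun_prop : Continuous fun x : ℝ => κ₀ + x).tendsto' _ _ (by simp)
  filter_upwards [ht.eventually hA, ht.eventually h.hasSum_root] with x h1 h2
  have h3 := Complex.hasSum_im h2
  rw [h1] at h3
  have e : (fun n : ℕ => (s (n + 1) * ((κ₀ + x - κ₀ : ℝ) : ℂ) ^ (n + 1)).im)
      = fun n => (s (n + 1)).im * x ^ (n + 1) := by
    funext n
    rw [add_sub_cancel_left, ← Complex.ofReal_pow, Complex.im_mul_ofReal]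
  rwa [e] at h3

theorem isZeroCurve (h : WeierstrassFactorization F κ₀ ω₀ s v A E) (hv : v ≠ 0)
    (hA : ∀ᶠ κ in 𝓝 κ₀, (A κ).im = 0) :
    IsZeroCurve F κ₀ ω₀ s (fun κ => ω₀ - (A κ).re) := by
  refine ⟨analyticAt_const.sub ((Complex.reCLM.analyticAt _).comp h.analytic_root), ?_, ?_⟩
  · filter_upwards [hA, h.hasSum_root] with κ h1 h2
    have : ((ω₀ - (ω₀ - (A κ).re) : ℝ) : ℂ) = A κ := by
      apply Complex.ext <;> simp [h1]
    rwa [this]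
  · have hf : Tendsto (fun p : ℝ × ℝ => p.1) (𝓝 (κ₀, ω₀)) (𝓝 κ₀) := continuous_fst.tendsto' _ _ rfl
    filter_upwards [h.eventually_eq_zero_iff hv, hf.eventually hA] with p h1 h2
    rw [h1, Complex.ext_iff]
    simp [h2]
    constructor <;> intro h3 <;> linarith

/-- If the linear coefficient is real and the quadratic one is not, the only real zero near
`(κ₀, ω₀)` is that point itself. -/
theorem eventually_ne_zero (h : WeierstrassFactorization F κ₀ ω₀ s v A E) (hv : v ≠ 0) {c : ℝ}
    (hc : s 1 = c) (hs : (s 2).im ≠ 0) : ∀ᶠ p in 𝓝[≠] (κ₀, ω₀), F p ≠ 0 := by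
  have h1 : ∀ᶠ κ in 𝓝[≠] κ₀, (A κ).im ≠ 0 := by
    filter_upwards [(ResonanceExpansion.tendsto_root_re h hc).2.eventually_ne hs] with κ hκ h0
    rw [h0, zero_div] at hκ
    exact hκ rfl
  rw [eventually_nhdsWithin_iff] at h1 ⊢
  have hf : Tendsto (fun p : ℝ × ℝ => p.1) (𝓝 (κ₀, ω₀)) (𝓝 κ₀) := continuous_fst.tendsto' _ _ rfl
  filter_upwards [h.eventually_eq_zero_iff hv, hf.eventually h1] with p h2 h3 hp
  rw [Ne, h2]
  intro h4
  by_cases hk : p.1 = κ₀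
  · rw [hk, h.root_apply, add_zero] at h4
    exact hp (Prod.ext hk (by simpa [sub_eq_zero] using h4))
  · have := congrArg Complex.im h4
    simp at this
    exact h3 hk this

end WeierstrassFactorization

namespace WeierstrassFactorization

variable {F : ℝ × ℝ → ℂ} {κ₀ ω₀ : ℝ} {s : ℕ → ℂ} {v : ℂ} {A : ℝ → ℂ} {E : ℝ × ℝ → ℂ}

/-- If a fixed nonzero multiple of `F` is real up to `o(|p - p₀|)`, then so is the linear
coefficient `s₁ = ∂_κ F / ∂_ω F`. -/
theorem exists_linear_coeff_real (h : WeierstrassFactorization F κ₀ ω₀ s 1 A E) {c : ℂ}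
    (hc : c ≠ 0)
    (ho : (fun p => (c * F p).im) =o[𝓝 (κ₀, ω₀)] fun p => ‖p - (κ₀, ω₀)‖) :
    ∃ x : ℝ, s 1 = x := by
  have im_zero : ∀ {path : ℝ → ℝ × ℝ} {d : ℝ → ℝ} {x₀ : ℝ} {z : ℂ},
      Tendsto path (𝓝[≠] x₀) (𝓝 (κ₀, ω₀)) → (∀ x, ‖path x - (κ₀, ω₀)‖ = |d x|) →
      Tendsto (fun x => F (path x) / (d x : ℂ)) (𝓝[≠] x₀) (𝓝 z) → (c * z).im = 0 := by
    intro path d x₀ z hp hd hz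
    have h1 := ((ho.comp_tendsto hp).trans_le (k := d) fun x => by
      simp [hd x]).tendsto_div_nhds_zero
    have h2 := (Complex.continuous_im.tendsto _).comp (hz.const_mul c)
    refine tendsto_nhds_unique (h2.congr fun x => ?_) h1
    simp only [Function.comp_apply]
    rw [← mul_div_assoc, Complex.div_ofReal_im]
  have hcim : c.im = 0 := by
    have hp : Tendsto (fun ω : ℝ => (κ₀, ω)) (𝓝[≠] ω₀) (𝓝 (κ₀, ω₀)) :=
      ((by fun_prop : Continuous fun ω : ℝ => (κ₀, ω)).tendsto' _ _ rfl).mono_left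
        nhdsWithin_le_nhds
    have h1 : Tendsto (fun ω => F (κ₀, ω) / ((ω - ω₀ : ℝ) : ℂ)) (𝓝[≠] ω₀) (𝓝 1) := by
      have h2 := h.analytic_unit.continuousAt.tendsto.comp hp
      rw [h.unit_apply] at h2
      refine h2.congr' ?_
      filter_upwards [self_mem_nhdsWithin, hp.eventually h.eq_mul] with ω hω h3
      have : ((ω - ω₀ : ℝ) : ℂ) ≠ 0 := by exact_mod_cast sub_ne_zero.2 hω
      rw [h3, h.root_apply, add_zero, mul_div_cancel_left₀ _ this]
      rfl
    simpa using im_zero hp (fun x => by simp [Prod.norm_def]) h1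
  have h1 : (c * s 1).im = 0 := by
    have hp : Tendsto (fun κ : ℝ => (κ, ω₀ + -0 * (κ - κ₀))) (𝓝[≠] κ₀) (𝓝 (κ₀, ω₀)) :=
      ((by fun_prop : Continuous fun κ : ℝ => (κ, ω₀ + -0 * (κ - κ₀))).tendsto' _ _
        (by simp)).mono_left nhdsWithin_le_nhds
    simpa using im_zero hp (fun x => by simp [Prod.norm_def]) (h.tendsto_linear 0)
  have hre : c.re ≠ 0 := fun h0 => hc (Complex.ext h0 hcim)
  refine ⟨(s 1).re, Complex.ext rfl ?_⟩
  rw [Complex.mul_im, hcim, zero_mul, add_zero] at h1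
  exact (mul_eq_zero.1 h1).resolve_left hre

/-- If two roots have the same real linear coefficient and quadratic coefficients that are equal or
conjugate and not real, then the moduli of the two functions have a limiting ratio. The cubic
remainders are negligible because the imaginary part keeps the denominator of order
`(κ - κ₀)²`. -/
theorem tendsto_norm_div {F' : ℝ × ℝ → ℂ} {s' : ℕ → ℂ} {A' : ℝ → ℂ} {E' : ℝ × ℝ → ℂ}
    (h : WeierstrassFactorization F κ₀ ω₀ s v A E)
    (h' : WeierstrassFactorization F' κ₀ ω₀ s' 1 A' E') {c : ℝ} (hc : s 1 = c) (hc' : s' 1 = c)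
    (him : (s' 2).im ≠ 0) (hs : ∀ y : ℝ, ‖(y + s 2)‖ = ‖(y + s' 2)‖) :
    Tendsto (fun p => ‖F p / F' p‖) (𝓝[≠] (κ₀, ω₀)) (𝓝 ‖v‖) := by
  have hf : Tendsto (fun p : ℝ × ℝ => p.1) (𝓝 (κ₀, ω₀)) (𝓝 κ₀) := continuous_fst.tendsto' _ _ rfl
  obtain ⟨C, hC⟩ := h.root_taylor.bound
  obtain ⟨C', hC'⟩ := h'.root_taylor.bound
  set m := |(s' 2).im| with hm
  have hm0 : 0 < m := abs_pos.2 him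
  set M := |C| + |C'| with hM
  have hsmall : ∀ᶠ κ in 𝓝 κ₀, M * |κ - κ₀| ≤ m / 2 := by
    have : Tendsto (fun κ => M * |κ - κ₀|) (𝓝 κ₀) (𝓝 0) :=
      (by fun_prop : Continuous fun κ => M * |κ - κ₀|).tendsto' _ _ (by simp)
    exact (this.eventually_lt_const (by positivity)).mono fun _ h => h.le
  have hratio : Tendsto (fun p : ℝ × ℝ => ‖((p.2 - ω₀ : ℝ) : ℂ) + A p.1‖
      / ‖((p.2 - ω₀ : ℝ) : ℂ) + A' p.1‖) (𝓝[≠] (κ₀, ω₀)) (𝓝 1) := by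
    rw [tendsto_iff_dist_tendsto_zero]
    have hlim : Tendsto (fun p : ℝ × ℝ => 2 * M / m * |p.1 - κ₀|) (𝓝[≠] (κ₀, ω₀)) (𝓝 0) :=
      ((by fun_prop : Continuous fun p : ℝ × ℝ => 2 * M / m * |p.1 - κ₀|).tendsto' _ _
        (by simp)).mono_left nhdsWithin_le_nhds
    refine squeeze_zero' (.of_forall fun _ => dist_nonneg) ?_ hlim
    filter_upwards [h'.eventually_ne_zero one_ne_zero hc' him,
      nhdsWithin_le_nhds (h'.eventually_eq_zero_iff one_ne_zero),
      nhdsWithin_le_nhds (hf.eventually hC), nhdsWithin_le_nhds (hf.eventually hC'),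
      nhdsWithin_le_nhds (hf.eventually hsmall)] with p h1 h2 h3 h4 h5
    rw [Ne, h2] at h1
    set K := p.1 - κ₀ with hK
    set X : ℝ := p.2 - ω₀ + c * K with hX
    set ρ := A p.1 - s 1 * (K : ℂ) - s 2 * (K : ℂ) ^ 2 with hρ
    set ρ' := A' p.1 - s' 1 * (K : ℂ) - s' 2 * (K : ℂ) ^ 2 with hρ'
    have e1 : ((p.2 - ω₀ : ℝ) : ℂ) + A p.1 = (X + s 2 * (K : ℂ) ^ 2) + ρ := by
      rw [hρ, hX, hc]; push_cast; ring
    have e2 : ((p.2 - ω₀ : ℝ) : ℂ) + A' p.1 = (X + s' 2 * (K : ℂ) ^ 2) + ρ' := by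
      rw [hρ', hX, hc']; push_cast; ring
    have e3 : ‖(X : ℂ) + s 2 * (K : ℂ) ^ 2‖ = ‖(X : ℂ) + s' 2 * (K : ℂ) ^ 2‖ := by
      by_cases hK0 : K = 0
      · simp [hK0]
      · have hKc : (K : ℂ) ≠ 0 := by exact_mod_cast hK0
        have e : ∀ z : ℂ, (X : ℂ) + z * (K : ℂ) ^ 2 = (K : ℂ) ^ 2 * ((X / K ^ 2 : ℝ) + z) := by
          intro z; push_cast; field_simp
        rw [e, e, norm_mul, norm_mul, hs]
    have e4 : m * |K| ^ 2 ≤ ‖(X : ℂ) + s' 2 * (K : ℂ) ^ 2‖ := by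
      have : ((X : ℂ) + s' 2 * (K : ℂ) ^ 2).im = (s' 2).im * K ^ 2 := by
        rw [← Complex.ofReal_pow, Complex.add_im, Complex.ofReal_im, Complex.im_mul_ofReal, zero_add]
      calc m * |K| ^ 2 = |((X : ℂ) + s' 2 * (K : ℂ) ^ 2).im| := by
            rw [this, abs_mul, abs_pow]
        _ ≤ _ := Complex.abs_im_le_norm _
    have hρ1 : ‖ρ‖ ≤ |C| * |K| ^ 3 := by
      refine h3.trans ?_
      rw [norm_pow, Real.norm_eq_abs, abs_abs]
      gcongr; exact le_abs_self C
    have hρ2 : ‖ρ'‖ ≤ |C'| * |K| ^ 3 := by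
      refine h4.trans ?_
      rw [norm_pow, Real.norm_eq_abs, abs_abs]
      gcongr; exact le_abs_self C'
    rw [e2] at h1
    rw [e1, e2]
    set α := (X : ℂ) + s 2 * (K : ℂ) ^ 2 with hα
    set β := (X : ℂ) + s' 2 * (K : ℂ) ^ 2 with hβ
    have hpos : 0 < ‖β + ρ'‖ := norm_pos_iff.2 h1
    have d1 : |‖α + ρ‖ - ‖β + ρ'‖| ≤ M * |K| ^ 3 := by
      have t1 := norm_add_le α ρ
      have t2 := norm_sub_norm_le α (-ρ)
      have t3 := norm_add_le β ρ'
      have t4 := norm_sub_norm_le β (-ρ')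
      rw [norm_neg, sub_neg_eq_add] at t2 t4
      rw [abs_le, hM]
      constructor <;> nlinarith
    have d2 : m / 2 * |K| ^ 2 ≤ ‖β + ρ'‖ := by
      have t4 := norm_sub_norm_le β (-ρ')
      rw [norm_neg, sub_neg_eq_add] at t4
      have : |C'| * |K| ^ 3 ≤ m / 2 * |K| ^ 2 := by
        calc |C'| * |K| ^ 3 = (|C'| * |K|) * |K| ^ 2 := by ring
          _ ≤ (M * |K|) * |K| ^ 2 := by
            gcongr; rw [hM]; linarith [abs_nonneg C]
          _ ≤ _ := by gcongr
      linarith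
    rw [Real.dist_eq, div_sub_one hpos.ne', abs_div, abs_of_pos hpos, div_le_iff₀ hpos]
    calc _ ≤ M * |K| ^ 3 := d1
      _ = 2 * M / m * |K| * (m / 2 * |K| ^ 2) := by field_simp
      _ ≤ _ := by gcongr
  have hp : Tendsto (fun p : ℝ × ℝ => p) (𝓝[≠] (κ₀, ω₀)) (𝓝 (κ₀, ω₀)) := nhdsWithin_le_nhds
  have hE := (h.analytic_unit.continuousAt.tendsto.comp hp).norm
  have hE' := (h'.analytic_unit.continuousAt.tendsto.comp hp).norm
  rw [h.unit_apply] at hE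
  rw [h'.unit_apply, norm_one] at hE'
  have := hratio.mul (hE.div hE' one_ne_zero)
  rw [one_mul, div_one] at this
  refine this.congr' ?_
  filter_upwards [nhdsWithin_le_nhds h.eq_mul, nhdsWithin_le_nhds h'.eq_mul] with p h1 h2
  rw [h1, h2, norm_div, norm_mul, norm_mul]
  simp only [Function.comp_apply, Pi.div_apply]
  rw [div_mul_div_comm]

end WeierstrassFactorization

/-- Redefining a function by its limit at one point makes it continuous near that point, if it is
continuous at all other nearby points. -/
theorem eventually_continuousAt_update {X Y : Type*} [TopologicalSpace X] [T1Space X]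
    [DecidableEq X] [TopologicalSpace Y] {f : X → Y} {x₀ : X} {y : Y}
    (hf : Tendsto f (𝓝[≠] x₀) (𝓝 y)) (h : ∀ᶠ x in 𝓝[≠] x₀, ContinuousAt f x) :
    ∀ᶠ x in 𝓝 x₀, ContinuousAt (Function.update f x₀ y) x := by
  rw [eventually_nhdsWithin_iff] at h
  filter_upwards [h] with x hx
  by_cases hxx : x = x₀
  · rw [hxx]; exact continuousAt_update_same.2 hf
  · exact (continuousAt_update_of_ne hxx).2 (hx hxx)

/-! ### Continuation of a real-analytic zero curve -/

theorem AnalyticAt.hasDerivAt_snd {c : ℝ × ℝ → ℂ} {κ ω : ℝ} (h : AnalyticAt ℝ c (κ, ω)) :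
    HasDerivAt (fun ω => c (κ, ω)) (fderiv ℝ c (κ, ω) (0, 1)) ω :=
  HasFDerivAt.comp_hasDerivAt (f := fun ω : ℝ => (κ, ω)) ω h.differentiableAt.hasFDerivAt
    ((hasDerivAt_const ω κ).prodMk (hasDerivAt_id ω))

theorem AnalyticAt.continuousAt_fderiv_snd {c : ℝ × ℝ → ℂ} {p : ℝ × ℝ} (h : AnalyticAt ℝ c p) :
    ContinuousAt (fun q => fderiv ℝ c q (0, 1)) p :=
  h.fderiv.continuousAt.clm_apply continuousAt_const

/-- The part of the zero set of `c` in `W` at which `∂c/∂ω` does not vanish. -/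
def regularZeros (c : ℝ × ℝ → ℂ) (W : Set (ℝ × ℝ)) : Set (ℝ × ℝ) :=
  {p | p ∈ W ∧ c p = 0 ∧ fderiv ℝ c p (0, 1) ≠ 0}

theorem eventually_mem_regularZeros {c : ℝ × ℝ → ℂ} {W : Set (ℝ × ℝ)} (hW : IsOpen W)
    {κ₀ : ℝ} {f : ℝ → ℝ} (hf : ContinuousAt f κ₀) (hc : AnalyticAt ℝ c (κ₀, f κ₀))
    (h0 : (κ₀, f κ₀) ∈ W) (hz : ∀ᶠ κ in 𝓝 κ₀, c (κ, f κ) = 0)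
    (hd : fderiv ℝ c (κ₀, f κ₀) (0, 1) ≠ 0) :
    ∀ᶠ κ in 𝓝 κ₀, (κ, f κ) ∈ regularZeros c W := by
  have hg : Tendsto (fun κ => (κ, f κ)) (𝓝 κ₀) (𝓝 (κ₀, f κ₀)) :=
    tendsto_id.prodMk_nhds hf.tendsto
  filter_upwards [hg.eventually (hW.mem_nhds h0), hz,
    hg.eventually (hc.continuousAt_fderiv_snd.eventually_ne hd)] with κ h1 h2 h3
  exact ⟨h1, h2, h3⟩

/-- A regular real zero that is a limit from the left of real zeros on a curve lies on a
real-analytic curve of zeros which continues that curve. The implicit function theorem is applied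
to one real component of `c`; the other component vanishes by analyticity. -/
theorem exists_analytic_continuation {c : ℝ × ℝ → ℂ} {κ₂ ω₂ : ℝ} {g : ℝ → ℝ}
    (hc : AnalyticAt ℝ c (κ₂, ω₂)) (hd : fderiv ℝ c (κ₂, ω₂) (0, 1) ≠ 0)
    (hg : Tendsto g (𝓝[<] κ₂) (𝓝 ω₂)) (hz : ∀ᶠ κ in 𝓝[<] κ₂, c (κ, g κ) = 0) :
    ∃ φ : ℝ → ℝ, AnalyticAt ℝ φ κ₂ ∧ φ κ₂ = ω₂ ∧ φ =ᶠ[𝓝[<] κ₂] g ∧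
      ∀ᶠ κ in 𝓝 κ₂, c (κ, φ κ) = 0 := by
  set v := fderiv ℝ c (κ₂, ω₂) (0, 1) with hv
  have hgraph : Tendsto (fun κ => (κ, g κ)) (𝓝[<] κ₂) (𝓝 (κ₂, ω₂)) :=
    (tendsto_id.mono_left nhdsWithin_le_nhds).prodMk_nhds hg
  have hc0 : c (κ₂, ω₂) = 0 :=
    tendsto_nhds_unique (hc.continuousAt.tendsto.comp hgraph)
      (tendsto_const_nhds.congr' (hz.mono fun κ h => h.symm))
  let Λ : ℂ →L[ℝ] ℝ := Complex.reCLM.comp (ContinuousLinearMap.mul ℝ ℂ (star v))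
  have hΛ : ∀ z, Λ z = (star v * z).re := fun z => rfl
  have hρ : AnalyticAt ℝ (fun p => Λ (c p)) (κ₂, ω₂) := (Λ.analyticAt _).comp hc
  have hρd : deriv (fun ω => Λ (c (κ₂, ω))) ω₂ ≠ 0 := by
    have := Λ.hasFDerivAt.comp_hasDerivAt ω₂ hc.hasDerivAt_snd
    rw [show (fun ω => Λ (c (κ₂, ω))) = Λ ∘ fun ω => c (κ₂, ω) from rfl, this.deriv, hΛ, ← hv,
      Complex.star_def, mul_comm, Complex.mul_conj, Complex.ofReal_re]
    exact fun h => hd (Complex.normSq_eq_zero.1 h)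
  obtain ⟨φ, hφ, hφ0, hiff⟩ := hρ.exists_implicit (𝕜 := ℝ) (by rw [hc0, map_zero]) hρd
  have heq : φ =ᶠ[𝓝[<] κ₂] g := by
    filter_upwards [hgraph.eventually hiff, hz] with κ h1 h2
    exact h1.1 (by rw [h2, map_zero])
  refine ⟨φ, hφ, hφ0, heq, ?_⟩
  have han : AnalyticAt ℝ (fun κ => c (κ, φ κ)) κ₂ :=
    AnalyticAt.comp (f := fun κ => (κ, φ κ)) (by rwa [hφ0]) (analyticAt_id.prod hφ)
  refine han.frequently_zero_iff_eventually_zero.1 ?_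
  have : ∀ᶠ κ in 𝓝[<] κ₂, c (κ, φ κ) = 0 := by
    filter_upwards [heq, hz] with κ h1 h2
    rw [h1, h2]
  exact this.frequently.filter_mono (nhdsWithin_mono _ fun x hx => ne_of_lt hx)

/-- If the graph of `g` consists of regular zeros then `g` cannot oscillate at `κ₂`. Otherwise, by
the intermediate value theorem, `c(·, ω)` would have zeros accumulating at `κ₂` for every `ω` of an
interval, and `c` would vanish in a disk that contains points of the graph. -/
theorem exists_tendsto_of_regularZeros {c : ℝ × ℝ → ℂ} {U W : Set (ℝ × ℝ)} {κ₁ κ₂ M : ℝ}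
    {g : ℝ → ℝ} (hU : IsOpen U) (hc : ∀ p ∈ U, AnalyticAt ℝ c p)
    (hM : ∀ p ∈ W, |p.2| ≤ M) (hlt : κ₁ < κ₂)
    (hvert : ∀ κ α ω β, (κ, α) ∈ closure W → (κ, ω) ∈ closure W → (κ, β) ∈ closure W →
      α < ω → ω < β → (κ, ω) ∈ U)
    (hg : ContinuousOn g (Ioo κ₁ κ₂)) (hz : ∀ κ ∈ Ioo κ₁ κ₂, (κ, g κ) ∈ regularZeros c W) :
    ∃ ω₂, Tendsto g (𝓝[<] κ₂) (𝓝 ω₂) := by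
  have hev : ∀ᶠ κ in 𝓝[<] κ₂, κ ∈ Ioo κ₁ κ₂ := Ioo_mem_nhdsLT hlt
  refine tendsto_of_no_upcrossings (s := univ) dense_univ ?_ ?_ ?_
  · rintro a - b - hab ⟨ha, hb⟩
    have hfreq : ∀ ω ∈ Ioo a b, ∃ᶠ κ in 𝓝[<] κ₂, κ ∈ Ioo κ₁ κ₂ ∧ g κ = ω := by
      intro ω hω
      rw [frequently_iff]
      intro V hV
      obtain ⟨x, hx, hxV⟩ := (mem_nhdsLT_iff_exists_mem_Ico_Ioo_subset hlt).1 hV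
      have hI : Ioo x κ₂ ∈ 𝓝[<] κ₂ := Ioo_mem_nhdsLT hx.2
      obtain ⟨y, hy, hyI⟩ := (ha.and_eventually hI).exists
      obtain ⟨z, hz', hzI⟩ := (hb.and_eventually hI).exists
      have hsub : Ioo x κ₂ ⊆ Ioo κ₁ κ₂ := Ioo_subset_Ioo_left hx.1
      have hgI : ContinuousOn g (Ioo x κ₂) := hg.mono hsub
      obtain ⟨κ, hκ, hκω⟩ := isPreconnected_Ioo.intermediate_value hyI hzI hgI
        ⟨(hy.trans hω.1).le, (hω.2.trans hz').le⟩
      exact ⟨κ, hxV hκ, hsub hκ, hκω⟩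
    have hclos : ∀ ω ∈ Ioo a b, (κ₂, ω) ∈ closure W := by
      intro ω hω
      rw [mem_closure_iff_frequently]
      have ht : Tendsto (fun κ : ℝ => (κ, ω)) (𝓝[<] κ₂) (𝓝 (κ₂, ω)) :=
        ((by fun_prop : Continuous fun κ : ℝ => (κ, ω)).tendsto' _ _ rfl).mono_left
          nhdsWithin_le_nhds
      refine ht.frequently ((hfreq ω hω).mono fun κ hκ => ?_)
      have := (hz κ hκ.1).1
      rwa [hκ.2] at this
    obtain ⟨ω, hω⟩ := exists_between hab
    obtain ⟨α, hα⟩ := exists_between hω.1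
    obtain ⟨β, hβ⟩ := exists_between hω.2
    have hmem : (κ₂, ω) ∈ U := hvert κ₂ α ω β (hclos α ⟨hα.1, hα.2.trans hω.2⟩) (hclos ω hω)
      (hclos β ⟨hω.1.trans hβ.1, hβ.2⟩) hα.2 hβ.1
    obtain ⟨ρ, hρ, hball⟩ := Metric.isOpen_iff.1 (hU.inter
      (isOpen_Ioo.preimage continuous_snd : IsOpen (Prod.snd ⁻¹' Ioo a b : Set (ℝ × ℝ))))
      (κ₂, ω) ⟨hmem, hω⟩
    rw [← ball_prod_same, Real.ball_eq_Ioo, Real.ball_eq_Ioo] at hball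
    have hzero : ∀ p ∈ Ioo (κ₂ - ρ) (κ₂ + ρ) ×ˢ Ioo (ω - ρ) (ω + ρ), c p = 0 := by
      rintro ⟨x, y⟩ ⟨hx, hy⟩
      have hline : AnalyticOnNhd ℝ (fun κ => c (κ, y)) (Ioo (κ₂ - ρ) (κ₂ + ρ)) := fun κ hκ =>
        AnalyticAt.comp (f := fun κ => (κ, y))
          (hc _ (hball (show (κ, y) ∈ _ from ⟨hκ, hy⟩)).1)
          (analyticAt_id.prod analyticAt_const)
      have hκ₂ : κ₂ ∈ Ioo (κ₂ - ρ) (κ₂ + ρ) := ⟨by linarith, by linarith⟩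
      refine hline.eqOn_zero_of_preconnected_of_frequently_eq_zero isPreconnected_Ioo hκ₂ ?_ hx
      have hy' : y ∈ Ioo a b := (hball (show (κ₂, y) ∈ _ from ⟨hκ₂, hy⟩)).2
      refine ((hfreq y hy').mono fun κ hκ => ?_).filter_mono
        (nhdsWithin_mono _ fun x hx => ne_of_lt hx)
      have := (hz κ hκ.1).2.1
      rwa [hκ.2] at this
    have hI : Ioo (κ₂ - ρ) κ₂ ∈ 𝓝[<] κ₂ := Ioo_mem_nhdsLT (by linarith)
    obtain ⟨κ, ⟨hκ, hκω⟩, hκI⟩ := ((hfreq ω hω).and_eventually hI).exists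
    have hp : (κ, ω) ∈ Ioo (κ₂ - ρ) (κ₂ + ρ) ×ˢ Ioo (ω - ρ) (ω + ρ) :=
      ⟨⟨hκI.1, hκI.2.trans (by linarith)⟩, ⟨by linarith, by linarith⟩⟩
    have hreg := (hz κ hκ).2.2
    rw [hκω] at hreg
    refine hreg ?_
    have : c =ᶠ[𝓝 (κ, ω)] fun _ => 0 := by
      filter_upwards [(isOpen_Ioo.prod isOpen_Ioo).mem_nhds hp] with q hq using hzero q hq
    rw [this.fderiv_eq]
    simp
  · exact ⟨M, by
      rw [eventually_map]
      filter_upwards [hev] with κ hκ using (abs_le.1 (hM _ (hz κ hκ).1)).2⟩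
  · exact ⟨-M, by
      rw [eventually_map]
      filter_upwards [hev] with κ hκ using (abs_le.1 (hM _ (hz κ hκ).1)).1⟩

/-- The continuation of a zero curve to the right as far as its points are regular zeros in `W`: at
the end `κ₂` of the maximal interval the graph has a limit point, which is not a regular zero
in `W`. -/
theorem exists_right_continuation {c : ℝ × ℝ → ℂ} {U W : Set (ℝ × ℝ)} {κ₀ M : ℝ} {f : ℝ → ℝ}
    (hU : IsOpen U) (hc : ∀ p ∈ U, AnalyticAt ℝ c p) (hW : IsOpen W) (hWU : W ⊆ U)
    (hM : ∀ p ∈ W, |p.1| ≤ M ∧ |p.2| ≤ M)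
    (hvert : ∀ κ α ω β, (κ, α) ∈ closure W → (κ, ω) ∈ closure W → (κ, β) ∈ closure W →
      α < ω → ω < β → (κ, ω) ∈ U)
    (hf : AnalyticAt ℝ f κ₀) (h0 : (κ₀, f κ₀) ∈ W) (hz : ∀ᶠ κ in 𝓝 κ₀, c (κ, f κ) = 0)
    (hd : fderiv ℝ c (κ₀, f κ₀) (0, 1) ≠ 0) :
    ∃ (κ₁ κ₂ ω₂ : ℝ) (g : ℝ → ℝ), κ₁ < κ₀ ∧ κ₀ < κ₂ ∧ AnalyticOnNhd ℝ g (Ioo κ₁ κ₂) ∧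
      g =ᶠ[𝓝 κ₀] f ∧ (∀ κ ∈ Ioo κ₁ κ₂, (κ, g κ) ∈ W ∧ c (κ, g κ) = 0) ∧
      Tendsto g (𝓝[<] κ₂) (𝓝 ω₂) ∧
      ((κ₂, ω₂) ∈ frontier W ∨
        ((κ₂, ω₂) ∈ W ∧ HasDerivAt (fun ω : ℝ => c (κ₂, ω)) 0 ω₂)) := by
  obtain ⟨δ, hδ, hball⟩ := Metric.eventually_nhds_iff_ball.1 (hf.eventually_analyticAt.and
    (eventually_mem_regularZeros hW hf.continuousAt (hc _ (hWU h0)) h0 hz hd))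
  rw [Real.ball_eq_Ioo] at hball
  set κ₁ := κ₀ - δ with hκ₁
  let Good : ℝ → (ℝ → ℝ) → Prop := fun κ' g => κ₀ < κ' ∧ AnalyticOnNhd ℝ g (Ioo κ₁ κ') ∧
    g =ᶠ[𝓝 κ₀] f ∧ ∀ κ ∈ Ioo κ₁ κ', (κ, g κ) ∈ regularZeros c W
  let I : Set ℝ := {κ' | ∃ g, Good κ' g}
  have hI0 : κ₀ + δ ∈ I := ⟨f, by linarith, fun κ hκ => (hball κ hκ).1, EventuallyEq.rfl,
    fun κ hκ => (hball κ hκ).2⟩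
  have hlt1 : κ₁ < κ₀ := by linarith
  have hIM : ∀ κ' ∈ I, κ' ≤ M := by
    rintro κ' ⟨g, h1, -, -, h4⟩
    refine le_of_forall_lt fun x hx => ?_
    obtain ⟨y, hy⟩ := exists_between (max_lt hx h1)
    have := (hM _ (h4 y ⟨by linarith [le_max_right x κ₀], hy.2⟩).1).1
    linarith [(abs_le.1 this).2, le_max_left x κ₀]
  have hbdd : BddAbove I := ⟨M, hIM⟩
  set κ₂ := sSup I with hκ₂
  have hlt2 : κ₀ < κ₂ := lt_of_lt_of_le (by linarith) (le_csSup hbdd hI0)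
  -- Any two continuations agree where both are defined, so they can be glued up to `sSup I`.
  have hagree : ∀ {x y g h}, Good x g → Good y h → ∀ κ, κ₁ < κ → κ < x → κ < y → g κ = h κ := by
    rintro x y g h ⟨hx, hg, hgf, -⟩ ⟨hy, hh, hhf, -⟩ κ h1 h2 h3
    have hsx : Ioo κ₁ (min x y) ⊆ Ioo κ₁ x := Ioo_subset_Ioo_right (min_le_left _ _)
    have hsy : Ioo κ₁ (min x y) ⊆ Ioo κ₁ y := Ioo_subset_Ioo_right (min_le_right _ _)
    exact (hg.mono hsx).eqOn_of_preconnected_of_eventuallyEq (hh.mono hsy) isPreconnected_Ioo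
      ⟨hlt1, lt_min hx hy⟩ (hgf.trans hhf.symm) ⟨h1, lt_min h2 h3⟩
  have hpick : ∀ κ, ∃ (x : ℝ) (g : ℝ → ℝ), κ < κ₂ → κ < x ∧ Good x g := by
    intro κ
    by_cases hκ : κ < κ₂
    · obtain ⟨x, ⟨g, hg⟩, hx⟩ := exists_lt_of_lt_csSup ⟨_, hI0⟩ hκ
      exact ⟨x, g, fun _ => ⟨hx, hg⟩⟩
    · exact ⟨0, f, fun h => absurd h hκ⟩
  choose X gg hX using hpick
  let g : ℝ → ℝ := fun κ => gg κ κ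
  have hgloc : ∀ κ ∈ Ioo κ₁ κ₂, g =ᶠ[𝓝 κ] gg κ := by
    intro κ hκ
    filter_upwards [Ioo_mem_nhds hκ.1 (lt_min hκ.2 (hX κ hκ.2).1)] with y hy
    have hy2 : y < κ₂ := hy.2.trans_le (min_le_left _ _)
    exact hagree (hX y hy2).2 (hX κ hκ.2).2 y hy.1 (hX y hy2).1 (hy.2.trans_le (min_le_right _ _))
  have hgan : AnalyticOnNhd ℝ g (Ioo κ₁ κ₂) := fun κ hκ =>
    ((hX κ hκ.2).2.2.1 κ ⟨hκ.1, (hX κ hκ.2).1⟩).congr (hgloc κ hκ).symm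
  have hgf : g =ᶠ[𝓝 κ₀] f := (hgloc κ₀ ⟨hlt1, hlt2⟩).trans (hX κ₀ hlt2).2.2.2.1
  have hgz : ∀ κ ∈ Ioo κ₁ κ₂, (κ, g κ) ∈ regularZeros c W := fun κ hκ =>
    (hX κ hκ.2).2.2.2.2 κ ⟨hκ.1, (hX κ hκ.2).1⟩
  obtain ⟨ω₂, hω₂⟩ := exists_tendsto_of_regularZeros hU hc (fun p hp => (hM p hp).2)
    (hlt1.trans hlt2) hvert (fun κ hκ => (hgan κ hκ).continuousAt.continuousWithinAt) hgz
  refine ⟨κ₁, κ₂, ω₂, g, hlt1, hlt2, hgan, hgf, fun κ hκ => ⟨(hgz κ hκ).1, (hgz κ hκ).2.1⟩, hω₂, ?_⟩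
  have hev : ∀ᶠ κ in 𝓝[<] κ₂, κ ∈ Ioo κ₁ κ₂ := Ioo_mem_nhdsLT (hlt1.trans hlt2)
  have hgraph : Tendsto (fun κ => (κ, g κ)) (𝓝[<] κ₂) (𝓝 (κ₂, ω₂)) :=
    (tendsto_id.mono_left nhdsWithin_le_nhds).prodMk_nhds hω₂
  by_cases hmem : (κ₂, ω₂) ∈ W
  · refine Or.inr ⟨hmem, ?_⟩
    have hcp := hc _ (hWU hmem)
    by_cases hd2 : fderiv ℝ c (κ₂, ω₂) (0, 1) = 0
    · rw [← hd2]; exact hcp.hasDerivAt_snd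
    -- At a regular zero in `W` the curve could be continued beyond `sSup I`.
    exfalso
    obtain ⟨φ, hφ, hφ0, hφg, hφz⟩ := exists_analytic_continuation hcp hd2 hω₂
      (hev.mono fun κ hκ => (hgz κ hκ).2.1)
    obtain ⟨η, hη, hηball⟩ := Metric.eventually_nhds_iff_ball.1 (hφ.eventually_analyticAt.and
      ((eventually_mem_regularZeros hW hφ.continuousAt (by rwa [hφ0]) (by rwa [hφ0]) hφz
        (by rwa [hφ0])).and (eventually_nhdsWithin_iff.1 hφg)))
    rw [Real.ball_eq_Ioo] at hηball
    have hglue : ∀ κ, κ₂ - η < κ → κ < κ₂ + η → (fun x => if x < κ₂ then g x else φ x) κ = φ κ := by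
      intro κ h1 h2
      by_cases h3 : κ < κ₂
      · simp only [h3, if_true]
        exact ((hηball κ ⟨h1, h2⟩).2.2 h3).symm
      · simp only [h3, if_false]
    have hglue' : ∀ κ, κ < κ₂ → (fun x => if x < κ₂ then g x else φ x) κ = g κ := by
      intro κ h1; simp only [h1, if_true]
    have hnew : κ₂ + η ∈ I := by
      refine ⟨fun x => if x < κ₂ then g x else φ x, by linarith, fun κ hκ => ?_, ?_, fun κ hκ => ?_⟩
      · by_cases h1 : κ < κ₂
        · refine (hgan κ ⟨hκ.1, h1⟩).congr ?_
          filter_upwards [Iio_mem_nhds h1] with y hy using (hglue' y hy).symm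
        · refine (hηball κ ⟨by linarith, hκ.2⟩).1.congr ?_
          filter_upwards [Ioo_mem_nhds (by linarith : κ₂ - η < κ) hκ.2] with y hy
            using (hglue y hy.1 hy.2).symm
      · refine EventuallyEq.trans ?_ hgf
        filter_upwards [Iio_mem_nhds hlt2] with y hy using hglue' y hy
      · by_cases h1 : κ < κ₂
        · rw [hglue' κ h1]; exact hgz κ ⟨hκ.1, h1⟩
        · rw [hglue κ (by linarith) hκ.2]; exact (hηball κ ⟨by linarith, hκ.2⟩).2.1
    linarith [le_csSup hbdd hnew]
  · refine Or.inl ?_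
    rw [hW.frontier_eq]
    exact ⟨mem_closure_of_tendsto hgraph (hev.mono fun κ hκ => (hgz κ hκ).1), hmem⟩

/-- The hypothesis `hvert` replaces compactness of `closure W` in `U`: it keeps the interior of a
vertical segment on which the curve might accumulate inside the domain of analyticity. -/
theorem extendsToBoundaryOrDegeneracy {c : ℝ × ℝ → ℂ} {U W : Set (ℝ × ℝ)} {κ₀ M : ℝ} {f : ℝ → ℝ}
    (hU : IsOpen U) (hc : ∀ p ∈ U, AnalyticAt ℝ c p) (hW : IsOpen W) (hWU : W ⊆ U)
    (hM : ∀ p ∈ W, |p.1| ≤ M ∧ |p.2| ≤ M)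
    (hvert : ∀ κ α ω β, (κ, α) ∈ closure W → (κ, ω) ∈ closure W → (κ, β) ∈ closure W →
      α < ω → ω < β → (κ, ω) ∈ U)
    (hf : AnalyticAt ℝ f κ₀) (h0 : (κ₀, f κ₀) ∈ W) (hz : ∀ᶠ κ in 𝓝 κ₀, c (κ, f κ) = 0)
    (hd : fderiv ℝ c (κ₀, f κ₀) (0, 1) ≠ 0) : ExtendsToBoundaryOrDegeneracy c W κ₀ f := by
  obtain ⟨x₁, κ₂, ω₂, g, hx₁, hκ₂, hg, hgf, hgz, hglim, hgend⟩ :=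
    exists_right_continuation hU hc hW hWU hM hvert hf h0 hz hd
  -- The left continuation is the right continuation of the reflected data.
  let σ : ℝ × ℝ ≃ₜ ℝ × ℝ := (Homeomorph.neg ℝ).prodCongr (Homeomorph.refl ℝ)
  have hσ : ∀ x y : ℝ, σ (x, y) = (-x, y) := fun x y => rfl
  have hσan : ∀ p, AnalyticAt ℝ σ p := fun p => analyticAt_fst.neg.prod analyticAt_snd
  have hσcl : ∀ x y : ℝ, (x, y) ∈ closure (σ ⁻¹' W) → (-x, y) ∈ closure W := by
    intro x y hxy
    rw [← σ.preimage_closure] at hxy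
    exact hxy
  have hnegan : AnalyticAt ℝ (fun κ : ℝ => -κ) (-κ₀) := analyticAt_id.neg
  have hfneg : AnalyticAt ℝ (fun κ => f (-κ)) (-κ₀) :=
    AnalyticAt.comp (f := fun κ : ℝ => -κ) (by rwa [neg_neg]) hnegan
  have hneg : Tendsto (fun κ : ℝ => -κ) (𝓝 (-κ₀)) (𝓝 κ₀) :=
    (continuous_neg : Continuous fun κ : ℝ => -κ).tendsto' _ _ (neg_neg κ₀)
  have hneg' : Tendsto (fun κ : ℝ => -κ) (𝓝 κ₀) (𝓝 (-κ₀)) := continuous_neg.tendsto _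
  have hcσ : ∀ p ∈ σ ⁻¹' U, AnalyticAt ℝ (fun q => c (σ q)) p := fun p hp =>
    AnalyticAt.comp (hc _ hp) (hσan p)
  have hdσ : fderiv ℝ (fun q => c (σ q)) (-κ₀, f (- -κ₀)) (0, 1) ≠ 0 := by
    have h1 := (hcσ (-κ₀, f (- -κ₀)) (hWU (by simpa [hσ] using h0))).hasDerivAt_snd
    have h2 := (hc _ (hWU h0)).hasDerivAt_snd
    rw [neg_neg] at h1 ⊢
    have h3 : HasDerivAt (fun ω => c (σ (-κ₀, ω))) (fderiv ℝ c (κ₀, f κ₀) (0, 1)) (f κ₀) := by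
      simp only [hσ, neg_neg]
      exact h2
    rw [h1.unique h3]
    exact hd
  obtain ⟨x₂, y₁, ω₁, h, hx₂, hy₁, hh, hhf, hhz, hhlim, hhend⟩ :=
    exists_right_continuation (c := fun q => c (σ q)) (U := σ ⁻¹' U) (W := σ ⁻¹' W) (κ₀ := -κ₀)
      (M := M) (f := fun κ => f (-κ)) (hU.preimage σ.continuous) hcσ (hW.preimage σ.continuous)
      (preimage_mono hWU) (fun p hp => by simpa [hσ] using hM _ hp)
      (fun κ α ω β h1 h2 h3 h4 h5 =>
        hvert (-κ) α ω β (hσcl _ _ h1) (hσcl _ _ h2) (hσcl _ _ h3) h4 h5)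
      hfneg (by simpa [hσ] using h0)
      (by filter_upwards [hneg.eventually hz] with κ hκ using hκ) hdσ
  have hhf' : (fun κ => h (-κ)) =ᶠ[𝓝 κ₀] f := by
    filter_upwards [hneg'.eventually hhf] with κ hκ
    simpa using hκ
  let G : ℝ → ℝ := fun κ => if κ < κ₀ then h (-κ) else g κ
  have hGl : ∀ κ, κ < κ₀ → G κ = h (-κ) := fun κ hκ => by simp only [G, hκ, if_true]
  have hGr : ∀ κ, ¬ κ < κ₀ → G κ = g κ := fun κ hκ => by simp only [G, hκ, if_false]
  have hGf : G =ᶠ[𝓝 κ₀] f := by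
    filter_upwards [hhf', hgf] with κ h1 h2
    by_cases h3 : κ < κ₀
    · rw [hGl κ h3, ← h1]
    · rw [hGr κ h3, h2]
  refine ⟨-y₁, κ₂, ω₁, ω₂, G, by linarith, hκ₂, ?_, hGf, ?_, ?_, ?_, ?_, hgend⟩
  · intro κ hκ
    rcases lt_trichotomy κ κ₀ with h1 | h1 | h1
    · have : AnalyticAt ℝ (fun κ => h (-κ)) κ :=
        AnalyticAt.comp (f := fun κ : ℝ => -κ) (hh (-κ) ⟨by linarith, by linarith [hκ.1]⟩)
          analyticAt_id.neg
      refine this.congr ?_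
      filter_upwards [Iio_mem_nhds h1] with y hy using (hGl y hy).symm
    · rw [h1]; exact hf.congr hGf.symm
    · refine (hg κ ⟨by linarith, hκ.2⟩).congr ?_
      filter_upwards [Ioi_mem_nhds h1] with y hy using (hGr y (not_lt.2 (le_of_lt hy))).symm
  · intro κ hκ
    by_cases h1 : κ < κ₀
    · rw [hGl κ h1]
      have := hhz (-κ) ⟨by linarith, by linarith [hκ.1]⟩
      simpa [hσ] using this
    · rw [hGr κ h1]
      exact hgz κ ⟨by linarith [not_lt.1 h1], hκ.2⟩
  · have h1 : Tendsto (fun κ : ℝ => -κ) (𝓝[>] (-y₁)) (𝓝[<] y₁) := by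
      have := tendsto_neg_nhdsGT (a := -y₁)
      simpa using this
    refine (hhlim.comp h1).congr' ?_
    filter_upwards [nhdsWithin_le_nhds (Iio_mem_nhds (by linarith : -y₁ < κ₀))] with κ hκ
    exact (hGl κ hκ).symm
  · refine hglim.congr' ?_
    filter_upwards [nhdsWithin_le_nhds (Ioi_mem_nhds hκ₂)] with κ hκ
    exact (hGr κ (not_lt.2 (le_of_lt hκ))).symm
  · refine hhend.imp (fun h1 => ?_) (fun h1 => ⟨by simpa [hσ] using h1.1, by
      simpa [hσ] using h1.2⟩)
    rw [← σ.preimage_frontier] at h1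
    exact h1

/-! ### Total transmission and reflection for abstract scattering coefficients -/

/-- The theorem on total transmission and reflection for functions `lam`, `R`, `T` on an open set
`U` that have the analytic and algebraic properties of the eigenvalue and of the scattering
coefficients of a symmetric slab: `lam`, `lam R`, `lam T` are analytic, energy is conserved, `R` and
`T` are out of phase by `π / 2`, a multiple of `lam` is real to first order at the guided mode, and
`T` at the guided mode is the limit of `T` along `κ = κ₀`. -/
theorem exists_anomaly_expansion {lam R T : ℝ × ℝ → ℂ} {U D : Set (ℝ × ℝ)} {M κ₀ ω₀ : ℝ}
    (hU : IsOpen U) (hUD : U ⊆ D) (hM : ∀ p ∈ D, |p.1| ≤ M ∧ |p.2| ≤ M)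
    (hvert : ∀ κ α ω β, (κ, α) ∈ closure D → (κ, β) ∈ closure D → α < ω → ω < β → (κ, ω) ∈ D)
    (h₀ : (κ₀, ω₀) ∈ U) (hmode : lam (κ₀, ω₀) = 0)
    (hlam : ∀ p ∈ U, IsComplexAnalyticAt lam p)
    (hR : ∀ p ∈ U, IsComplexAnalyticAt (fun q => lam q * R q) p)
    (hT : ∀ p ∈ U, IsComplexAnalyticAt (fun q => lam q * T q) p)
    (henergy : ∀ p ∈ U, lam p ≠ 0 → ‖R p‖ ^ 2 + ‖T p‖ ^ 2 = 1)
    (hphase : ∀ p ∈ U, lam p ≠ 0 → (R p * star (T p)).re = 0)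
    (hreal : ∃ c : ℂ, c ≠ 0 ∧
      (fun p => (c * lam p).im) =o[𝓝 (κ₀, ω₀)] fun p => ‖p - (κ₀, ω₀)‖)
    (hTlim : Tendsto (fun ω => T (κ₀, ω)) (𝓝[≠] ω₀) (𝓝 (T (κ₀, ω₀))))
    (hgl : deriv (fun ω : ℝ => lam (κ₀, ω)) ω₀ ≠ 0)
    (hga : deriv (fun ω : ℝ => lam (κ₀, ω) * R (κ₀, ω)) ω₀ ≠ 0)
    (hgb : deriv (fun ω : ℝ => lam (κ₀, ω) * T (κ₀, ω)) ω₀ ≠ 0) :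
    ∃ (C : ℂ) (ℓ a b : ℝ × ℝ → ℂ) (l r t : ℕ → ℂ) (r₀ t₀ γ : ℝ),
      C ≠ 0 ∧ (∀ p, ℓ p = C * lam p) ∧ (∀ p, a p = ℓ p * R p) ∧
      (∀ p, b p = ℓ p * T p) ∧
      0 < r₀ ∧ r₀ < 1 ∧ 0 < |t₀| ∧ |t₀| < 1 ∧
      HasWeierstrassExpansion ℓ κ₀ ω₀ l 1 ∧
      HasWeierstrassExpansion a κ₀ ω₀ r (r₀ * Complex.exp (Complex.I * γ)) ∧
      HasWeierstrassExpansion b κ₀ ω₀ t (Complex.I * t₀ * Complex.exp (Complex.I * γ)) ∧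
      (0 < (l 2).im →
        (ContinuousAt (fun p => ‖T p‖ ^ 2) (κ₀, ω₀) ∨
          ∃ f₁ f₂ : ℝ → ℝ, AnalyticAt ℝ f₁ κ₀ ∧ AnalyticAt ℝ f₂ κ₀ ∧
            f₁ κ₀ = ω₀ ∧ f₂ κ₀ = ω₀ ∧ deriv f₁ κ₀ = deriv f₂ κ₀ ∧
            iteratedDeriv 2 f₁ κ₀ ≠ iteratedDeriv 2 f₂ κ₀ ∧
            ∀ᶠ κ in 𝓝[≠] κ₀,
              ‖T (κ, f₁ κ)‖ ^ 2 = 1 ∧ ‖T (κ, f₂ κ)‖ ^ 2 = 0) ∧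
        (r 2 ≠ t 2 →
          (∀ n, 1 ≤ n → (r n).im = 0 ∧ (t n).im = 0) ∧ r 1 = l 1 ∧ t 1 = l 1 ∧
          (∀ᶠ ω in 𝓝 ω₀, ContinuousAt (Function.update (fun ω => a (κ₀, ω) / ℓ (κ₀, ω)) ω₀
            (r₀ * Complex.exp (Complex.I * γ))) ω) ∧
          (∀ᶠ ω in 𝓝 ω₀, ContinuousAt (Function.update (fun ω => b (κ₀, ω) / ℓ (κ₀, ω)) ω₀
            (Complex.I * t₀ * Complex.exp (Complex.I * γ))) ω) ∧
          ∃ fa fb : ℝ → ℝ,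
            IsZeroCurve a κ₀ ω₀ r fa ∧ IsZeroCurve b κ₀ ω₀ t fb ∧
            (∀ᶠ κ in 𝓝[≠] κ₀, fa κ ≠ fb κ) ∧
            (∀ᶠ p : ℝ × ℝ in 𝓝[≠] (κ₀, ω₀),
              (‖T p‖ ^ 2 = 1 ↔ p.2 = fa p.1) ∧ (‖T p‖ ^ 2 = 0 ↔ p.2 = fb p.1)) ∧
            ∀ W : Set (ℝ × ℝ), IsOpen W → (κ₀, ω₀) ∈ W → W ⊆ U →
              closure W ∩ D ⊆ U →
              ExtendsToBoundaryOrDegeneracy a W κ₀ fa ∧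
              ExtendsToBoundaryOrDegeneracy b W κ₀ fb) ∧
        (r 2 = t 2 →
          (∀ᶠ p in 𝓝 (κ₀, ω₀),
            ContinuousAt (Function.update (fun p => ‖a p / ℓ p‖) (κ₀, ω₀) |r₀|) p) ∧
          (∀ᶠ p in 𝓝 (κ₀, ω₀),
            ContinuousAt (Function.update (fun p => ‖b p / ℓ p‖) (κ₀, ω₀) |t₀|) p))) := by
  classical
  -- With this constant the unit in the factorisation of `ℓ = C lam` is `1` at `(κ₀, ω₀)`.
  set C := (deriv (fun ω : ℝ => lam (κ₀, ω)) ω₀)⁻¹ with hC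
  have hC0 : C ≠ 0 := inv_ne_zero hgl
  let ℓ : ℝ × ℝ → ℂ := fun p => C * lam p
  let a : ℝ × ℝ → ℂ := fun p => ℓ p * R p
  let b : ℝ × ℝ → ℂ := fun p => ℓ p * T p
  have ha_eq : a = fun p => C * (lam p * R p) := funext fun p => by simp only [a, ℓ]; ring
  have hb_eq : b = fun p => C * (lam p * T p) := funext fun p => by simp only [b, ℓ]; ring
  obtain ⟨l, Al, El, hl⟩ := (hlam _ h₀).exists_weierstrassFactorization hmode hgl
  obtain ⟨r, Aa, Ea, hr⟩ := (hR _ h₀).exists_weierstrassFactorization (by rw [hmode, zero_mul]) hga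
  obtain ⟨t, Ab, Eb, ht⟩ := (hT _ h₀).exists_weierstrassFactorization (by rw [hmode, zero_mul]) hgb
  replace hl := hl.const_mul C
  rw [hC, inv_mul_cancel₀ hgl, ← hC] at hl
  replace hr := hr.const_mul C
  replace ht := ht.const_mul C
  rw [← ha_eq] at hr
  rw [← hb_eq] at ht
  set va := C * deriv (fun ω : ℝ => lam (κ₀, ω) * R (κ₀, ω)) ω₀ with hva
  set vb := C * deriv (fun ω : ℝ => lam (κ₀, ω) * T (κ₀, ω)) ω₀ with hvb
  have hva0 : va ≠ 0 := mul_ne_zero hC0 hga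
  have hvb0 : vb ≠ 0 := mul_ne_zero hC0 hgb
  have hUnhds : U ∈ 𝓝 (κ₀, ω₀) := hU.mem_nhds h₀
  have hlam0 : ∀ p, ℓ p ≠ 0 → lam p ≠ 0 := fun p h0 h => h0 (by simp only [ℓ, h, mul_zero])
  have hres : ResonanceExpansion ℓ a b κ₀ ω₀ l r t va vb Al Aa Ab
      (fun p => C * El p) (fun p => C * Ea p) (fun p => C * Eb p) := by
    refine ⟨hl, hr, ht, ?_, ?_, hva0, hvb0⟩
    · filter_upwards [hUnhds] with p hp
      by_cases h0 : ℓ p = 0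
      · simp [a, b, h0]
      · simp only [a, b, norm_mul, mul_pow]
        rw [← mul_add, henergy p hp (hlam0 p h0), mul_one]
    · filter_upwards [hUnhds] with p hp
      by_cases h0 : ℓ p = 0
      · simp [a, h0]
      · have : a p * star (b p) = (Complex.normSq (ℓ p) : ℂ) * (R p * star (T p)) := by
          simp only [a, b, star_mul']
          rw [← Complex.mul_conj, Complex.star_def]
          ring
        rw [this, Complex.re_ofReal_mul, hphase p hp (hlam0 p h0), mul_zero]
  obtain ⟨r₀, t₀, γ, hr0, hr1, ht0, ht1, hvaeq, hvbeq⟩ := hres.exists_polar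
  obtain ⟨c, hc⟩ : ∃ c : ℝ, l 1 = c := by
    obtain ⟨c', hc', ho⟩ := hreal
    refine hl.exists_linear_coeff_real (c := c' / C) (div_ne_zero hc' hC0) ?_
    have e : ∀ p, c' / C * (C * lam p) = c' * lam p := fun p => by
      rw [← mul_assoc, div_mul_cancel₀ _ hC0]
    simpa only [e] using ho
  obtain ⟨hrc, htc⟩ := hres.linear_coeff hc
  have hnormva : ‖va‖ = |r₀| := by
    rw [hvaeq, norm_mul, Complex.norm_real, Real.norm_eq_abs, mul_comm Complex.I,
      Complex.norm_exp_ofReal_mul_I, mul_one]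
  have hnormvb : ‖vb‖ = |t₀| := by
    rw [hvbeq, norm_mul, norm_mul, Complex.norm_I, Complex.norm_real, Real.norm_eq_abs,
      mul_comm Complex.I, Complex.norm_exp_ofReal_mul_I, mul_one, one_mul]
  have haAn : ∀ p ∈ U, AnalyticAt ℝ a p := fun p hp => by
    rw [ha_eq]; exact ((hR p hp).const_mul C).analyticAt
  have hbAn : ∀ p ∈ U, AnalyticAt ℝ b p := fun p hp => by
    rw [hb_eq]; exact ((hT p hp).const_mul C).analyticAt
  have hlAn : ∀ p ∈ U, AnalyticAt ℝ ℓ p := fun p hp => ((hlam p hp).const_mul C).analyticAt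
  refine ⟨C, ℓ, a, b, l, r, t, r₀, t₀, γ, hC0, fun _ => rfl, fun _ => rfl, fun _ => rfl, hr0, hr1,
    ht0, ht1, hl.hasWeierstrassExpansion, hvaeq ▸ hr.hasWeierstrassExpansion,
    hvbeq ▸ ht.hasWeierstrassExpansion, fun him => ?_⟩
  -- Since `ℓ₁` is real and `ℓ₂` is not, the zero of `ℓ` at `(κ₀, ω₀)` is isolated.
  have hne : ∀ᶠ p in 𝓝[≠] (κ₀, ω₀), ℓ p ≠ 0 := hl.eventually_ne_zero one_ne_zero hc him.ne'
  have hcont : ∀ {d : ℝ × ℝ → ℂ}, (∀ p ∈ U, AnalyticAt ℝ d p) →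
      ∀ᶠ p in 𝓝[≠] (κ₀, ω₀), ContinuousAt (fun q => d q / ℓ q) p := by
    intro d hd
    filter_upwards [hne, nhdsWithin_le_nhds hUnhds] with p hp hpU
    exact (hd p hpU).continuousAt.div (hlAn p hpU).continuousAt hp
  have hdiv : ∀ {X : ℝ × ℝ → ℂ} {p : ℝ × ℝ}, ℓ p ≠ 0 → ℓ p * X p / ℓ p = X p := fun h =>
    mul_div_cancel_left₀ _ h
  have hline : Tendsto (fun ω : ℝ => (κ₀, ω)) (𝓝[≠] ω₀) (𝓝[≠] (κ₀, ω₀)) := by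
    refine tendsto_nhdsWithin_of_tendsto_nhds_of_eventually_within _
      (((by fun_prop : Continuous fun ω : ℝ => (κ₀, ω)).tendsto' _ _ rfl).mono_left
        nhdsWithin_le_nhds) ?_
    filter_upwards [self_mem_nhdsWithin] with ω hω h
    exact hω (by simpa using h)
  have hcase3 : r 2 = t 2 → Tendsto (fun p => ‖a p / ℓ p‖) (𝓝[≠] (κ₀, ω₀)) (𝓝 |r₀|) ∧
      Tendsto (fun p => ‖b p / ℓ p‖) (𝓝[≠] (κ₀, ω₀)) (𝓝 |t₀|) := by
    intro hrt
    rw [← hnormva, ← hnormvb]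
    exact ⟨hr.tendsto_norm_div hl hrc hc him.ne' (hres.quadratic_coeff_of_eq hc hrt),
      ht.tendsto_norm_div hl htc hc him.ne' (by
        rw [← hrt]; exact hres.quadratic_coeff_of_eq hc hrt)⟩
  have hcase1 : r 2 ≠ t 2 → IsZeroCurve a κ₀ ω₀ r (fun κ => ω₀ - (Aa κ).re) ∧
      IsZeroCurve b κ₀ ω₀ t (fun κ => ω₀ - (Ab κ).re) ∧
      (∀ᶠ p : ℝ × ℝ in 𝓝[≠] (κ₀, ω₀), (‖T p‖ ^ 2 = 1 ↔ p.2 = ω₀ - (Aa p.1).re) ∧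
        (‖T p‖ ^ 2 = 0 ↔ p.2 = ω₀ - (Ab p.1).re)) := by
    intro hrt
    obtain ⟨hreala, hrealb⟩ := hres.eventually_root_real hc hrt
    have hza := hr.isZeroCurve hva0 hreala
    have hzb := ht.isZeroCurve hvb0 hrealb
    refine ⟨hza, hzb, ?_⟩
    filter_upwards [hne, nhdsWithin_le_nhds hUnhds, nhdsWithin_le_nhds hza.2.2,
      nhdsWithin_le_nhds hzb.2.2] with p h1 h2 h3 h4
    rw [← h3, ← h4]
    have h5 := henergy p h2 (hlam0 p h1)
    constructor
    · have : ‖T p‖ ^ 2 = 1 ↔ ‖R p‖ ^ 2 = 0 := by constructor <;> intro h <;> linarith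
      rw [this, pow_eq_zero_iff two_ne_zero, norm_eq_zero]
      simp only [a, mul_eq_zero, h1, false_or]
    · rw [pow_eq_zero_iff two_ne_zero, norm_eq_zero]
      simp only [b, mul_eq_zero, h1, false_or]
  have hcurve : ∀ {f : ℝ → ℝ}, ContinuousAt f κ₀ → f κ₀ = ω₀ →
      Tendsto (fun κ => (κ, f κ)) (𝓝[≠] κ₀) (𝓝[≠] (κ₀, ω₀)) := by
    intro f hf hf0
    refine tendsto_nhdsWithin_of_tendsto_nhds_of_eventually_within _ ?_ ?_
    · have := hf.tendsto
      rw [hf0] at this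
      exact (tendsto_id.prodMk_nhds this).mono_left nhdsWithin_le_nhds
    · filter_upwards [self_mem_nhdsWithin] with κ hκ h
      exact hκ (congrArg Prod.fst h)
  refine ⟨?_, fun hrt => ?_, fun hrt => ?_⟩
  · by_cases hrt : r 2 = t 2
    · -- The value of `T` at the guided mode is its limit along `κ = κ₀`, namely `i t₀ e^{iγ}`.
      left
      have hT0 : ‖T (κ₀, ω₀)‖ = |t₀| := by
        refine tendsto_nhds_unique hTlim.norm (((hcase3 hrt).2.comp hline).congr' ?_)
        filter_upwards [hline.eventually hne] with ω hω
        simp only [Function.comp_apply, b]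
        rw [hdiv hω]
      have h1 : Tendsto (fun p => ‖T p‖) (𝓝[≠] (κ₀, ω₀)) (𝓝 ‖T (κ₀, ω₀)‖) := by
        rw [hT0]
        refine (hcase3 hrt).2.congr' ?_
        filter_upwards [hne] with p hp
        simp only [b]
        rw [hdiv hp]
      exact (continuousAt_iff_punctured_nhds.2 h1).pow 2
    · right
      obtain ⟨hza, hzb, hTT⟩ := hcase1 hrt
      obtain ⟨a0, a1, a2⟩ := hza.taylor
      obtain ⟨b0, b1, b2⟩ := hzb.taylor
      refine ⟨_, _, hza.1, hzb.1, a0, b0, by rw [a1, b1, hrc, htc], ?_, ?_⟩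
      · rw [a2, b2]
        have := hres.re_sub_ne hc hrt
        intro h
        exact this (by linarith)
      · filter_upwards [(hcurve hza.1.continuousAt a0).eventually hTT,
          (hcurve hzb.1.continuousAt b0).eventually hTT] with κ h1 h2
        exact ⟨h1.1.2 rfl, h2.2.2 rfl⟩
  · obtain ⟨hreala, hrealb⟩ := hres.eventually_root_real hc hrt
    obtain ⟨hza, hzb, hTT⟩ := hcase1 hrt
    have hupd : ∀ {d : ℝ × ℝ → ℂ} {v : ℂ}, (∀ p ∈ U, AnalyticAt ℝ d p) →
        Tendsto (fun ω => d (κ₀, ω) / ℓ (κ₀, ω)) (𝓝[≠] ω₀) (𝓝 v) →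
        ∀ᶠ ω in 𝓝 ω₀,
          ContinuousAt (Function.update (fun ω => d (κ₀, ω) / ℓ (κ₀, ω)) ω₀ v) ω := by
      intro d v hd hv
      refine eventually_continuousAt_update hv ?_
      filter_upwards [hline.eventually (hcont hd)] with ω hω
      exact ContinuousAt.comp (f := fun ω : ℝ => (κ₀, ω)) hω (by fun_prop)
    refine ⟨fun n hn => ⟨hr.im_coeff_eq_zero hreala hn, ht.im_coeff_eq_zero hrealb hn⟩,
      by rw [hrc, hc], by rw [htc, hc], ?_, ?_, _, _, hza, hzb, ?_, hTT, ?_⟩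
    · have := hr.tendsto_div_axis hl one_ne_zero
      rw [div_one, hvaeq] at this
      convert hupd haAn this
    · have := ht.tendsto_div_axis hl one_ne_zero
      rw [div_one, hvbeq] at this
      convert hupd hbAn this
    · filter_upwards [(hres.tendsto_re_sub hc).eventually_ne (hres.re_sub_ne hc hrt)] with κ hκ h
      refine hκ ?_
      rw [show (Ab κ).re - (Aa κ).re = 0 by linarith, zero_div]
    · intro W hW h0W hWU hWD
      have hMW : ∀ p ∈ W, |p.1| ≤ M ∧ |p.2| ≤ M := fun p hp => hM p (hUD (hWU hp))
      have hcl : closure W ⊆ closure D := closure_mono (hWU.trans hUD)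
      have hvertW : ∀ κ α ω β, (κ, α) ∈ closure W → (κ, ω) ∈ closure W → (κ, β) ∈ closure W →
          α < ω → ω < β → (κ, ω) ∈ U := fun κ α ω β h1 h2 h3 h4 h5 =>
        hWD ⟨h2, hvert κ α ω β (hcl h1) (hcl h3) h4 h5⟩
      have key : ∀ {d : ℝ × ℝ → ℂ} {f : ℝ → ℝ} {s : ℕ → ℂ}, (∀ p ∈ U, AnalyticAt ℝ d p) →
          IsZeroCurve d κ₀ ω₀ s f → deriv (fun ω => d (κ₀, ω)) ω₀ ≠ 0 →
          ExtendsToBoundaryOrDegeneracy d W κ₀ f := by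
        intro d f s hd hz hder
        have hf0 := hz.taylor.1
        refine extendsToBoundaryOrDegeneracy hU hd hW hWU hMW hvertW hz.1 (by rwa [hf0]) ?_ ?_
        · have ht : Tendsto (fun κ => (κ, f κ)) (𝓝 κ₀) (𝓝 (κ₀, ω₀)) := by
            have := hz.1.continuousAt.tendsto
            rw [hf0] at this
            exact tendsto_id.prodMk_nhds this
          filter_upwards [ht.eventually hz.2.2] with κ hκ using hκ.2 rfl
        · rw [hf0, ← (hd _ h₀).hasDerivAt_snd.deriv]
          exact hder
      refine ⟨key haAn hza ?_, key hbAn hzb ?_⟩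
      · rw [ha_eq, deriv_const_mul_field]
        exact hva0
      · rw [hb_eq, deriv_const_mul_field]
        exact hvb0
  · obtain ⟨h1, h2⟩ := hcase3 hrt
    constructor
    · convert eventually_continuousAt_update h1 ((hcont haAn).mono fun p hp => hp.norm)
    · convert eventually_continuousAt_update h2 ((hcont hbAn).mono fun p hp => hp.norm)

/-! ### Perturbation of a simple eigenvalue of a compact perturbation of the identity -/

section SimpleEigenvalue

variable {H : Type*} [NormedAddCommGroup H] [InnerProductSpace ℂ H]

/-- The operator `A - λ` corrected by the rank-one operator `v ↦ φ(v) u`. -/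
def borderedOp (A : H →L[ℂ] H) (φ : H →L[ℂ] ℂ) (u : H) (x : ℂ) : H →L[ℂ] H :=
  A - x • 1 + φ.smulRight u

theorem borderedOp_apply (A : H →L[ℂ] H) (φ : H →L[ℂ] ℂ) (u : H) (x : ℂ) (v : H) :
    borderedOp A φ u x v = A v - x • v + φ v • u := rfl

theorem ringInverse_apply_self {B : H →L[ℂ] H} (hB : IsUnit B) (v : H) :
    Ring.inverse B (B v) = v := by
  have := congrArg (fun T : H →L[ℂ] H => T v) (Ring.inverse_mul_cancel B hB)
  exact this

theorem apply_ringInverse {B : H →L[ℂ] H} (hB : IsUnit B) (v : H) :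
    B (Ring.inverse B v) = v := by
  have := congrArg (fun T : H →L[ℂ] H => T v) (Ring.mul_inverse_cancel B hB)
  exact this

section Algebra

variable {A : H →L[ℂ] H} {φ : H →L[ℂ] ℂ} {u : H} {x : ℂ}

theorem apply_ringInverse_borderedOp (hB : IsUnit (borderedOp A φ u x)) {v : H} (hv0 : v ≠ 0)
    (hv : A v = x • v) : φ (Ring.inverse (borderedOp A φ u x) u) = 1 := by
  have h5 : borderedOp A φ u x v = φ v • u := by
    rw [borderedOp_apply, hv, sub_self, zero_add]
  have h6 : v = φ v • Ring.inverse (borderedOp A φ u x) u := by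
    rw [← map_smul, ← h5, ringInverse_apply_self hB]
  have hφv : φ v ≠ 0 := fun h => hv0 (by rw [h6, h, zero_smul])
  have h7 := congrArg φ h6
  rw [map_smul, smul_eq_mul] at h7
  exact (mul_left_cancel₀ hφv ((mul_one _).trans h7)).symm

theorem apply_eq_sub_smul (hB : IsUnit (borderedOp A φ u 0)) (g : H) :
    A (Ring.inverse (borderedOp A φ u 0) g)
      = g - φ (Ring.inverse (borderedOp A φ u 0) g) • u := by
  have := apply_ringInverse hB g
  rw [borderedOp_apply, zero_smul, sub_zero] at this
  exact eq_sub_of_add_eq this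

theorem eq_add_smul_of_apply_eq (hB : IsUnit (borderedOp A φ u 0)) {v g : H} (hv : A v = g) :
    v = Ring.inverse (borderedOp A φ u 0) g + φ v • Ring.inverse (borderedOp A φ u 0) u := by
  have h1 : borderedOp A φ u 0 v = g + φ v • u := by
    rw [borderedOp_apply, hv, zero_smul, sub_zero]
  rw [← map_smul, ← map_add, ← h1, ringInverse_apply_self hB]

theorem smul_eq_of_apply_eq (hB : IsUnit (borderedOp A φ u 0)) {v g : H} (hv : A v = g) :
    (1 - φ (Ring.inverse (borderedOp A φ u 0) u)) • v
      = (1 - φ (Ring.inverse (borderedOp A φ u 0) u)) • Ring.inverse (borderedOp A φ u 0) g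
        + φ (Ring.inverse (borderedOp A φ u 0) g) • Ring.inverse (borderedOp A φ u 0) u := by
  have h1 := eq_add_smul_of_apply_eq hB hv
  set z := Ring.inverse (borderedOp A φ u 0) u
  set y := Ring.inverse (borderedOp A φ u 0) g
  have h2 : φ v = φ y + φ v * φ z := by
    conv_lhs => rw [h1]
    rw [map_add, map_smul, smul_eq_mul]
  have h3 : φ y = (1 - φ z) * φ v := by linear_combination -h2
  conv_lhs => rw [h1]
  rw [smul_add, smul_smul, h3]

/-- The resolvent identity for the bordered operators at `x` and at `0`. -/
theorem one_sub_eq_mul (hB : IsUnit (borderedOp A φ u x)) (hB0 : IsUnit (borderedOp A φ u 0))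
    {v : H} (hv0 : v ≠ 0) (hv : A v = x • v) :
    1 - φ (Ring.inverse (borderedOp A φ u 0) u)
      = x * φ (Ring.inverse (borderedOp A φ u 0) (Ring.inverse (borderedOp A φ u x) u)) := by
  have h1 := apply_ringInverse_borderedOp hB hv0 hv
  have h2 := apply_ringInverse hB u
  set w := Ring.inverse (borderedOp A φ u x) u
  have h3 : borderedOp A φ u 0 w = u + x • w := by
    rw [borderedOp_apply, sub_add_eq_add_sub, sub_eq_iff_eq_add] at h2
    rw [borderedOp_apply, zero_smul, sub_zero, h2]
  have h4 := congrArg (fun t => φ (Ring.inverse (borderedOp A φ u 0) t)) h3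
  rw [ringInverse_apply_self hB0, h1, map_add, map_smul, map_add, map_smul, smul_eq_mul] at h4
  linear_combination h4

end Algebra

variable [CompleteSpace H]

/-- The Fredholm alternative. -/
theorem IsCompactOperator.isUnit_smul_one_add {K : H →L[ℂ] H} (hK : IsCompactOperator K) {c : ℂ}
    (hc : c ≠ 0) (hinj : ∀ v, c • v + K v = 0 → v = 0) :
    IsUnit (c • (1 : H →L[ℂ] H) + K) := by
  rcases hK.hasEigenvalue_or_mem_resolventSet (neg_ne_zero.2 hc) with h | h
  · obtain ⟨v, hv⟩ := h.exists_hasEigenvector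
    refine absurd (hinj v ?_) hv.2
    have := hv.apply_eq_smul
    simp only [ContinuousLinearMap.coe_coe] at this
    rw [this, neg_smul, add_neg_cancel]
  · rw [spectrum.mem_resolventSet_iff, Algebra.algebraMap_eq_smul_one] at h
    have := h.neg
    rwa [neg_sub, neg_smul, sub_neg_eq_add, add_comm] at this

/-- At an algebraically simple eigenvalue the bordered operator is invertible. -/
theorem exists_isUnit_borderedOp {K : H →L[ℂ] H} (hK : IsCompactOperator K)
    (hinj : ∀ v, K v = 0 → v = 0) {x : ℂ}
    (hx : Module.finrank ℂ
      (Module.End.maxGenEigenspace ((1 + K : H →L[ℂ] H) : H →ₗ[ℂ] H) x) = 1) :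
    ∃ (u : H) (φ : H →L[ℂ] ℂ), (1 + K) u = x • u ∧ φ u = 1 ∧
      IsUnit (borderedOp (1 + K) φ u x) := by
  set f : Module.End ℂ H := ((1 + K : H →L[ℂ] H) : H →ₗ[ℂ] H) with hf
  have hfv : ∀ v, f v = v + K v := fun v => rfl
  have hne : f.maxGenEigenspace x ≠ ⊥ := fun h => by
    rw [h, finrank_bot] at hx; exact zero_ne_one hx
  have hev : f.HasEigenvalue x :=
    Module.End.HasUnifEigenvalue.lt (k := ⊤) (m := 1) one_pos hne
  obtain ⟨u, hu⟩ := hev.exists_hasEigenvector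
  have hfu : f u = x • u := hu.apply_eq_smul
  have hmem : ∀ v, f v = x • v → v ∈ f.maxGenEigenspace x := fun v hv =>
    (Module.End.mem_maxGenEigenspace _ _ _).2 ⟨1, by
      rw [pow_one, LinearMap.sub_apply, hv]; simp⟩
  have hspan : ∀ v ∈ f.maxGenEigenspace x, ∃ c : ℂ, v = c • u := by
    intro v hv
    obtain ⟨c, hc⟩ := (finrank_eq_one_iff_of_nonzero' (⟨u, hmem u hfu⟩ : f.maxGenEigenspace x)
      (fun h => hu.2 (congrArg Subtype.val h))).1 hx ⟨v, hv⟩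
    exact ⟨c, (congrArg Subtype.val hc).symm⟩
  have hx1 : (1 : ℂ) - x ≠ 0 := by
    intro h
    rw [sub_eq_zero] at h
    refine hu.2 (hinj u ?_)
    rw [hfv, ← h, one_smul] at hfu
    simpa using hfu
  obtain ⟨φ, -, hφ⟩ := exists_dual_vector ℂ u (norm_ne_zero_iff.2 hu.2)
  have hnorm : ((‖u‖ : ℝ) : ℂ) ≠ 0 := by exact_mod_cast norm_ne_zero_iff.2 hu.2
  set ψ : H →L[ℂ] ℂ := ((‖u‖ : ℝ) : ℂ)⁻¹ • φ with hψ
  have hψu : ψ u = 1 := by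
    rw [hψ, _root_.smul_apply, hφ, smul_eq_mul]
    exact inv_mul_cancel₀ hnorm
  refine ⟨u, ψ, hfu, hψu, ?_⟩
  have hcomp : IsCompactOperator (K + ψ.smulRight u : H →L[ℂ] H) := by
    refine hK.add ?_
    have h1 : IsCompactOperator ((ContinuousLinearMap.id ℂ ℂ).smulRight u : ℂ →L[ℂ] H) :=
      isCompactOperator_of_locallyCompactSpace_rng _
    exact h1.comp_clm ψ
  have heq : borderedOp (1 + K) ψ u x = (1 - x) • (1 : H →L[ℂ] H) + (K + ψ.smulRight u) := by
    rw [borderedOp, sub_smul, one_smul]; abel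
  rw [heq]
  refine hcomp.isUnit_smul_one_add hx1 fun v hv => ?_
  have h1 : f v - x • v = -(ψ v • u) := by
    rw [eq_neg_iff_add_eq_zero, ← hv, hfv, _root_.add_apply,
      ContinuousLinearMap.smulRight_apply, sub_smul, one_smul]
    abel
  have h2 : v ∈ f.maxGenEigenspace x := by
    refine (Module.End.mem_maxGenEigenspace _ _ _).2 ⟨2, ?_⟩
    have e : ∀ w, (f - x • 1) w = f w - x • w := fun w => rfl
    rw [pow_two, Module.End.mul_apply, e v, h1, map_neg, map_smul, e u, hfu, sub_self, smul_zero,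
      neg_zero]
  obtain ⟨c, rfl⟩ := hspan v h2
  rw [map_smul, hfu, smul_comm, sub_self, map_smul, hψu, smul_eq_mul, mul_one, zero_eq_neg] at h1
  exact h1

variable {A : ℝ × ℝ → H →L[ℂ] H} {lam : ℝ × ℝ → ℂ} {p₁ : ℝ × ℝ} {u : H} {φ : H →L[ℂ] ℂ}

/-- A continuous branch of simple eigenvalues of an analytic family is analytic. The number
`1 - φ(B⁻¹ u)`, with the bordered operator `B` of `A(p) - x`, is analytic in `(p, x)`, vanishes if
`x` is an eigenvalue of `A(p)`, and has a nonzero derivative in `x`. -/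
theorem IsComplexAnalyticAt.eigenvalue (hA : IsComplexAnalyticAt A p₁)
    (hlam : ContinuousAt lam p₁)
    (heig : ∀ᶠ p in 𝓝 p₁, ∃ v ≠ 0, A p v = lam p • v) (hu : A p₁ u = lam p₁ • u) (hφ : φ u = 1)
    (hB : IsUnit (borderedOp (A p₁) φ u (lam p₁))) : IsComplexAnalyticAt lam p₁ := by
  obtain ⟨G, hG, hAG⟩ := hA
  have hGp : G (ofRealPair p₁) = A p₁ := hAG.self_of_nhds.symm
  let s : (ℂ × ℂ) × ℂ → ℂ := fun q => 1 - φ (Ring.inverse (borderedOp (G q.1) φ u q.2) u)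
  have hBan : AnalyticAt ℂ (fun q : (ℂ × ℂ) × ℂ => borderedOp (G q.1) φ u q.2)
      (ofRealPair p₁, lam p₁) := by
    refine AnalyticAt.add (AnalyticAt.sub ?_ (analyticAt_snd.smul analyticAt_const)) analyticAt_const
    exact AnalyticAt.comp (f := fun q : (ℂ × ℂ) × ℂ => q.1) hG analyticAt_fst
  have hinv : AnalyticAt ℂ (fun q : (ℂ × ℂ) × ℂ => Ring.inverse (borderedOp (G q.1) φ u q.2))
      (ofRealPair p₁, lam p₁) := by
    obtain ⟨w, hw⟩ := hB
    refine AnalyticAt.comp (g := Ring.inverse) ?_ hBan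
    simp only [hGp]
    rw [← hw]
    exact analyticAt_inverse w
  have hs : AnalyticAt ℂ s (ofRealPair p₁, lam p₁) := by
    refine analyticAt_const.sub ?_
    exact ((φ.comp (ContinuousLinearMap.apply ℂ H u)).analyticAt _).comp hinv
  have hunit : ∀ᶠ q in 𝓝 (ofRealPair p₁, lam p₁), IsUnit (borderedOp (G q.1) φ u q.2) := by
    refine hBan.continuousAt.eventually (Units.isOpen.mem_nhds ?_)
    rw [Set.mem_ofPred_eq]
    simpa only [hGp] using hB
  -- On the line `p = p₁` the bordered operator multiplies `u` by `1 + lam p₁ - x`.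
  have hline : ∀ᶠ x in 𝓝 (lam p₁), s (ofRealPair p₁, x) = 1 - (1 + lam p₁ - x)⁻¹ := by
    have ht : Tendsto (fun x => (ofRealPair p₁, x)) (𝓝 (lam p₁)) (𝓝 (ofRealPair p₁, lam p₁)) :=
      (by fun_prop : Continuous fun x : ℂ => (ofRealPair p₁, x)).tendsto _
    have hne : ∀ᶠ x in 𝓝 (lam p₁), 1 + lam p₁ - x ≠ 0 := by
      have : ContinuousAt (fun x : ℂ => 1 + lam p₁ - x) (lam p₁) := by fun_prop
      exact this.eventually_ne (by simp)
    filter_upwards [ht.eventually hunit, hne] with x h1 h2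
    have h3 : borderedOp (G (ofRealPair p₁)) φ u x ((1 + lam p₁ - x)⁻¹ • u) = u := by
      rw [map_smul, borderedOp_apply, hGp, hu, hφ, ← sub_smul, ← add_smul, smul_smul,
        show lam p₁ - x + 1 = 1 + lam p₁ - x by ring, inv_mul_cancel₀ h2, one_smul]
    have h4 : Ring.inverse (borderedOp (G (ofRealPair p₁)) φ u x) u = (1 + lam p₁ - x)⁻¹ • u := by
      have := ringInverse_apply_self h1 ((1 + lam p₁ - x)⁻¹ • u)
      rwa [h3] at this
    simp only [s]
    rw [h4, map_smul, hφ, smul_eq_mul, mul_one]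
  have hs0 : s (ofRealPair p₁, lam p₁) = 0 := by
    rw [hline.self_of_nhds]; simp
  have hds : deriv (fun x => s (ofRealPair p₁, x)) (lam p₁) ≠ 0 := by
    have h1 : HasDerivAt (fun x : ℂ => 1 - (1 + lam p₁ - x)⁻¹) (-1) (lam p₁) := by
      have h2 := (((hasDerivAt_id (lam p₁)).const_sub (1 + lam p₁)).inv (by simp)).const_sub 1
      simpa using h2
    rw [(h1.congr_of_eventuallyEq hline).deriv]
    norm_num
  obtain ⟨S, hS, -, hiff⟩ := hs.exists_implicit hs0 hds
  refine ⟨S, hS, ?_⟩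
  have ht : Tendsto (fun p => (ofRealPair p, lam p)) (𝓝 p₁) (𝓝 (ofRealPair p₁, lam p₁)) :=
    (continuous_ofRealPair.tendsto p₁).prodMk_nhds hlam
  filter_upwards [ht.eventually hiff, ht.eventually hunit, heig, hAG] with p h1 h2 h3 h4
  refine (h1.1 ?_).symm
  obtain ⟨v, hv0, hv⟩ := h3
  rw [h4] at hv
  simp only [s]
  rw [apply_ringInverse_borderedOp h2 hv0 hv, sub_self]

/-- The hypotheses of the perturbation theory at a point `p₁`: an analytic family `A(p)` with an
analytic eigenvalue `lam(p)` which vanishes at `p₁`, where the eigenvector is `u` and the bordered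
operator is invertible. -/
structure SimpleZeroEigenvalue (A : ℝ × ℝ → H →L[ℂ] H) (lam : ℝ × ℝ → ℂ) (p₁ : ℝ × ℝ) (u : H)
    (φ : H →L[ℂ] ℂ) : Prop where
  analytic : IsComplexAnalyticAt A p₁
  analytic_eigenvalue : IsComplexAnalyticAt lam p₁
  exists_eigenvector : ∀ᶠ p in 𝓝 p₁, ∃ v ≠ 0, A p v = lam p • v
  eigenvalue_eq_zero : lam p₁ = 0
  apply_eq_zero : A p₁ u = 0
  apply_eq_one : φ u = 1
  isUnit : IsUnit (borderedOp (A p₁) φ u 0)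

namespace SimpleZeroEigenvalue

theorem analytic_borderedOp (h : SimpleZeroEigenvalue A lam p₁ u φ) :
    IsComplexAnalyticAt (fun p => borderedOp (A p) φ u 0) p₁ :=
  (h.analytic.sub (.const _)).add (.const _)

theorem eventually_isUnit (h : SimpleZeroEigenvalue A lam p₁ u φ) :
    ∀ᶠ p in 𝓝 p₁, IsUnit (borderedOp (A p) φ u 0) :=
  h.analytic_borderedOp.continuousAt.eventually (Units.isOpen.mem_nhds h.isUnit)

theorem analytic_inverse (h : SimpleZeroEigenvalue A lam p₁ u φ) {g : ℝ × ℝ → H}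
    (hg : IsComplexAnalyticAt g p₁) :
    IsComplexAnalyticAt (fun p => Ring.inverse (borderedOp (A p) φ u 0) (g p)) p₁ :=
  (h.analytic_borderedOp.inverse h.isUnit).clm_apply hg

theorem inverse_apply (h : SimpleZeroEigenvalue A lam p₁ u φ) :
    Ring.inverse (borderedOp (A p₁) φ u 0) u = u := by
  have h1 : borderedOp (A p₁) φ u 0 u = u := by
    rw [borderedOp_apply, h.apply_eq_zero, h.apply_eq_one, zero_smul, sub_zero, zero_add, one_smul]
  have := ringInverse_apply_self h.isUnit u
  rwa [h1] at this

/-- `1 - φ(B⁻¹ u)` is a nonvanishing analytic multiple of the eigenvalue. -/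
theorem exists_analytic_factor (h : SimpleZeroEigenvalue A lam p₁ u φ) :
    ∃ q : ℝ × ℝ → ℂ, IsComplexAnalyticAt q p₁ ∧ q p₁ = 1 ∧
      ∀ᶠ p in 𝓝 p₁, 1 - φ (Ring.inverse (borderedOp (A p) φ u 0) u) = lam p * q p := by
  have hB'an : IsComplexAnalyticAt (fun p => borderedOp (A p) φ u (lam p)) p₁ :=
    (h.analytic.sub (h.analytic_eigenvalue.smul (.const _))).add (.const _)
  have hB' : IsUnit (borderedOp (A p₁) φ u (lam p₁)) := by
    rw [h.eigenvalue_eq_zero]; exact h.isUnit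
  have hunit' : ∀ᶠ p in 𝓝 p₁, IsUnit (borderedOp (A p) φ u (lam p)) :=
    hB'an.continuousAt.eventually (Units.isOpen.mem_nhds hB')
  refine ⟨fun p => φ (Ring.inverse (borderedOp (A p) φ u 0)
    (Ring.inverse (borderedOp (A p) φ u (lam p)) u)),
    (h.analytic_inverse ((hB'an.inverse hB').clm_apply (.const _))).clm_comp φ, ?_, ?_⟩
  · simp only
    rw [h.eigenvalue_eq_zero, h.inverse_apply, h.inverse_apply, h.apply_eq_one]
  · filter_upwards [hunit', h.eventually_isUnit, h.exists_eigenvector] with p h1 h2 ⟨v, h3, h4⟩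
    exact one_sub_eq_mul h1 h2 h3 h4

/-- A functional `τ` of the solutions of `A(p) v = g(p)`, multiplied by the simple eigenvalue, is
analytic also where the eigenvalue vanishes, if `τ` vanishes on the kernel of `A(p)` for real `p`.
With the bordered operator `B` and `s = 1 - φ(B⁻¹ u)`, solutions satisfy
`s v = s B⁻¹ g + φ(B⁻¹ g) B⁻¹ u`. -/
theorem analytic_mul_solution (h : SimpleZeroEigenvalue A lam p₁ u φ) {g : ℝ × ℝ → H}
    (hg : IsComplexAnalyticAt g p₁) {τ : H →L[ℂ] ℂ}
    (hτ : ∀ᶠ p in 𝓝 p₁, ∀ v, A p v = 0 → τ v = 0) {sol : ℝ × ℝ → H}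
    (hsol : ∀ᶠ p in 𝓝 p₁, lam p ≠ 0 → A p (sol p) = g p) :
    IsComplexAnalyticAt (fun p => lam p * τ (sol p)) p₁ := by
  obtain ⟨q, hq, hq1, hlq⟩ := h.exists_analytic_factor
  have hz := h.analytic_inverse (g := fun _ => u) (.const _)
  have hy := h.analytic_inverse hg
  have hF := ((((IsComplexAnalyticAt.const (1 : ℂ)).sub (hz.clm_comp φ)).mul (hy.clm_comp τ)).add
    ((hy.clm_comp φ).mul (hz.clm_comp τ))).div hq (by rw [hq1]; exact one_ne_zero)
  refine hF.congr ?_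
  have hq0 : ∀ᶠ p in 𝓝 p₁, q p ≠ 0 := hq.continuousAt.eventually_ne (by rw [hq1]; exact one_ne_zero)
  filter_upwards [hlq, hq0, h.eventually_isUnit, hτ, hsol] with p h1 h2 h3 h4 h5
  rw [div_eq_iff h2]
  by_cases h6 : lam p = 0
  · have h7 : A p (Ring.inverse (borderedOp (A p) φ u 0) u) = 0 := by
      rw [apply_eq_sub_smul h3]
      rw [h6, zero_mul, sub_eq_zero] at h1
      rw [← h1, one_smul, sub_self]
    rw [h1, h6, h4 _ h7]
    ring
  · have h7 := congrArg τ (smul_eq_of_apply_eq h3 (h5 h6))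
    rw [map_smul, map_add, map_smul, map_smul, smul_eq_mul, smul_eq_mul, smul_eq_mul] at h7
    rw [← h7, h1]
    ring

/-- If the equation is solvable at `p₁`, then on a line on which the eigenvalue has a simple zero
the value of `τ` at solutions converges to its value at any solution at `p₁`. -/
theorem tendsto_solution {κ₀ ω₀ : ℝ} (h : SimpleZeroEigenvalue A lam (κ₀, ω₀) u φ)
    {g : ℝ × ℝ → H} (hg : IsComplexAnalyticAt g (κ₀, ω₀)) {τ : H →L[ℂ] ℂ} (hτ : τ u = 0)
    {sol : ℝ × ℝ → H} (hsol : ∀ᶠ p in 𝓝 (κ₀, ω₀), lam p ≠ 0 → A p (sol p) = g p)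
    (hsol₀ : A (κ₀, ω₀) (sol (κ₀, ω₀)) = g (κ₀, ω₀))
    (hd : deriv (fun ω : ℝ => lam (κ₀, ω)) ω₀ ≠ 0) :
    Tendsto (fun ω => τ (sol (κ₀, ω))) (𝓝[≠] ω₀) (𝓝 (τ (sol (κ₀, ω₀)))) := by
  obtain ⟨q, hq, hq1, hlq⟩ := h.exists_analytic_factor
  have hz := h.analytic_inverse (g := fun _ => u) (.const _)
  have hy := h.analytic_inverse hg
  set z : ℝ × ℝ → H := fun p => Ring.inverse (borderedOp (A p) φ u 0) u with hzdef
  set y : ℝ × ℝ → H := fun p => Ring.inverse (borderedOp (A p) φ u 0) (g p) with hydef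
  have hz0 : z (κ₀, ω₀) = u := h.inverse_apply
  have hsy := eq_add_smul_of_apply_eq h.isUnit hsol₀
  rw [h.inverse_apply] at hsy
  have hφy : φ (y (κ₀, ω₀)) = 0 := by
    have := congrArg φ hsy
    rw [map_add, map_smul, h.apply_eq_one, smul_eq_mul, mul_one] at this
    simpa using this
  have hτy : τ (sol (κ₀, ω₀)) = τ (y (κ₀, ω₀)) := by
    conv_lhs => rw [hsy]
    rw [map_add, map_smul, hτ, smul_zero, add_zero]
  have hline : Tendsto (fun ω : ℝ => (κ₀, ω)) (𝓝[≠] ω₀) (𝓝 (κ₀, ω₀)) :=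
    ((by fun_prop : Continuous fun ω : ℝ => (κ₀, ω)).tendsto' _ _ rfl).mono_left nhdsWithin_le_nhds
  have slope : ∀ {F : ℝ × ℝ → ℂ}, IsComplexAnalyticAt F (κ₀, ω₀) → F (κ₀, ω₀) = 0 →
      Tendsto (fun ω : ℝ => F (κ₀, ω) / ((ω - ω₀ : ℝ) : ℂ)) (𝓝[≠] ω₀)
        (𝓝 (deriv (fun ω : ℝ => F (κ₀, ω)) ω₀)) := by
    intro F hF h0
    have h1 := hF.analyticAt.hasDerivAt_snd
    rw [h1.deriv]
    refine (hasDerivAt_iff_tendsto_slope.1 h1).congr fun ω => ?_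
    rw [slope_def_module, h0, sub_zero, Complex.real_smul]
    push_cast
    rw [inv_mul_eq_div]
  have hlim1 := slope h.analytic_eigenvalue h.eigenvalue_eq_zero
  have hlim2 := slope (hy.clm_comp φ) hφy
  have hqlim := hq.continuousAt.tendsto.comp hline
  rw [hq1] at hqlim
  have hτz := (hz.clm_comp τ).continuousAt.tendsto.comp hline
  rw [hz0, hτ] at hτz
  have hτylim := (hy.clm_comp τ).continuousAt.tendsto.comp hline
  have hq' := hlim1.mul hqlim
  rw [mul_one] at hq'
  have hall := hτylim.add ((hlim2.div hq' hd).mul hτz)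
  rw [mul_zero, add_zero, ← hτy] at hall
  refine hall.congr' ?_
  filter_upwards [self_mem_nhdsWithin, hlim1.eventually_ne hd, hline.eventually hlq,
    hline.eventually h.eventually_isUnit, hline.eventually hsol, hqlim.eventually_ne one_ne_zero]
    with ω hω h1 h2 h3 h4 h5
  have hω' : ((ω - ω₀ : ℝ) : ℂ) ≠ 0 := by exact_mod_cast sub_ne_zero.2 hω
  have hl0 : lam (κ₀, ω) ≠ 0 := fun h0 => h1 (by rw [h0, zero_div])
  have h6 := congrArg τ (smul_eq_of_apply_eq h3 (h4 hl0))
  rw [h2, map_smul, map_add, map_smul, map_smul, smul_eq_mul, smul_eq_mul, smul_eq_mul] at h6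
  simp only [Function.comp_apply, Pi.div_apply] at h5 ⊢
  have hlq0 : lam (κ₀, ω) * q (κ₀, ω) ≠ 0 := mul_ne_zero hl0 h5
  field_simp
  linear_combination -h6

/-- First-order perturbation theory: if `⟨u, M(p) A(p) u⟩` is real for an analytic family `M`, and
`u` is also in the kernel of the adjoint of `M(p₁) A(p₁)`, then `⟨u, M(p₁) u⟩ lam(p)` is real up to
`o(|p - p₁|)`. -/
theorem isLittleO_im (h : SimpleZeroEigenvalue A lam p₁ u φ) {M : ℝ × ℝ → H →L[ℂ] H}
    (hM : IsComplexAnalyticAt M p₁) (hreal : ∀ᶠ p in 𝓝 p₁, (inner ℂ u (M p (A p u))).im = 0)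
    (hadj : ∀ v, inner ℂ u (M p₁ (A p₁ v)) = 0) :
    (fun p => (inner ℂ u (M p₁ u) * lam p).im) =o[𝓝 p₁] fun p => ‖p - p₁‖ := by
  obtain ⟨q, hq, hq1, hlq⟩ := h.exists_analytic_factor
  have hz := h.analytic_inverse (g := fun _ => u) (.const _)
  set z : ℝ × ℝ → H := fun p => Ring.inverse (borderedOp (A p) φ u 0) u with hzdef
  have hz0 : z p₁ = u := h.inverse_apply
  let I : H →L[ℂ] ℂ := innerSL ℂ u
  have hI : ∀ v, I v = inner ℂ u v := fun v => rfl
  have hF : IsComplexAnalyticAt (fun p => M p * A p) p₁ := hM.mul h.analytic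
  -- The coupling of the perturbation of the operator with that of the eigenvector is quadratic.
  have h1 : (fun p => I ((M p * A p - M p₁ * A p₁) (z p - z p₁))) =o[𝓝 p₁] fun p => ‖p - p₁‖ := by
    have hzo : (fun p => z p - z p₁) =o[𝓝 p₁] fun _ => (1 : ℝ) := by
      rw [Asymptotics.isLittleO_one_iff]
      simpa using hz.continuousAt.tendsto.sub_const (z p₁)
    have h2 : (fun p => I ((M p * A p - M p₁ * A p₁) (z p - z p₁)))
        =O[𝓝 p₁] fun p => ‖M p * A p - M p₁ * A p₁‖ * ‖z p - z p₁‖ := by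
      refine Asymptotics.IsBigO.of_bound ‖I‖ (.of_forall fun p => ?_)
      rw [Real.norm_of_nonneg (by positivity)]
      exact (I.le_opNorm _).trans (by gcongr; exact ContinuousLinearMap.le_opNorm _ _)
    refine h2.trans_isLittleO ?_
    have := hF.isBigO_sub.norm_left.mul_isLittleO hzo.norm_left
    simpa using this
  -- The dependence of the coefficient of `lam` on `p` is negligible since `lam p₁ = 0`.
  have h3 : (fun p => lam p * (q p * I (M p u) - I (M p₁ u))) =o[𝓝 p₁] fun p => ‖p - p₁‖ := by
    have hl := h.analytic_eigenvalue.isBigO_sub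
    simp only [h.eigenvalue_eq_zero, sub_zero] at hl
    have hc : (fun p => q p * I (M p u) - I (M p₁ u)) =o[𝓝 p₁] fun _ => (1 : ℝ) := by
      rw [Asymptotics.isLittleO_one_iff]
      have := (hq.mul ((hM.clm_apply (.const u)).clm_comp I)).continuousAt.tendsto.sub_const
        (I (M p₁ u))
      rw [hq1, one_mul, sub_self] at this
      exact this
    have := hl.mul_isLittleO hc
    simpa using this
  have h4 : (fun p => (I ((M p * A p - M p₁ * A p₁) (z p - z p₁))
      - lam p * (q p * I (M p u) - I (M p₁ u))).im) =o[𝓝 p₁] fun p => ‖p - p₁‖ :=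
    (Asymptotics.isBigO_of_le _ fun p => by
      rw [Real.norm_eq_abs]
      exact Complex.abs_im_le_norm _).trans_isLittleO (h1.sub h3)
  refine h4.congr' ?_ EventuallyEq.rfl
  filter_upwards [hlq, h.eventually_isUnit, hreal] with p h5 h6 h7
  have e1 : I ((M p * A p) (z p)) = lam p * q p * I (M p u) := by
    rw [mul_apply_eq_comp, hzdef]
    simp only
    rw [apply_eq_sub_smul h6, map_sub, map_smul, map_sub, map_smul, smul_eq_mul, ← h5]
    ring
  have e2 : ∀ v, I ((M p₁ * A p₁) v) = 0 := fun v => hadj v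
  have e3 : (M p * A p - M p₁ * A p₁) (z p - z p₁)
      = (M p * A p) (z p) - (M p * A p) u - ((M p₁ * A p₁) (z p) - (M p₁ * A p₁) u) := by
    rw [hz0, _root_.sub_apply, map_sub, map_sub]
  rw [e3, map_sub, map_sub, map_sub, e1, e2, e2, sub_zero, sub_zero]
  have e4 : (I ((M p * A p) u)).im = 0 := h7
  rw [show lam p * q p * I (M p u) - I ((M p * A p) u) - lam p * (q p * I (M p u) - I (M p₁ u))
    = I (M p₁ u) * lam p - I ((M p * A p) u) by ring, Complex.sub_im, e4, sub_zero]
  rfl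

end SimpleZeroEigenvalue

end SimpleEigenvalue

/-! ### Fourier modes on the truncated period -/

namespace PeriodicSlab

variable (S : PeriodicSlab)

theorem measurableSet_cell : MeasurableSet S.cell := measurableSet_Ioo.prod measurableSet_Ioo

theorem volume_restrict_cell : (volume.restrict S.cell : Measure (ℝ × ℝ))
    = (volume.restrict (Ioo (-Real.pi) Real.pi)).prod (volume.restrict (Ioo (-S.L) S.L)) := by
  rw [cell, Measure.prod_restrict, Measure.volume_eq_prod]

instance isFiniteMeasure_cell : IsFiniteMeasure (volume.restrict S.cell) := by
  rw [volume_restrict_cell]; infer_instance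

theorem ae_mem_cell : ∀ᵐ p ∂volume.restrict S.cell, p ∈ S.cell :=
  ae_restrict_mem S.measurableSet_cell

theorem memLp_cell {ψ : ℝ × ℝ → ℂ} (hψ : Continuous ψ) : MemLp ψ 2 (volume.restrict S.cell) := by
  have hK : IsCompact (Icc (-Real.pi) Real.pi ×ˢ Icc (-S.L) S.L) :=
    isCompact_Icc.prod isCompact_Icc
  obtain ⟨C, hC⟩ := hK.exists_bound_of_continuousOn hψ.continuousOn
  refine MemLp.of_bound hψ.aestronglyMeasurable C ?_
  filter_upwards [S.ae_mem_cell] with p hp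
  exact hC p ⟨Ioo_subset_Icc_self hp.1, Ioo_subset_Icc_self hp.2⟩

theorem integrable_L2 (f : S.L2) : Integrable (fun p => f p) (volume.restrict S.cell) :=
  (Lp.memLp f).integrable (by norm_num)

/-- The function `e^{imx} g(z)`. -/
def modeFun (m : ℤ) (g : ℝ → ℝ) (p : ℝ × ℝ) : ℂ := Complex.exp (Complex.I * m * p.1) * g p.2

theorem continuous_modeFun (m : ℤ) {g : ℝ → ℝ} (hg : Continuous g) : Continuous (modeFun m g) := by
  unfold modeFun
  fun_prop

theorem norm_modeFun (m : ℤ) (g : ℝ → ℝ) (p : ℝ × ℝ) : ‖modeFun m g p‖ = |g p.2| := by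
  rw [modeFun, norm_mul, Complex.norm_real, Real.norm_eq_abs,
    show Complex.I * m * p.1 = ((m * p.1 : ℝ) : ℂ) * Complex.I by push_cast; ring,
    Complex.norm_exp_ofReal_mul_I, one_mul]

theorem star_modeFun (m : ℤ) (g : ℝ → ℝ) (p : ℝ × ℝ) :
    star (modeFun m g p) = modeFun (-m) g p := by
  rw [modeFun, modeFun, Complex.star_def, map_mul, Complex.conj_ofReal, ← Complex.exp_conj]
  simp

/-- The function `e^{imx} g(z)` as an element of `L²`. -/
def mode (m : ℤ) (g : C(ℝ, ℝ)) : S.L2 := (S.memLp_cell (continuous_modeFun m g.continuous)).toLp _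

theorem inner_mode (m : ℤ) (g : C(ℝ, ℝ)) (f : S.L2) :
    inner ℂ (S.mode m g) f = ∫ p in S.cell, modeFun (-m) g p * f p := by
  rw [L2.inner_def]
  refine integral_congr_ae ?_
  filter_upwards [(S.memLp_cell (continuous_modeFun m g.continuous)).coeFn_toLp] with p hp
  rw [mode, hp, RCLike.inner_apply, mul_comm, ← star_modeFun]
  rfl

theorem integral_exp_mul (m : ℤ) :
    ∫ x in Ioo (-Real.pi) Real.pi, Complex.exp (Complex.I * m * x)
      = if m = 0 then (2 * Real.pi : ℂ) else 0 := by
  rw [← integral_Ioc_eq_integral_Ioo, ← intervalIntegral.integral_of_le (by linarith [Real.pi_pos])]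
  split_ifs with h
  · subst h
    simp
    ring
  · have hc : Complex.I * m ≠ 0 := mul_ne_zero Complex.I_ne_zero (by exact_mod_cast h)
    rw [integral_exp_mul_complex hc, div_eq_zero_iff]
    left
    rw [sub_eq_zero]
    refine Complex.exp_eq_exp_iff_exists_int.2 ⟨m, ?_⟩
    push_cast
    ring

theorem inner_mode_mode (m n : ℤ) (g h : C(ℝ, ℝ)) :
    inner ℂ (S.mode m g) (S.mode n h)
      = if m = n then ((2 * Real.pi * ∫ z in Ioo (-S.L) S.L, g z * h z : ℝ) : ℂ) else 0 := by
  have h1 : inner ℂ (S.mode m g) (S.mode n h)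
      = ∫ p in S.cell, Complex.exp (Complex.I * (n - m : ℤ) * p.1) * ((g p.2 * h p.2 : ℝ) : ℂ) := by
    rw [inner_mode]
    refine integral_congr_ae ?_
    filter_upwards [(S.memLp_cell (continuous_modeFun n h.continuous)).coeFn_toLp] with p hp
    rw [mode, hp, modeFun, modeFun, mul_mul_mul_comm, ← Complex.exp_add]
    push_cast
    ring_nf
  rw [h1, volume_restrict_cell, integral_prod_mul (fun x : ℝ => Complex.exp (Complex.I * (n - m : ℤ) * x))
    (fun z : ℝ => ((g z * h z : ℝ) : ℂ)), integral_exp_mul, integral_complex_ofReal]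
  by_cases h : m = n
  · rw [if_pos h, if_pos (sub_eq_zero.2 h.symm)]; push_cast; ring
  · rw [if_neg h, if_neg (sub_ne_zero.2 (Ne.symm h)), zero_mul]

theorem tendsto_integral_modeFun (m : ℤ) (f : S.L2) {h : ℕ → ℝ → ℝ} {g : ℝ → ℝ} {C : ℝ}
    (hc : ∀ n, Continuous (h n)) (hb : ∀ n, ∀ z ∈ Ioo (-S.L) S.L, |h n z| ≤ C)
    (hl : ∀ z ∈ Ioo (-S.L) S.L, Tendsto (fun n => h n z) atTop (𝓝 (g z))) :
    Tendsto (fun n => ∫ p in S.cell, modeFun m (h n) p * f p) atTop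
      (𝓝 (∫ p in S.cell, modeFun m g p * f p)) := by
  refine tendsto_integral_of_dominated_convergence (fun p => C * ‖f p‖) (fun n => ?_)
    ((S.integrable_L2 f).norm.const_mul C) (fun n => ?_) ?_
  · exact (continuous_modeFun m (hc n)).aestronglyMeasurable.mul (Lp.aestronglyMeasurable f)
  · filter_upwards [S.ae_mem_cell] with p hp
    rw [norm_mul, norm_modeFun]
    exact mul_le_mul_of_nonneg_right (hb n _ hp.2) (norm_nonneg _)
  · filter_upwards [S.ae_mem_cell] with p hp
    refine Tendsto.mul_const _ (Tendsto.const_mul _ ?_)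
    exact (Complex.continuous_ofReal.tendsto _).comp (hl _ hp.2)

/-! ### Integration by parts -/

theorem contDiff_modeFun (m : ℤ) {g : ℝ → ℝ} (hg : ContDiff ℝ (⊤ : ℕ∞) g) :
    ContDiff ℝ (⊤ : ℕ∞) (modeFun m g) := by
  unfold modeFun
  refine ContDiff.mul ?_ ?_
  · refine Complex.contDiff_exp.comp (contDiff_const.mul ?_)
    exact Complex.ofRealCLM.contDiff.comp contDiff_fst
  · exact Complex.ofRealCLM.contDiff.comp (hg.comp contDiff_snd)

theorem hasFDerivAt_modeFun (m : ℤ) {g : ℝ → ℝ} {g' : ℝ} {p : ℝ × ℝ} (hg : HasDerivAt g g' p.2) :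
    fderiv ℝ (modeFun m g) p (1, 0) = Complex.I * m * modeFun m g p ∧
    fderiv ℝ (modeFun m g) p (0, 1) = Complex.exp (Complex.I * m * p.1) * g' := by
  have h1 : HasFDerivAt (fun p : ℝ × ℝ => Complex.exp (Complex.I * m * p.1)) _ p :=
    (((Complex.ofRealCLM.hasFDerivAt (x := p.1)).comp p hasFDerivAt_fst).const_mul
      (Complex.I * m)).cexp
  have h2 : HasFDerivAt (fun p : ℝ × ℝ => (g p.2 : ℂ)) _ p :=
    (Complex.ofRealCLM.hasFDerivAt (x := g p.2)).comp p (hg.hasFDerivAt.comp p hasFDerivAt_snd)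
  have h3 := h1.mul h2
  have h4 : modeFun m g = (fun p : ℝ × ℝ => Complex.exp (Complex.I * m * p.1)) * fun p => (g p.2 : ℂ) := rfl
  rw [h4, h3.fderiv]
  constructor
  · simp; ring
  · simp

theorem isTest_modeFun (m : ℤ) {g : ℝ → ℝ} (hg : ContDiff ℝ (⊤ : ℕ∞) g)
    (h0 : ∃ δ > 0, ∀ z, S.L - δ ≤ |z| → g z = 0) : S.IsTest (modeFun m g) where
  smooth := contDiff_modeFun m hg
  periodic x z := by
    simp only [modeFun]
    congr 1
    refine Complex.exp_eq_exp_iff_exists_int.2 ⟨m, ?_⟩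
    push_cast
    ring
  support := by
    obtain ⟨δ, hδ, h⟩ := h0
    exact ⟨δ, hδ, fun x z hz => by rw [modeFun, h z hz, Complex.ofReal_zero, mul_zero]⟩

/-- Smooth functions of `z` with compact support in `(-L, L)` that converge to `1` there. -/
def cutoff (n : ℕ) (z : ℝ) : ℝ := Real.smoothTransition ((n + 1) * (S.L ^ 2 - z ^ 2) - 1)

theorem contDiff_cutoff (n : ℕ) : ContDiff ℝ (⊤ : ℕ∞) (S.cutoff n) :=
  Real.smoothTransition.contDiff.comp (by fun_prop)

theorem abs_cutoff_le (n : ℕ) (z : ℝ) : |S.cutoff n z| ≤ 1 := by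
  rw [cutoff, abs_of_nonneg (Real.smoothTransition.nonneg _)]
  exact Real.smoothTransition.le_one _

theorem cutoff_eq_zero (n : ℕ) : ∃ δ > 0, ∀ z, S.L - δ ≤ |z| → S.cutoff n z = 0 := by
  have hL := S.L_pos
  have hn : (0 : ℝ) < n + 1 := by positivity
  refine ⟨min S.L (1 / (2 * S.L * (n + 1))), lt_min hL (by positivity), fun z hz => ?_⟩
  refine Real.smoothTransition.zero_of_nonpos ?_
  have h1 : S.L - |z| ≤ 1 / (2 * S.L * (n + 1)) := by linarith [min_le_right S.L (1 / (2 * S.L * (n + 1)))]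
  rw [le_div_iff₀ (by positivity)] at h1
  rw [← sq_abs z]
  by_cases h2 : |z| ≤ S.L
  · nlinarith [abs_nonneg z, mul_nonneg (sub_nonneg.2 h2) hn.le]
  · nlinarith [abs_nonneg z, mul_nonneg (sub_nonneg.2 (not_le.1 h2).le) hn.le]

theorem eventually_le_mul {z : ℝ} (hz : z ∈ Ioo (-S.L) S.L) :
    ∀ᶠ n : ℕ in atTop, 2 < (n + 1 : ℝ) * (S.L ^ 2 - z ^ 2) := by
  have h : 0 < S.L ^ 2 - z ^ 2 := by nlinarith [hz.1, hz.2]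
  have h1 : Tendsto (fun n : ℕ => ((n : ℝ) + 1) * (S.L ^ 2 - z ^ 2)) atTop atTop :=
    (tendsto_natCast_atTop_atTop.atTop_add tendsto_const_nhds).atTop_mul_const h
  exact h1.eventually_gt_atTop 2

theorem tendsto_cutoff {z : ℝ} (hz : z ∈ Ioo (-S.L) S.L) :
    Tendsto (fun n => S.cutoff n z) atTop (𝓝 1) := by
  refine tendsto_const_nhds.congr' ?_
  filter_upwards [S.eventually_le_mul hz] with n hn
  exact (Real.smoothTransition.one_of_one_le (by linarith)).symm

theorem exists_abs_deriv_smoothTransition_le :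
    ∃ B : ℝ, ∀ t, |deriv Real.smoothTransition t| ≤ B ∧
      (1 < t → deriv Real.smoothTransition t = 0) := by
  have hc : Continuous (deriv Real.smoothTransition) :=
    (Real.smoothTransition.contDiff (n := 1)).continuous_deriv le_rfl
  obtain ⟨B, hB⟩ := (isCompact_Icc (a := (0 : ℝ)) (b := 1)).exists_bound_of_continuousOn hc.continuousOn
  have h1 : ∀ t, 1 < t → deriv Real.smoothTransition t = 0 := fun t ht => by
    have : Real.smoothTransition =ᶠ[𝓝 t] fun _ => 1 := by
      filter_upwards [lt_mem_nhds ht] with s hs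
      exact Real.smoothTransition.one_of_one_le hs.le
    rw [this.deriv_eq, deriv_const]
  have h0 : ∀ t, t < 0 → deriv Real.smoothTransition t = 0 := fun t ht => by
    have : Real.smoothTransition =ᶠ[𝓝 t] fun _ => 0 := by
      filter_upwards [gt_mem_nhds ht] with s hs
      exact Real.smoothTransition.zero_of_nonpos hs.le
    rw [this.deriv_eq, deriv_const]
  have hB0 : 0 ≤ B := (norm_nonneg _).trans (hB 0 (by simp))
  refine ⟨B, fun t => ⟨?_, h1 t⟩⟩
  rcases lt_or_ge t 0 with h | h
  · rw [h0 t h, abs_zero]; exact hB0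
  rcases lt_or_ge 1 t with h' | h'
  · rw [h1 t h', abs_zero]; exact hB0
  · exact hB t ⟨h, h'⟩

theorem hasDerivAt_cutoff (n : ℕ) (z : ℝ) :
    HasDerivAt (S.cutoff n) (deriv Real.smoothTransition ((n + 1) * (S.L ^ 2 - z ^ 2) - 1)
      * ((n + 1) * (-(2 * z)))) z := by
  have h1 : HasDerivAt (fun z : ℝ => (n + 1 : ℝ) * (S.L ^ 2 - z ^ 2) - 1) ((n + 1) * (-(2 * z))) z := by
    have := (((hasDerivAt_pow 2 z).const_sub (S.L ^ 2)).const_mul (n + 1 : ℝ)).sub_const 1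
    simpa using this
  have h2 : HasDerivAt Real.smoothTransition _ ((n + 1) * (S.L ^ 2 - z ^ 2) - 1) :=
    ((Real.smoothTransition.contDiff (n := 1)).differentiable (by simp)).differentiableAt.hasDerivAt
  exact h2.comp z h1

/-- Integration by parts in `x` needs no boundary condition on the sides `z = ±L`. -/
theorem integral_modeFun_dx (u : S.H1per) (m : ℤ) {g : ℝ → ℝ} (hg : ContDiff ℝ (⊤ : ℕ∞) g) :
    ∫ p in S.cell, modeFun m g p * u.1 1 p
      = -(Complex.I * m) * ∫ p in S.cell, modeFun m g p * u.1 0 p := by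
  have hgc := hg.continuous
  obtain ⟨C, hC⟩ := (isCompact_Icc (a := -S.L) (b := S.L)).exists_bound_of_continuousOn
    hgc.continuousOn
  have key : ∀ f : S.L2, Tendsto (fun n => ∫ p in S.cell, modeFun m (fun z => S.cutoff n z * g z) p * f p)
      atTop (𝓝 (∫ p in S.cell, modeFun m g p * f p)) := fun f => by
    refine S.tendsto_integral_modeFun m f (C := C)
      (fun n => (S.contDiff_cutoff n).continuous.mul hgc) (fun n z hz => ?_) fun z hz => ?_
    · rw [abs_mul]
      exact (mul_le_of_le_one_left (abs_nonneg _) (S.abs_cutoff_le n z)).trans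
        (hC z (Ioo_subset_Icc_self hz))
    · simpa using (S.tendsto_cutoff hz).mul_const (g z)
  refine tendsto_nhds_unique (key (u.1 1)) (((key (u.1 0)).const_mul _).congr fun n => ?_)
  have hsm : ContDiff ℝ (⊤ : ℕ∞) (fun z => S.cutoff n z * g z) := (S.contDiff_cutoff n).mul hg
  have htest : S.IsTest (modeFun m fun z => S.cutoff n z * g z) := by
    refine S.isTest_modeFun m hsm ?_
    obtain ⟨δ, hδ, h⟩ := S.cutoff_eq_zero n
    exact ⟨δ, hδ, fun z hz => by rw [h z hz, zero_mul]⟩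
  have h1 := (u.2 _ htest).1
  rw [← neg_eq_iff_eq_neg] at h1
  simp only [mul_comm _ ((u.1 1 : S.L2) _)]
  rw [← h1, neg_mul, ← integral_const_mul]
  congr 1
  refine integral_congr_ae (.of_forall fun p => ?_)
  simp only
  rw [(hasFDerivAt_modeFun m (hsm.differentiable (by simp) _).hasDerivAt).1]
  ring

/-- Integration by parts in `z` against functions that vanish on the sides `z = ±L`. -/
theorem integral_modeFun_dz (u : S.H1per) (m : ℤ) {g : ℝ → ℝ} (hg : ContDiff ℝ (⊤ : ℕ∞) g)
    (hgL : g S.L = 0) (hgL' : g (-S.L) = 0) :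
    ∫ p in S.cell, modeFun m g p * u.1 2 p = -∫ p in S.cell, modeFun m (deriv g) p * u.1 0 p := by
  have hL := S.L_pos
  have hgc := hg.continuous
  have hgd : ∀ z, HasDerivAt g (deriv g z) z := fun z =>
    (hg.differentiable (by simp) _).hasDerivAt
  have hgc' : Continuous (deriv g) := hg.continuous_deriv (by simp)
  obtain ⟨C, hC⟩ := (isCompact_Icc (a := -S.L) (b := S.L)).exists_bound_of_continuousOn
    hgc.continuousOn
  obtain ⟨K, hK⟩ := (isCompact_Icc (a := -S.L) (b := S.L)).exists_bound_of_continuousOn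
    hgc'.continuousOn
  obtain ⟨B, hB⟩ := exists_abs_deriv_smoothTransition_le
  have hK0 : 0 ≤ K := (norm_nonneg _).trans (hK 0 ⟨by linarith, hL.le⟩)
  have hB0 : 0 ≤ B := (abs_nonneg _).trans (hB 0).1
  have hmv : ∀ z ∈ Icc (-S.L) S.L, ∀ w ∈ Icc (-S.L) S.L, |g z - g w| ≤ K * |z - w| :=
    fun z hz w hw => (convex_Icc (-S.L) S.L).norm_image_sub_le_of_norm_hasDerivWithin_le
      (fun x _ => (hgd x).hasDerivWithinAt) hK hw hz
  have hdist : ∀ z ∈ Ioo (-S.L) S.L, |g z| * S.L ≤ K * (S.L ^ 2 - z ^ 2) := by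
    intro z hz
    have h1 := hmv z (Ioo_subset_Icc_self hz) S.L ⟨by linarith, le_rfl⟩
    have h2 := hmv z (Ioo_subset_Icc_self hz) (-S.L) ⟨le_rfl, by linarith⟩
    rw [hgL, sub_zero, abs_of_neg (sub_neg.2 hz.2)] at h1
    rw [hgL', sub_zero, sub_neg_eq_add,
      abs_of_pos (a := z + S.L) (by linarith [hz.1])] at h2
    rcases le_total 0 z with h | h
    · have h3 := mul_nonneg hK0 (mul_nonneg h (sub_pos.2 hz.2).le)
      linear_combination S.L * h1 + h3
    · have h3 := mul_nonneg hK0 (mul_nonneg (neg_nonneg.2 h) (by linarith [hz.1] : 0 ≤ z + S.L))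
      linear_combination S.L * h2 + h3
  have hderiv : ∀ n z, HasDerivAt (fun z => S.cutoff n z * g z)
      (deriv Real.smoothTransition ((n + 1) * (S.L ^ 2 - z ^ 2) - 1) * ((n + 1) * (-(2 * z))) * g z
        + S.cutoff n z * deriv g z) z := fun n z => (S.hasDerivAt_cutoff n z).mul (hgd z)
  have hcd : Continuous (deriv Real.smoothTransition) :=
    (Real.smoothTransition.contDiff (n := 1)).continuous_deriv le_rfl
  have key : Tendsto (fun n => ∫ p in S.cell, modeFun m (fun z => S.cutoff n z * g z) p * u.1 2 p)
      atTop (𝓝 (∫ p in S.cell, modeFun m g p * u.1 2 p)) := by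
    refine S.tendsto_integral_modeFun m _ (C := C)
      (fun n => (S.contDiff_cutoff n).continuous.mul hgc) (fun n z hz => ?_) fun z hz => ?_
    · rw [abs_mul]
      exact (mul_le_of_le_one_left (abs_nonneg _) (S.abs_cutoff_le n z)).trans
        (hC z (Ioo_subset_Icc_self hz))
    · simpa using (S.tendsto_cutoff hz).mul_const (g z)
  have key' : Tendsto (fun n : ℕ => ∫ p in S.cell, modeFun m (fun z =>
      deriv Real.smoothTransition ((n + 1) * (S.L ^ 2 - z ^ 2) - 1) * ((n + 1) * (-(2 * z))) * g z
        + S.cutoff n z * deriv g z) p * u.1 0 p)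
      atTop (𝓝 (∫ p in S.cell, modeFun m (deriv g) p * u.1 0 p)) := by
    refine S.tendsto_integral_modeFun m _ (C := B * (4 * K) + K) (fun n => ?_) (fun n z hz => ?_)
      fun z hz => ?_
    · have := (S.contDiff_cutoff n).continuous
      fun_prop
    · refine (abs_add_le _ _).trans (add_le_add ?_ ?_)
      · set t := ((n : ℝ) + 1) * (S.L ^ 2 - z ^ 2) - 1 with ht
        rcases lt_or_ge 1 t with h | h
        · rw [(hB t).2 h]; simp; positivity
        · rw [mul_assoc, abs_mul]
          refine mul_le_mul (hB t).1 ?_ (abs_nonneg _) hB0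
          rw [abs_mul, abs_mul, abs_neg, abs_mul, abs_two, abs_of_pos (by positivity : (0 : ℝ) < n + 1)]
          have h1 := hdist z hz
          have hz' : |z| ≤ S.L := abs_le.2 ⟨hz.1.le, hz.2.le⟩
          have h2 : (n + 1 : ℝ) * (|g z| * S.L) ≤ K * 2 := by
            calc (n + 1 : ℝ) * (|g z| * S.L) ≤ (n + 1) * (K * (S.L ^ 2 - z ^ 2)) := by gcongr
              _ = K * (t + 1) := by rw [ht]; ring
              _ ≤ K * 2 := by gcongr; linarith
          calc (n + 1 : ℝ) * (2 * |z|) * |g z| ≤ (n + 1 : ℝ) * (2 * S.L) * |g z| := by gcongr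
            _ = 2 * ((n + 1 : ℝ) * (|g z| * S.L)) := by ring
            _ ≤ 4 * K := by linarith
      · rw [abs_mul]
        exact (mul_le_of_le_one_left (abs_nonneg _) (S.abs_cutoff_le n z)).trans
          (hK z (Ioo_subset_Icc_self hz))
    · have h1 : Tendsto (fun n : ℕ => deriv Real.smoothTransition ((n + 1) * (S.L ^ 2 - z ^ 2) - 1)
          * ((n + 1) * (-(2 * z))) * g z) atTop (𝓝 0) := by
        refine tendsto_const_nhds.congr' ?_
        filter_upwards [S.eventually_le_mul hz] with n hn
        rw [(hB _).2 (by linarith), zero_mul, zero_mul]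
      simpa using h1.add ((S.tendsto_cutoff hz).mul_const (deriv g z))
  refine tendsto_nhds_unique key (key'.neg.congr fun n => ?_)
  have hsm : ContDiff ℝ (⊤ : ℕ∞) (fun z => S.cutoff n z * g z) := (S.contDiff_cutoff n).mul hg
  have htest : S.IsTest (modeFun m fun z => S.cutoff n z * g z) := by
    refine S.isTest_modeFun m hsm ?_
    obtain ⟨δ, hδ, h⟩ := S.cutoff_eq_zero n
    exact ⟨δ, hδ, fun z hz => by rw [h z hz, zero_mul]⟩
  have h1 := (u.2 _ htest).2
  rw [← neg_eq_iff_eq_neg] at h1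
  simp only [mul_comm _ ((u.1 2 : S.L2) _)]
  rw [← h1]
  congr 1
  refine integral_congr_ae (.of_forall fun p => ?_)
  simp only
  rw [(hasFDerivAt_modeFun m (hderiv n p.2)).2, mul_comm, modeFun]

end PeriodicSlab

/-! ### Completeness of the system `e^{imx} cos(nπ(z + L)/2L)` -/

namespace PeriodicSlab

variable (S : PeriodicSlab)

/-- The affine map of `[-L, L]` onto `[0, π]`. -/
def angle (z : ℝ) : ℝ := Real.pi * (z + S.L) / (2 * S.L)

theorem contDiff_angle : ContDiff ℝ (⊤ : ℕ∞) S.angle := by unfold angle; fun_prop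

theorem hasDerivAt_angle (z : ℝ) : HasDerivAt S.angle (Real.pi / (2 * S.L)) z := by
  have : HasDerivAt S.angle (Real.pi * 1 / (2 * S.L)) z :=
    (((hasDerivAt_id z).add_const S.L).const_mul Real.pi).div_const (2 * S.L)
  rwa [mul_one] at this

theorem angle_mem {z : ℝ} (hz : z ∈ Ioo (-S.L) S.L) : S.angle z ∈ Ioo 0 Real.pi := by
  have hL := S.L_pos
  have hpi := Real.pi_pos
  rw [angle]
  constructor
  · have : 0 < z + S.L := by linarith [hz.1]
    positivity
  · rw [div_lt_iff₀ (by positivity)]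
    exact mul_lt_mul_of_pos_left (by linarith [hz.2]) hpi

theorem angle_L : S.angle S.L = Real.pi := by
  have hL := S.L_pos.ne'
  rw [angle]; field_simp; norm_num

theorem angle_neg_L : S.angle (-S.L) = 0 := by
  rw [angle]; simp

/-- The function `cos(nθ)` of the angle `θ = π(z + L)/2L`. -/
def cosFun (n : ℕ) : C(ℝ, ℝ) :=
  ⟨fun z => Real.cos (n * S.angle z), by have := S.contDiff_angle.continuous; fun_prop⟩

/-- The function `sin(nθ)` of the angle `θ = π(z + L)/2L`. -/
def sinFun (n : ℕ) : C(ℝ, ℝ) :=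
  ⟨fun z => Real.sin (n * S.angle z), by have := S.contDiff_angle.continuous; fun_prop⟩

theorem integral_cos_angle (j : ℤ) :
    ∫ z in Ioo (-S.L) S.L, Real.cos (j * S.angle z) = if j = 0 then 2 * S.L else 0 := by
  have hL := S.L_pos
  rw [← integral_Ioc_eq_integral_Ioo, ← intervalIntegral.integral_of_le (by linarith)]
  split_ifs with h
  · subst h
    simp
    ring
  · have hj : (j : ℝ) ≠ 0 := by exact_mod_cast h
    have hpi := Real.pi_pos.ne'
    have hd : ∀ z ∈ uIcc (-S.L) S.L, HasDerivAt (fun z => Real.sin (j * S.angle z) * (2 * S.L / (j * Real.pi)))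
        (Real.cos (j * S.angle z)) z := fun z _ => by
      have := (((S.hasDerivAt_angle z).const_mul (j : ℝ)).sin).mul_const (2 * S.L / (j * Real.pi))
      refine this.congr_deriv ?_
      field_simp
    rw [intervalIntegral.integral_eq_sub_of_hasDerivAt hd, angle_L, angle_neg_L]
    · simp [Real.sin_int_mul_pi]
    · have := S.contDiff_angle.continuous
      exact Continuous.intervalIntegrable (by fun_prop) _ _

theorem integrableOn_cos_angle (j : ℤ) :
    IntegrableOn (fun z => Real.cos (j * S.angle z)) (Ioo (-S.L) S.L) := by
  have := S.contDiff_angle.continuous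
  have h : Continuous (fun z => Real.cos (j * S.angle z)) := by fun_prop
  exact (h.integrableOn_Icc).mono_set Ioo_subset_Icc_self

theorem integral_cosFun_mul (n k : ℕ) :
    ∫ z in Ioo (-S.L) S.L, S.cosFun n z * S.cosFun k z
      = if n = k then (if n = 0 then 2 * S.L else S.L) else 0 := by
  have h1 : ∀ z, S.cosFun n z * S.cosFun k z = (Real.cos ((n - k : ℤ) * S.angle z)
      + Real.cos ((n + k : ℤ) * S.angle z)) / 2 := fun z => by
    simp only [cosFun, ContinuousMap.coe_mk]
    push_cast
    rw [sub_mul, add_mul, Real.cos_sub, Real.cos_add]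
    ring
  simp only [h1]
  rw [integral_div, integral_add (S.integrableOn_cos_angle _) (S.integrableOn_cos_angle _),
    integral_cos_angle, integral_cos_angle]
  split_ifs <;> first | omega | ring

theorem integral_sinFun_mul (n k : ℕ) :
    ∫ z in Ioo (-S.L) S.L, S.sinFun n z * S.sinFun k z
      = if n = k then (if n = 0 then 0 else S.L) else 0 := by
  have h1 : ∀ z, S.sinFun n z * S.sinFun k z = (Real.cos ((n - k : ℤ) * S.angle z)
      - Real.cos ((n + k : ℤ) * S.angle z)) / 2 := fun z => by
    simp only [sinFun, ContinuousMap.coe_mk]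
    push_cast
    rw [sub_mul, add_mul, Real.cos_sub, Real.cos_add]
    ring
  simp only [h1]
  rw [integral_div, integral_sub (S.integrableOn_cos_angle _) (S.integrableOn_cos_angle _),
    integral_cos_angle, integral_cos_angle]
  split_ifs <;> first | omega | ring

/-- The two maps `(x, z) ↦ (x, ±θ)` of the truncated period to the torus. -/
def toTorus (s : ℝ) (p : ℝ × ℝ) : UnitAddTorus (Fin 2) :=
  ![((p.1 / (2 * Real.pi) : ℝ) : UnitAddCircle),
    ((s * (S.angle p.2 / (2 * Real.pi)) : ℝ) : UnitAddCircle)]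

theorem continuous_toTorus (s : ℝ) : Continuous (S.toTorus s) := by
  have := S.contDiff_angle.continuous
  refine continuous_pi fun i => ?_
  fin_cases i
  · exact (AddCircle.continuous_mk' 1).comp (by fun_prop : Continuous fun p : ℝ × ℝ => p.1 / (2 * Real.pi))
  · exact (AddCircle.continuous_mk' 1).comp
      (by fun_prop : Continuous fun p : ℝ × ℝ => s * (S.angle p.2 / (2 * Real.pi)))

/-- A common left inverse of the maps `(x, z) ↦ (x, ±θ)`. -/
def ofTorus (t : UnitAddTorus (Fin 2)) : ℝ × ℝ :=
  (2 * Real.pi * (AddCircle.equivIoc (1 : ℝ) (-(1 / 2)) (t 0) : ℝ),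
    S.L * (4 * |(AddCircle.equivIoc (1 : ℝ) (-(1 / 2)) (t 1) : ℝ)| - 1))

theorem measurable_ofTorus : Measurable S.ofTorus := by
  have h : Measurable fun t : UnitAddCircle => (AddCircle.equivIoc (1 : ℝ) (-(1 / 2)) t : ℝ) :=
    measurable_subtype_coe.comp (AddCircle.measurableEquivIoc (1 : ℝ) (-(1 / 2))).measurable
  have h0 := h.comp (measurable_pi_apply (0 : Fin 2) : Measurable fun t : UnitAddTorus (Fin 2) => t 0)
  have h1 := h.comp (measurable_pi_apply (1 : Fin 2) : Measurable fun t : UnitAddTorus (Fin 2) => t 1)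
  exact (h0.const_mul _).prodMk ((((continuous_abs.measurable.comp h1).const_mul 4).sub_const 1).const_mul _)

theorem equivIoc_coe {y : ℝ} (hy : y ∈ Ioo (-(1 / 2) : ℝ) (1 / 2)) :
    (AddCircle.equivIoc (1 : ℝ) (-(1 / 2)) (y : UnitAddCircle) : ℝ) = y := by
  have h : y ∈ Ioc (-(1 / 2) : ℝ) (-(1 / 2) + 1) := ⟨hy.1, by linarith [hy.2]⟩
  exact congrArg Subtype.val ((AddCircle.equivIoc (1 : ℝ) (-(1 / 2))).apply_symm_apply ⟨y, h⟩)

theorem ofTorus_toTorus {s : ℝ} (hs : |s| = 1) {p : ℝ × ℝ} (hp : p ∈ S.cell) :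
    S.ofTorus (S.toTorus s p) = p := by
  have hpi := Real.pi_pos
  have hL := S.L_pos
  have hθ := S.angle_mem hp.2
  have h0 : p.1 / (2 * Real.pi) ∈ Ioo (-(1 / 2) : ℝ) (1 / 2) := by
    rw [mem_Ioo, lt_div_iff₀ (by positivity), div_lt_iff₀ (by positivity)]
    constructor <;> linarith [hp.1.1, hp.1.2]
  have habs : |s * (S.angle p.2 / (2 * Real.pi))| = S.angle p.2 / (2 * Real.pi) := by
    rw [abs_mul, hs, one_mul, abs_of_pos (div_pos hθ.1 (by positivity))]
  have h1 : s * (S.angle p.2 / (2 * Real.pi)) ∈ Ioo (-(1 / 2) : ℝ) (1 / 2) := by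
    rw [mem_Ioo, ← abs_lt, habs, div_lt_iff₀ (by positivity)]
    linarith [hθ.2]
  have e0 : S.toTorus s p 0 = ((p.1 / (2 * Real.pi) : ℝ) : UnitAddCircle) := rfl
  have e1 : S.toTorus s p 1 = ((s * (S.angle p.2 / (2 * Real.pi)) : ℝ) : UnitAddCircle) := rfl
  rw [ofTorus, e0, e1, equivIoc_coe h0, equivIoc_coe h1, habs, angle]
  refine Prod.ext ?_ ?_
  · simp only; field_simp
  · simp only; field_simp; ring

theorem mFourier_toTorus (k : Fin 2 → ℤ) (s : ℝ) (p : ℝ × ℝ) :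
    UnitAddTorus.mFourier k (S.toTorus s p)
      = Complex.exp (Complex.I * k 0 * p.1) * Complex.exp (Complex.I * (k 1 * s * S.angle p.2)) := by
  have hpi : (Real.pi : ℂ) ≠ 0 := by exact_mod_cast Real.pi_pos.ne'
  have e : UnitAddTorus.mFourier k (S.toTorus s p) = ∏ i : Fin 2, fourier (k i) (S.toTorus s p i) := rfl
  rw [e, Fin.prod_univ_two]
  have e0 : S.toTorus s p 0 = ((p.1 / (2 * Real.pi) : ℝ) : UnitAddCircle) := rfl
  have e1 : S.toTorus s p 1 = ((s * (S.angle p.2 / (2 * Real.pi)) : ℝ) : UnitAddCircle) := rfl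
  rw [e0, e1, fourier_coe_apply, fourier_coe_apply]
  congr 2
  · push_cast; field_simp
  · push_cast; field_simp

theorem mFourier_add_mFourier (k : Fin 2 → ℤ) (p : ℝ × ℝ) :
    UnitAddTorus.mFourier k (S.toTorus 1 p) + UnitAddTorus.mFourier k (S.toTorus (-1) p)
      = 2 * modeFun (k 0) (S.cosFun (k 1).natAbs) p := by
  rw [mFourier_toTorus, mFourier_toTorus, modeFun]
  have h : S.cosFun (k 1).natAbs p.2 = Real.cos (k 1 * S.angle p.2) := by
    simp only [cosFun, ContinuousMap.coe_mk]
    rcases Int.natAbs_eq (k 1) with h | h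
    · have h' := congrArg (Int.cast (R := ℝ)) h
      rw [h', Int.cast_natCast]
    · have h' := congrArg (Int.cast (R := ℝ)) h
      rw [h', Int.cast_neg, Int.cast_natCast, neg_mul, Real.cos_neg]
  rw [h, Complex.ofReal_cos, Complex.cos]
  push_cast
  rw [show Complex.I * (k 1 * 1 * S.angle p.2) = k 1 * S.angle p.2 * Complex.I by ring,
    show Complex.I * (k 1 * -1 * S.angle p.2) = -(k 1 * S.angle p.2) * Complex.I by ring]
  ring

theorem measure_torus_ext {P Q : Measure (UnitAddTorus (Fin 2))} [IsFiniteMeasure P]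
    [IsFiniteMeasure Q]
    (h : ∀ k, ∫ t, UnitAddTorus.mFourier k t ∂P = ∫ t, UnitAddTorus.mFourier k t ∂Q) : P = Q := by
  have hint : ∀ (M : Measure (UnitAddTorus (Fin 2))) [IsFiniteMeasure M]
      (g : C(UnitAddTorus (Fin 2), ℂ)), Integrable g M := fun M _ g =>
    g.continuous.integrable_of_hasCompactSupport (HasCompactSupport.of_compactSpace _)
  have hcont : ∀ (M : Measure (UnitAddTorus (Fin 2))) [IsFiniteMeasure M],
      Continuous fun g : C(UnitAddTorus (Fin 2), ℂ) => (∫ t, g t ∂M) := fun M _ => by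
    have h1 := continuous_integral.comp (ContinuousMap.toLp (E := ℂ) 1 M ℂ).continuous
    refine h1.congr fun g => ?_
    exact integral_congr_ae (ContinuousMap.coeFn_toLp M g)
  let V : Submodule ℂ C(UnitAddTorus (Fin 2), ℂ) :=
    { carrier := {g | ∫ t, g t ∂P = ∫ t, g t ∂Q}
      zero_mem' := by simp
      add_mem' := fun {f g} hf hg => by
        simp only [Set.mem_ofPred_eq, ContinuousMap.add_apply] at hf hg ⊢
        rw [integral_add (hint P f) (hint P g), integral_add (hint Q f) (hint Q g), hf, hg]
      smul_mem' := fun c f hf => by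
        simp only [Set.mem_ofPred_eq, ContinuousMap.smul_apply] at hf ⊢
        rw [integral_smul, integral_smul, hf] }
  have hV : IsClosed (V : Set C(UnitAddTorus (Fin 2), ℂ)) := isClosed_eq (hcont P) (hcont Q)
  have htop : (⊤ : Submodule ℂ C(UnitAddTorus (Fin 2), ℂ)) ≤ V := by
    rw [← UnitAddTorus.span_mFourier_closure_eq_top]
    refine Submodule.topologicalClosure_minimal _ (Submodule.span_le.2 ?_) hV
    rintro _ ⟨k, rfl⟩
    exact h k
  refine ext_of_forall_integral_eq_of_IsFiniteMeasure fun f => ?_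
  have := htop (Submodule.mem_top (x := (⟨fun t => (f t : ℂ), by fun_prop⟩ : C(UnitAddTorus (Fin 2), ℂ))))
  have h2 : ∫ t, (f t : ℂ) ∂P = ∫ t, (f t : ℂ) ∂Q := this
  rw [integral_complex_ofReal, integral_complex_ofReal] at h2
  exact_mod_cast h2

/-- A real function whose integrals against the modes `e^{imx} cos(nθ)` vanish is zero: the positive
and the negative part give measures with the same image on the torus. -/
theorem ae_eq_zero_of_integral_modeFun_real {f : ℝ × ℝ → ℝ} (hm : Measurable f)
    (hf : Integrable f (volume.restrict S.cell))
    (h : ∀ (m : ℤ) (n : ℕ), ∫ p in S.cell, modeFun m (S.cosFun n) p * f p = 0) :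
    f =ᵐ[volume.restrict S.cell] 0 := by
  set ν := (volume.restrict S.cell : Measure (ℝ × ℝ)) with hν
  let ρ : (ℝ × ℝ → ℝ) → Measure (ℝ × ℝ) := fun f => ν.withDensity fun p => ENNReal.ofReal (f p)
  let Q : (ℝ × ℝ → ℝ) → Measure (UnitAddTorus (Fin 2)) := fun f =>
    (ρ f).map (S.toTorus 1) + (ρ f).map (S.toTorus (-1))
  have hfin : ∀ g : ℝ × ℝ → ℝ, Integrable g ν → IsFiniteMeasure (ρ g) := fun g hg =>
    isFiniteMeasure_withDensity_ofReal hg.2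
  have h1 := hfin f hf
  have h2 := hfin _ hf.neg
  have hrho : ∀ (g : ℝ × ℝ → ℝ), Measurable g → ∀ ψ : ℝ × ℝ → ℂ,
      ∫ p, ψ p ∂(ρ g) = ∫ p in S.cell, ψ p * (max (g p) 0 : ℝ) := fun g hg ψ => by
    rw [integral_withDensity_eq_integral_toReal_smul hg.ennreal_ofReal (by simp)]
    refine integral_congr_ae (.of_forall fun p => ?_)
    simp only [ENNReal.toReal_ofReal', Complex.real_smul]
    ring
  have hQ : ∀ (g : ℝ × ℝ → ℝ), Measurable g → Integrable g ν → ∀ k,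
      ∫ t, UnitAddTorus.mFourier k t ∂(Q g)
        = ∫ p in S.cell, 2 * modeFun (k 0) (S.cosFun (k 1).natAbs) p * (max (g p) 0 : ℝ) := by
    intro g hg hgi k
    have := hfin g hgi
    have hint : ∀ (R : Measure (UnitAddTorus (Fin 2))) [IsFiniteMeasure R],
        Integrable (UnitAddTorus.mFourier k) R := fun R _ =>
      (UnitAddTorus.mFourier k).continuous.integrable_of_hasCompactSupport
        (HasCompactSupport.of_compactSpace _)
    have hasm : ∀ (R : Measure (UnitAddTorus (Fin 2))),
        AEStronglyMeasurable (UnitAddTorus.mFourier k) R := fun R =>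
      (UnitAddTorus.mFourier k).continuous.aestronglyMeasurable
    rw [integral_add_measure (hint _) (hint _),
      integral_map (S.continuous_toTorus 1).measurable.aemeasurable (hasm _),
      integral_map (S.continuous_toTorus (-1)).measurable.aemeasurable (hasm _), ← integral_add,
      hrho g hg]
    · simp only [mFourier_add_mFourier]
    · exact (integrable_map_measure (hasm _) (S.continuous_toTorus 1).measurable.aemeasurable).1
        (hint _)
    · exact (integrable_map_measure (hasm _) (S.continuous_toTorus (-1)).measurable.aemeasurable).1
        (hint _)
  have hQeq : Q f = Q (-f) := by
    refine measure_torus_ext fun k => ?_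
    rw [hQ f hm hf k, hQ _ hm.neg hf.neg k, ← sub_eq_zero]
    have hmod := continuous_modeFun (k 0) (S.cosFun (k 1).natAbs).continuous
    have hint : ∀ g : ℝ × ℝ → ℝ, Measurable g → Integrable g ν → Integrable (fun p =>
        2 * modeFun (k 0) (S.cosFun (k 1).natAbs) p * ((max (g p) 0 : ℝ) : ℂ)) ν := by
      intro g hg hgi
      refine (Integrable.ofReal (hgi.sup (integrable_zero _ _ _))).bdd_mul (c := 2)
        (by fun_prop) (.of_forall fun p => ?_)
      rw [norm_mul, norm_modeFun]
      simp only [Complex.norm_ofNat, cosFun, ContinuousMap.coe_mk]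
      linarith [Real.abs_cos_le_one ((k 1).natAbs * S.angle p.2)]
    rw [← integral_sub (hint f hm hf) (hint _ hm.neg hf.neg)]
    have h3 := h (k 0) (k 1).natAbs
    rw [← mul_eq_zero_iff_left (two_ne_zero (α := ℂ)), ← integral_const_mul] at h3
    refine Eq.trans (integral_congr_ae (.of_forall fun p => ?_)) h3
    simp only
    rw [← mul_sub, ← Complex.ofReal_sub]
    rw [show max (f p) 0 - max ((-f) p) 0 = f p from posPart_sub_negPart (f p)]
    ring
  have hback : ∀ g : ℝ × ℝ → ℝ, (Q g).map S.ofTorus = ρ g + ρ g := by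
    intro g
    have hae : ∀ s : ℝ, |s| = 1 → S.ofTorus ∘ S.toTorus s =ᵐ[ρ g] id := fun s hs => by
      refine (withDensity_absolutelyContinuous ν _).ae_le ?_
      filter_upwards [S.ae_mem_cell] with p hp
      exact S.ofTorus_toTorus hs hp
    rw [Measure.map_add _ _ S.measurable_ofTorus,
      Measure.map_map S.measurable_ofTorus (S.continuous_toTorus 1).measurable,
      Measure.map_map S.measurable_ofTorus (S.continuous_toTorus (-1)).measurable,
      Measure.map_congr (hae 1 (by simp)), Measure.map_congr (hae (-1) (by simp)), Measure.map_id]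
  have h3 := hback f
  rw [hQeq, hback] at h3
  simp only [ρ] at h3
  rw [← withDensity_add_left hm.neg.ennreal_ofReal, ← withDensity_add_left hm.ennreal_ofReal,
    withDensity_eq_iff (hm.neg.ennreal_ofReal.add hm.neg.ennreal_ofReal).aemeasurable
      (hm.ennreal_ofReal.add hm.ennreal_ofReal).aemeasurable] at h3
  · filter_upwards [h3] with p hp
    simp only [Pi.add_apply, Pi.neg_apply] at hp
    rcases le_total 0 (f p) with h0 | h0
    · rw [ENNReal.ofReal_of_nonpos (by linarith : -f p ≤ 0), add_zero, eq_comm, add_eq_zero,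
        ENNReal.ofReal_eq_zero] at hp
      exact le_antisymm hp.1 h0
    · rw [ENNReal.ofReal_of_nonpos h0, add_zero, add_eq_zero, ENNReal.ofReal_eq_zero] at hp
      exact le_antisymm h0 (neg_nonpos.1 hp.1)
  · have := h2.measure_univ_lt_top
    simp only [ρ] at this
    rw [withDensity_apply _ MeasurableSet.univ, Measure.restrict_univ] at this
    simp only [Pi.add_apply]
    rw [lintegral_add_left hm.neg.ennreal_ofReal]
    exact (ENNReal.add_lt_top.2 ⟨this, this⟩).ne

theorem eq_zero_of_integral_modeFun (f : S.L2)
    (h : ∀ (m : ℤ) (n : ℕ), ∫ p in S.cell, modeFun m (S.cosFun n) p * f p = 0) : f = 0 := by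
  have hint : ∀ (m : ℤ) (n : ℕ), Integrable (fun p => modeFun m (S.cosFun n) p * f p)
      (volume.restrict S.cell) := fun m n => by
    simp only [mul_comm (modeFun _ _ _)]
    exact S.integrable_L2_mul f (continuous_modeFun m (S.cosFun n).continuous)
  have hconj : ∀ (m : ℤ) (n : ℕ),
      ∫ p in S.cell, modeFun m (S.cosFun n) p * star ((f : ℝ × ℝ → ℂ) p) = 0 := by
    intro m n
    have h1 := congrArg star (h (-m) n)
    rw [star_zero, Complex.star_def, ← integral_conj] at h1
    refine Eq.trans (integral_congr_ae (.of_forall fun p => ?_)) h1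
    simp only
    rw [map_mul, ← Complex.star_def, star_modeFun, neg_neg]
  have hint' : ∀ (m : ℤ) (n : ℕ), Integrable (fun p => modeFun m (S.cosFun n) p
      * star ((f : ℝ × ℝ → ℂ) p)) (volume.restrict S.cell) := fun m n => by
    have h1 : Integrable (fun p => star (modeFun (-m) (S.cosFun n) p * f p))
      (volume.restrict S.cell) := (RCLike.conjCLE (K := ℂ)).toContinuousLinearMap.integrable_comp (hint (-m) n)
    refine h1.congr (.of_forall fun p => ?_)
    simp only [star_mul']
    rw [star_modeFun, neg_neg]
  have hsm := (Lp.stronglyMeasurable f).measurable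
  have hre := S.ae_eq_zero_of_integral_modeFun_real (Complex.measurable_re.comp hsm)
    ((S.integrable_L2 f).re) fun m n => by
      have h1 := congrArg₂ (· + ·) (h m n) (hconj m n)
      rw [← integral_add (hint m n) (hint' m n), add_zero] at h1
      rw [← mul_eq_zero_iff_left (two_ne_zero (α := ℂ)), ← integral_const_mul]
      refine Eq.trans (integral_congr_ae (.of_forall fun p => ?_)) h1
      simp only [Function.comp_apply]
      rw [← mul_add, Complex.star_def, Complex.add_conj]
      push_cast
      ring
  have him := S.ae_eq_zero_of_integral_modeFun_real (Complex.measurable_im.comp hsm)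
    ((S.integrable_L2 f).im) fun m n => by
      have h1 := congrArg₂ (· - ·) (h m n) (hconj m n)
      rw [← integral_sub (hint m n) (hint' m n), sub_zero] at h1
      rw [← mul_eq_zero_iff_left (mul_ne_zero (two_ne_zero (α := ℂ)) Complex.I_ne_zero),
        ← integral_const_mul]
      refine Eq.trans (integral_congr_ae (.of_forall fun p => ?_)) h1
      simp only [Function.comp_apply]
      rw [← mul_sub, Complex.star_def, Complex.sub_conj]
      push_cast
      ring
  refine Lp.ext ?_
  filter_upwards [hre, him, Lp.coeFn_zero ℂ 2 (volume.restrict S.cell)] with p h1 h2 h3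
  rw [h3]
  exact Complex.ext h1 h2

end PeriodicSlab

/-! ### The Hilbert space `H¹_per` and its compact embedding in `L²` -/

/-- Bessel's inequality for an orthogonal family, which may contain zero vectors (the term of a zero
vector is `0 / 0 = 0`). -/
theorem sum_norm_inner_sq_div_le {E ι : Type*} [NormedAddCommGroup E] [InnerProductSpace ℂ E]
    [DecidableEq ι] {v : ι → E} {c : ι → ℝ}
    (h : ∀ i j, inner ℂ (v i) (v j) = if i = j then (c i : ℂ) else 0) (f : E) (s : Finset ι) :
    ∑ i ∈ s, ‖inner ℂ (v i) f‖ ^ 2 / c i ≤ ‖f‖ ^ 2 := by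
  set w : E := ∑ i ∈ s, (inner ℂ (v i) f / c i) • v i with hw
  have h1 : inner ℂ w f = ((∑ i ∈ s, ‖inner ℂ (v i) f‖ ^ 2 / c i : ℝ) : ℂ) := by
    rw [hw, sum_inner]
    push_cast
    refine Finset.sum_congr rfl fun i _ => ?_
    rw [inner_smul_left, map_div₀, Complex.conj_ofReal, div_mul_eq_mul_div, Complex.conj_mul']
  have h2 : inner ℂ w w = ((∑ i ∈ s, ‖inner ℂ (v i) f‖ ^ 2 / c i : ℝ) : ℂ) := by
    rw [← h1, hw, sum_inner, sum_inner]
    refine Finset.sum_congr rfl fun i hi => ?_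
    rw [inner_smul_left, inner_smul_left, inner_sum]
    simp only [inner_smul_right, h]
    simp only [mul_ite, mul_zero, Finset.sum_ite_eq, hi, if_true]
    by_cases hc : c i = 0
    · simp [hc]
    · have hc' : (c i : ℂ) ≠ 0 := by exact_mod_cast hc
      rw [div_mul_cancel₀ _ hc']
  have h3 : ‖w‖ ^ 2 = ∑ i ∈ s, ‖inner ℂ (v i) f‖ ^ 2 / c i := by
    have := inner_self_eq_norm_sq (𝕜 := ℂ) w
    rw [h2] at this
    exact this.symm
  have h4 := sq_nonneg ‖f - w‖
  rw [@norm_sub_sq ℂ, ← inner_conj_symm, h1, h3, Complex.conj_ofReal] at h4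
  simp only [RCLike.re_to_complex, Complex.ofReal_re] at h4
  linarith

namespace PeriodicSlab

variable (S : PeriodicSlab)

theorem integral_L2_mul_eq_inner (f : S.L2) {ψ : ℝ × ℝ → ℂ} (hψ : Continuous ψ) :
    ∫ p in S.cell, f p * ψ p
      = inner ℂ ((S.memLp_cell (continuous_star.comp hψ)).toLp _ : S.L2) f := by
  rw [L2.inner_def]
  refine integral_congr_ae ?_
  filter_upwards [(S.memLp_cell (continuous_star.comp hψ)).coeFn_toLp] with p hp
  rw [hp, RCLike.inner_apply, Function.comp_apply, ← Complex.star_def, star_star]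

/-- The components `u`, `∂ₓ u`, `∂_z u` of an element of `H¹_per`. -/
def component (i : Fin 3) : S.H1per →L[ℂ] S.L2 :=
  (PiLp.proj 2 (fun _ : Fin 3 => S.L2) i).comp S.H1per.subtypeL

theorem component_apply (i : Fin 3) (u : S.H1per) : S.component i u = u.1 i := rfl

theorem norm_sq_eq (u : S.H1per) :
    ‖u‖ ^ 2 = ‖S.component 0 u‖ ^ 2 + ‖S.component 1 u‖ ^ 2 + ‖S.component 2 u‖ ^ 2 := by
  rw [show ‖u‖ = ‖u.1‖ from rfl, PiLp.norm_sq_eq_of_L2, Fin.sum_univ_three]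
  rfl

instance completeSpace_H1per : CompleteSpace S.H1per := by
  have hc : ∀ (i : Fin 3) {ψ : ℝ × ℝ → ℂ}, Continuous ψ →
      Continuous fun u : PiLp 2 (fun _ : Fin 3 => S.L2) => ∫ p in S.cell, u i p * ψ p := by
    intro i ψ hψ
    simp only [S.integral_L2_mul_eq_inner _ hψ]
    have h1 : Continuous fun u : PiLp 2 (fun _ : Fin 3 => S.L2) => u i :=
      (PiLp.proj 2 (fun _ : Fin 3 => S.L2) i (𝕜 := ℂ)).continuous
    exact continuous_const.inner h1
  have hcl : IsClosed (S.H1per : Set (PiLp 2 (fun _ : Fin 3 => S.L2))) := by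
    have : (S.H1per : Set (PiLp 2 (fun _ : Fin 3 => S.L2))) = ⋂ (φ : ℝ × ℝ → ℂ) (_ : S.IsTest φ),
        {u | (∫ p in S.cell, u 0 p * fderiv ℝ φ p (1, 0)) = -∫ p in S.cell, u 1 p * φ p} ∩
        {u | (∫ p in S.cell, u 0 p * fderiv ℝ φ p (0, 1)) = -∫ p in S.cell, u 2 p * φ p} := by
      ext u
      simp only [Set.mem_iInter]
      rfl
    rw [this]
    refine isClosed_iInter fun φ => isClosed_iInter fun hφ => IsClosed.inter ?_ ?_
    · exact isClosed_eq (hc 0 (hφ.continuous_fderiv _)) (hc 1 hφ.smooth.continuous).neg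
    · exact isClosed_eq (hc 0 (hφ.continuous_fderiv _)) (hc 2 hφ.smooth.continuous).neg
  exact hcl.completeSpace_coe

theorem contDiff_cosFun (n : ℕ) : ContDiff ℝ (⊤ : ℕ∞) (S.cosFun n) :=
  Real.contDiff_cos.comp (contDiff_const.mul S.contDiff_angle)

theorem contDiff_sinFun (n : ℕ) : ContDiff ℝ (⊤ : ℕ∞) (S.sinFun n) :=
  Real.contDiff_sin.comp (contDiff_const.mul S.contDiff_angle)

theorem deriv_sinFun (n : ℕ) :
    deriv (S.sinFun n) = fun z => (n * Real.pi / (2 * S.L)) * S.cosFun n z := by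
  funext z
  have h : HasDerivAt (S.sinFun n) _ z := ((S.hasDerivAt_angle z).const_mul (n : ℝ)).sin
  rw [h.deriv]
  simp only [cosFun, ContinuousMap.coe_mk]
  ring

/-- The weak derivatives are determined by the function. -/
theorem eq_zero_of_component_zero {u : S.H1per} (h : S.component 0 u = 0) : u = 0 := by
  have h0 : ∀ ψ : ℝ × ℝ → ℂ, ∫ p in S.cell, ψ p * u.1 0 p = 0 := fun ψ => by
    rw [integral_congr_ae (g := fun _ => (0 : ℂ)) ?_, integral_zero]
    rw [component_apply] at h
    rw [h]
    filter_upwards [Lp.coeFn_zero ℂ 2 (volume.restrict S.cell)] with p hp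
    rw [hp, Pi.zero_apply, mul_zero]
  have h1 : S.component 1 u = 0 := S.eq_zero_of_integral_modeFun _ fun m n => by
    rw [component_apply, S.integral_modeFun_dx u m (S.contDiff_cosFun n), h0, mul_zero]
  have h2 : S.component 2 u = 0 := S.eq_zero_of_integral_modeFun _ fun m n => by
    have hc := (S.cosFun n).continuous
    refine tendsto_nhds_unique (S.tendsto_integral_modeFun m (S.component 2 u) (C := 1)
      (h := fun k z => S.cutoff k z * S.cosFun n z)
      (fun k => (S.contDiff_cutoff k).continuous.mul hc) (fun k z _ => ?_) fun z hz => ?_)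
      (tendsto_const_nhds.congr fun k => ?_)
    · rw [abs_mul]
      exact mul_le_one₀ (S.abs_cutoff_le k z) (abs_nonneg _) (Real.abs_cos_le_one _)
    · simpa using (S.tendsto_cutoff hz).mul_const (S.cosFun n z)
    · obtain ⟨δ, hδ, hz⟩ := S.cutoff_eq_zero k
      have hL := S.L_pos
      rw [component_apply, S.integral_modeFun_dz u m ((S.contDiff_cutoff k).mul (S.contDiff_cosFun n)),
        h0, neg_zero]
      · rw [hz S.L (by rw [abs_of_pos hL]; linarith), zero_mul]
      · rw [hz (-S.L) (by rw [abs_neg, abs_of_pos hL]; linarith), zero_mul]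
  have h3 := S.norm_sq_eq u
  rw [h, h1, h2] at h3
  simpa using h3

/-- The squared norm of the mode `e^{imx} cos(nθ)`. -/
def cosNormSq (i : ℤ × ℕ) : ℝ := 2 * Real.pi * if i.2 = 0 then 2 * S.L else S.L

theorem cosNormSq_pos (i : ℤ × ℕ) : 0 < S.cosNormSq i := by
  have hL := S.L_pos
  have hpi := Real.pi_pos
  rw [cosNormSq]
  split_ifs <;> positivity

theorem inner_cosMode (i j : ℤ × ℕ) :
    inner ℂ (S.mode i.1 (S.cosFun i.2)) (S.mode j.1 (S.cosFun j.2))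
      = if i = j then (S.cosNormSq i : ℂ) else 0 := by
  rw [inner_mode_mode, integral_cosFun_mul, cosNormSq]
  by_cases h1 : i.1 = j.1 <;> by_cases h2 : i.2 = j.2
  · rw [if_pos h1, if_pos h2, if_pos (Prod.ext h1 h2)]
  · rw [if_pos h1, if_neg h2, if_neg (fun h => h2 (congrArg Prod.snd h))]; simp
  · rw [if_neg h1, if_neg (fun h => h1 (congrArg Prod.fst h))]
  · rw [if_neg h1, if_neg (fun h => h1 (congrArg Prod.fst h))]

/-- The squared norm of the mode `e^{imx} sin(nθ)`. -/
def sinNormSq (i : ℤ × ℕ) : ℝ := 2 * Real.pi * if i.2 = 0 then 0 else S.L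

theorem sinNormSq_nonneg (i : ℤ × ℕ) : 0 ≤ S.sinNormSq i := by
  have hL := S.L_pos
  have hpi := Real.pi_pos
  rw [sinNormSq]
  split_ifs <;> positivity

theorem inner_sinMode (i j : ℤ × ℕ) :
    inner ℂ (S.mode i.1 (S.sinFun i.2)) (S.mode j.1 (S.sinFun j.2))
      = if i = j then (S.sinNormSq i : ℂ) else 0 := by
  rw [inner_mode_mode, integral_sinFun_mul, sinNormSq]
  by_cases h1 : i.1 = j.1 <;> by_cases h2 : i.2 = j.2
  · rw [if_pos h1, if_pos h2, if_pos (Prod.ext h1 h2)]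
  · rw [if_pos h1, if_neg h2, if_neg (fun h => h2 (congrArg Prod.snd h))]; simp
  · rw [if_neg h1, if_neg (fun h => h1 (congrArg Prod.fst h))]
  · rw [if_neg h1, if_neg (fun h => h1 (congrArg Prod.fst h))]

/-- The normalised mode `e^{imx} cos(nθ)`. -/
def cosMode (i : ℤ × ℕ) : S.L2 :=
  (((√(S.cosNormSq i))⁻¹ : ℝ) : ℂ) • S.mode i.1 (S.cosFun i.2)

theorem norm_inner_cosMode_sq (i : ℤ × ℕ) (f : S.L2) :
    ‖inner ℂ (S.cosMode i) f‖ ^ 2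
      = ‖inner ℂ (S.mode i.1 (S.cosFun i.2)) f‖ ^ 2 / S.cosNormSq i := by
  rw [cosMode, inner_smul_left, Complex.conj_ofReal, norm_mul, Complex.norm_real, mul_pow,
    Real.norm_eq_abs, sq_abs, inv_pow, Real.sq_sqrt (S.cosNormSq_pos i).le, div_eq_inv_mul]

theorem orthonormal_cosMode : Orthonormal ℂ S.cosMode := by
  rw [orthonormal_iff_ite]
  intro i j
  rw [cosMode, cosMode, inner_smul_left, inner_smul_right, inner_cosMode, Complex.conj_ofReal]
  split_ifs with hij
  · subst hij
    rw [← Complex.ofReal_mul, ← Complex.ofReal_mul, ← mul_assoc, ← mul_inv,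
      Real.mul_self_sqrt (S.cosNormSq_pos i).le, inv_mul_cancel₀ (S.cosNormSq_pos i).ne',
      Complex.ofReal_one]
  · rw [mul_zero, mul_zero]

/-- The modes `e^{imx} cos(nθ)` form a Hilbert basis of `L²`. -/
def cosBasis : HilbertBasis (ℤ × ℕ) ℂ S.L2 :=
  HilbertBasis.mkOfOrthogonalEqBot S.orthonormal_cosMode (by
    rw [Submodule.eq_bot_iff]
    intro f hf
    refine S.eq_zero_of_integral_modeFun f fun m n => ?_
    have h1 := (Submodule.mem_orthogonal _ _).1 hf (S.cosMode (-m, n))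
      (Submodule.subset_span ⟨_, rfl⟩)
    rw [cosMode, inner_smul_left, Complex.conj_ofReal, mul_eq_zero, inner_mode] at h1
    rcases h1 with h1 | h1
    · exact absurd h1 (by
        exact_mod_cast inv_ne_zero (Real.sqrt_ne_zero'.2 (S.cosNormSq_pos (-m, n))))
    · simpa using h1)

theorem hasSum_norm_inner_cosMode_sq (f : S.L2) :
    HasSum (fun i => ‖inner ℂ (S.cosMode i) f‖ ^ 2) (‖f‖ ^ 2) := by
  have h := S.cosBasis.hasSum_inner_mul_inner f f
  have h2 := Complex.reCLM.hasSum h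
  have e : Complex.reCLM (inner ℂ f f) = ‖f‖ ^ 2 := inner_self_eq_norm_sq (𝕜 := ℂ) f
  have e' : ∀ i, S.cosBasis i = S.cosMode i := fun i => by
    rw [cosBasis, HilbertBasis.coe_mkOfOrthogonalEqBot]
  rw [e] at h2
  refine h2.congr_fun fun i => ?_
  rw [e', ← inner_conj_symm f, Complex.conj_mul', ← Complex.ofReal_pow]
  exact (Complex.ofReal_re _).symm

/-- The Fourier coefficients of `u` are bounded by those of its derivatives, divided by the
frequency. -/
theorem norm_inner_cosMode_sq_le (u : S.H1per) {N : ℕ} (hN : 0 < N) {i : ℤ × ℕ}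
    (hi : i ∉ Finset.Icc (-(N : ℤ)) N ×ˢ Finset.range (N + 1)) :
    ‖inner ℂ (S.cosMode i) (S.component 0 u)‖ ^ 2 ≤ (1 / (N : ℝ) ^ 2) *
      (‖inner ℂ (S.mode i.1 (S.cosFun i.2)) (S.component 1 u)‖ ^ 2 / S.cosNormSq i
      + (2 * S.L / Real.pi) ^ 2 * (‖inner ℂ (S.mode i.1 (S.sinFun i.2)) (S.component 2 u)‖ ^ 2
        / S.sinNormSq i)) := by
  have hL := S.L_pos
  have hpi := Real.pi_pos
  have hN' : (0 : ℝ) < N := by exact_mod_cast hN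
  have hc := S.cosNormSq_pos i
  set A := ‖inner ℂ (S.mode i.1 (S.cosFun i.2)) (S.component 0 u)‖ with hA
  rw [norm_inner_cosMode_sq, one_div, inv_mul_eq_div, le_div_iff₀ (by positivity)]
  rw [Finset.mem_product, Finset.mem_Icc, Finset.mem_range, not_and_or] at hi
  rcases hi with hi | hi
  · -- here the frequency in `x` is large
    have hm : (N : ℝ) ≤ |(i.1 : ℝ)| := by
      rw [not_and_or, not_le, not_le] at hi
      have h1 : (N : ℤ) ≤ |i.1| := by
        rcases hi with hi | hi
        · exact le_trans (by linarith) (neg_le_abs i.1)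
        · exact hi.le.trans (le_abs_self _)
      exact_mod_cast h1
    have h1 : ‖inner ℂ (S.mode i.1 (S.cosFun i.2)) (S.component 1 u)‖ = |(i.1 : ℝ)| * A := by
      rw [inner_mode, component_apply, S.integral_modeFun_dx u _ (S.contDiff_cosFun _), hA,
        inner_mode, norm_mul, component_apply]
      congr 1
      simp
    have h2 : A ^ 2 / S.cosNormSq i * N ^ 2 ≤ (|(i.1 : ℝ)| * A) ^ 2 / S.cosNormSq i := by
      rw [mul_pow, div_mul_eq_mul_div, mul_comm (A ^ 2)]
      gcongr
    rw [← h1] at h2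
    have hs := S.sinNormSq_nonneg i
    exact h2.trans (le_add_of_nonneg_right (by positivity))
  · -- here the frequency in `z` is large
    have hn : N < i.2 := by omega
    have hnr : (N : ℝ) ≤ i.2 := by exact_mod_cast hn.le
    have h1 : ‖inner ℂ (S.mode i.1 (S.sinFun i.2)) (S.component 2 u)‖
        = (i.2 * Real.pi / (2 * S.L)) * A := by
      have e : ∫ p in S.cell, modeFun (-i.1) (deriv (S.sinFun i.2)) p * u.1 0 p
          = ((i.2 * Real.pi / (2 * S.L) : ℝ) : ℂ)
            * ∫ p in S.cell, modeFun (-i.1) (S.cosFun i.2) p * u.1 0 p := by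
        rw [deriv_sinFun, ← integral_const_mul]
        refine integral_congr_ae (.of_forall fun p => ?_)
        simp only [modeFun]
        push_cast
        ring
      rw [inner_mode, component_apply, S.integral_modeFun_dz u _ (S.contDiff_sinFun _), norm_neg, e,
        norm_mul, Complex.norm_real, Real.norm_of_nonneg (by positivity), hA, inner_mode,
        component_apply]
      · simp only [sinFun, ContinuousMap.coe_mk]
        rw [angle_L, Real.sin_nat_mul_pi]
      · simp only [sinFun, ContinuousMap.coe_mk]
        rw [angle_neg_L, mul_zero, Real.sin_zero]
    have hs0 : S.sinNormSq i = 2 * Real.pi * S.L := by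
      rw [sinNormSq, if_neg (by omega)]
    have h0 : S.cosNormSq i = 2 * Real.pi * S.L := by
      rw [cosNormSq, if_neg (by omega)]
    have h2 : A ^ 2 / S.cosNormSq i * N ^ 2 ≤ (2 * S.L / Real.pi) ^ 2 *
        (((i.2 * Real.pi / (2 * S.L)) * A) ^ 2 / (2 * Real.pi * S.L)) := by
      rw [h0]
      have e : (2 * S.L / Real.pi) ^ 2 * (((i.2 * Real.pi / (2 * S.L)) * A) ^ 2 / (2 * Real.pi * S.L))
        = A ^ 2 / (2 * Real.pi * S.L) * i.2 ^ 2 := by field_simp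
      rw [e]
      gcongr
    rw [← h1] at h2
    rw [hs0]
    exact h2.trans (le_add_of_nonneg_left (by positivity))

/-- The projection of `L²` on finitely many modes. -/
def cosProj (s : Finset (ℤ × ℕ)) : S.L2 →L[ℂ] S.L2 :=
  ∑ i ∈ s, (innerSL ℂ (S.cosMode i)).smulRight (S.cosMode i)

theorem cosProj_apply (s : Finset (ℤ × ℕ)) (f : S.L2) :
    S.cosProj s f = ∑ i ∈ s, inner ℂ (S.cosMode i) f • S.cosMode i := by
  rw [cosProj, _root_.sum_apply]
  rfl

theorem norm_sub_cosProj_sq (s : Finset (ℤ × ℕ)) (f : S.L2) :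
    ‖f - S.cosProj s f‖ ^ 2 = ‖f‖ ^ 2 - ∑ i ∈ s, ‖inner ℂ (S.cosMode i) f‖ ^ 2 := by
  have ho := S.orthonormal_cosMode
  have h1 : inner ℂ (S.cosProj s f) f = ((∑ i ∈ s, ‖inner ℂ (S.cosMode i) f‖ ^ 2 : ℝ) : ℂ) := by
    rw [cosProj_apply, sum_inner]
    push_cast
    refine Finset.sum_congr rfl fun i _ => ?_
    rw [inner_smul_left, Complex.conj_mul']
  have h2 : inner ℂ (S.cosProj s f) (S.cosProj s f)
      = ((∑ i ∈ s, ‖inner ℂ (S.cosMode i) f‖ ^ 2 : ℝ) : ℂ) := by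
    rw [cosProj_apply, ho.inner_sum]
    push_cast
    refine Finset.sum_congr rfl fun i _ => ?_
    rw [Complex.conj_mul']
  rw [@norm_sub_sq ℂ, ← inner_conj_symm, h1]
  have h3 : ‖S.cosProj s f‖ ^ 2 = ∑ i ∈ s, ‖inner ℂ (S.cosMode i) f‖ ^ 2 := by
    have := inner_self_eq_norm_sq (𝕜 := ℂ) (S.cosProj s f)
    rw [h2] at this
    exact this.symm
  rw [h3, Complex.conj_ofReal]
  simp only [RCLike.re_to_complex, Complex.ofReal_re]
  ring

/-- Rellich's theorem: `H¹_per` is compactly embedded in `L²`. -/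
theorem isCompactOperator_component_zero : IsCompactOperator (S.component 0) := by
  set K : ℝ := 1 + (2 * S.L / Real.pi) ^ 2 with hK
  have hK0 : 0 ≤ K := by positivity
  let s : ℕ → Finset (ℤ × ℕ) := fun N => Finset.Icc (-(N : ℤ)) N ×ˢ Finset.range (N + 1)
  have hcomp : ∀ t : Finset (ℤ × ℕ), IsCompactOperator (S.cosProj t) := fun t => by
    classical
    induction t using Finset.induction_on with
    | empty => simpa [cosProj] using isCompactOperator_zero
    | insert i t hi ih =>
      have e : S.cosProj (insert i t)
          = (innerSL ℂ (S.cosMode i)).smulRight (S.cosMode i) + S.cosProj t := by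
        rw [cosProj, Finset.sum_insert hi]; rfl
      rw [e]
      refine IsCompactOperator.add ?_ ih
      have h1 : IsCompactOperator ((ContinuousLinearMap.id ℂ ℂ).smulRight (S.cosMode i) : ℂ →L[ℂ] S.L2) :=
        isCompactOperator_of_locallyCompactSpace_rng _
      exact h1.comp_clm (innerSL ℂ (S.cosMode i))
  refine isCompactOperator_of_tendsto (l := atTop)
    (F := fun N : ℕ => (S.cosProj (s N)).comp (S.component 0)) ?_
    (.of_forall fun N => (hcomp _).comp_clm _)
  refine (tendsto_iff_norm_sub_tendsto_zero (E := S.H1per →L[ℂ] S.L2)).2 ?_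
  have hbound : ∀ᶠ N : ℕ in atTop,
      ‖(S.cosProj (s N)).comp (S.component 0) - S.component 0‖ ≤ √K * (1 / (N : ℝ)) := by
    filter_upwards [eventually_gt_atTop 0] with N hN
    refine ContinuousLinearMap.opNorm_le_bound _ (by positivity) fun u => ?_
    rw [_root_.sub_apply, ContinuousLinearMap.comp_apply, norm_sub_rev]
    refine abs_le_of_sq_le_sq' ?_ (by positivity) |>.2
    rw [norm_sub_cosProj_sq, mul_pow, mul_pow, Real.sq_sqrt hK0, sub_le_iff_le_add]
    refine hasSum_le_of_sum_le (S.hasSum_norm_inner_cosMode_sq _) fun t => ?_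
    have hsplit : ∑ i ∈ t, ‖inner ℂ (S.cosMode i) (S.component 0 u)‖ ^ 2
        ≤ ∑ i ∈ t \ s N, ‖inner ℂ (S.cosMode i) (S.component 0 u)‖ ^ 2
          + ∑ i ∈ s N, ‖inner ℂ (S.cosMode i) (S.component 0 u)‖ ^ 2 := by
      rw [← Finset.sum_union Finset.sdiff_disjoint, Finset.sdiff_union_self_eq_union]
      exact Finset.sum_le_sum_of_subset_of_nonneg Finset.subset_union_left
        fun i _ _ => by positivity
    refine hsplit.trans (add_le_add_left ?_ _)
    have h1 := sum_norm_inner_sq_div_le (v := fun i : ℤ × ℕ => S.mode i.1 (S.cosFun i.2))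
      S.inner_cosMode (S.component 1 u) (t \ s N)
    have h2 := sum_norm_inner_sq_div_le (v := fun i : ℤ × ℕ => S.mode i.1 (S.sinFun i.2))
      S.inner_sinMode (S.component 2 u) (t \ s N)
    have h3 := S.norm_sq_eq u
    calc ∑ i ∈ t \ s N, ‖inner ℂ (S.cosMode i) (S.component 0 u)‖ ^ 2
        ≤ ∑ i ∈ t \ s N, (1 / (N : ℝ) ^ 2) *
          (‖inner ℂ (S.mode i.1 (S.cosFun i.2)) (S.component 1 u)‖ ^ 2 / S.cosNormSq i
          + (2 * S.L / Real.pi) ^ 2 * (‖inner ℂ (S.mode i.1 (S.sinFun i.2)) (S.component 2 u)‖ ^ 2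
            / S.sinNormSq i)) :=
          Finset.sum_le_sum fun i hi => S.norm_inner_cosMode_sq_le u hN (Finset.mem_sdiff.1 hi).2
      _ ≤ (1 / (N : ℝ) ^ 2) * (‖S.component 1 u‖ ^ 2
          + (2 * S.L / Real.pi) ^ 2 * ‖S.component 2 u‖ ^ 2) := by
          rw [← Finset.mul_sum, Finset.sum_add_distrib, ← Finset.mul_sum]
          gcongr
      _ ≤ (1 / (N : ℝ) ^ 2) * (K * ‖u‖ ^ 2) := by
          gcongr
          rw [h3, hK]
          nlinarith [sq_nonneg ‖S.component 0 u‖, sq_nonneg ‖S.component 1 u‖,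
            sq_nonneg ‖S.component 2 u‖, sq_nonneg (2 * S.L / Real.pi),
            mul_nonneg (sq_nonneg (2 * S.L / Real.pi)) (sq_nonneg ‖S.component 0 u‖),
            mul_nonneg (sq_nonneg (2 * S.L / Real.pi)) (sq_nonneg ‖S.component 1 u‖)]
      _ = K * (1 / (N : ℝ)) ^ 2 * ‖u‖ ^ 2 := by ring
  refine squeeze_zero' (.of_forall fun N => norm_nonneg
    ((S.cosProj (s N)).comp (S.component 0) - S.component 0)) hbound ?_
  simpa using tendsto_one_div_atTop_nhds_zero_nat.const_mul (√K)

end PeriodicSlab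

/-! ### Traces on the sides of the truncated period -/

namespace PeriodicSlab

variable (S : PeriodicSlab)

/-- The function `((z + L) / 2L)^k`, which is `1` for `z = L` and, if `k > 0`, is `0` for `z = -L`. -/
def ramp (k : ℕ) : C(ℝ, ℝ) := ⟨fun z => ((z + S.L) / (2 * S.L)) ^ k, by fun_prop⟩

theorem hasDerivAt_ramp (k : ℕ) (z : ℝ) :
    HasDerivAt (S.ramp k) (k / (2 * S.L) * S.ramp (k - 1) z) z := by
  have h : HasDerivAt (fun z : ℝ => (z + S.L) / (2 * S.L)) (1 / (2 * S.L)) z :=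
    ((hasDerivAt_id z).add_const S.L).div_const _
  refine (h.pow k).congr_deriv ?_
  simp only [ramp, ContinuousMap.coe_mk]
  ring

theorem contDiff_ramp (k : ℕ) : ContDiff ℝ (⊤ : ℕ∞) (S.ramp k) := by
  have : ContDiff ℝ (⊤ : ℕ∞) (fun z : ℝ => ((z + S.L) / (2 * S.L)) ^ k) := by fun_prop
  exact this

theorem ramp_L (k : ℕ) : S.ramp k S.L = 1 := by
  have hL := S.L_pos.ne'
  simp only [ramp, ContinuousMap.coe_mk]
  rw [← two_mul, div_self (by positivity), one_pow]

theorem ramp_neg_L (k : ℕ) : S.ramp (k + 1) (-S.L) = 0 := by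
  simp [ramp]

theorem integral_ramp (k : ℕ) : ∫ z in Ioo (-S.L) S.L, S.ramp k z = 2 * S.L / (k + 1) := by
  have hL := S.L_pos
  rw [← integral_Ioc_eq_integral_Ioo, ← intervalIntegral.integral_of_le (by linarith)]
  have hd : ∀ z ∈ uIcc (-S.L) S.L, HasDerivAt (fun z => S.ramp (k + 1) z * (2 * S.L / (k + 1)))
      (S.ramp k z) z := fun z _ => by
    refine ((S.hasDerivAt_ramp (k + 1) z).mul_const (2 * S.L / (k + 1))).congr_deriv ?_
    have : (k : ℝ) + 1 ≠ 0 := by positivity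
    rw [Nat.add_sub_cancel]
    push_cast
    field_simp
  rw [intervalIntegral.integral_eq_sub_of_hasDerivAt hd
    ((S.ramp k).continuous.intervalIntegrable _ _), ramp_L, ramp_neg_L]
  ring

theorem inner_rampMode (d : ℤ → ℕ) (m n : ℤ) :
    inner ℂ (S.mode m (S.ramp (d m))) (S.mode n (S.ramp (d n)))
      = if m = n then ((4 * Real.pi * S.L / (2 * d m + 1) : ℝ) : ℂ) else 0 := by
  rw [inner_mode_mode]
  by_cases h : m = n
  · subst h
    rw [if_pos rfl, if_pos rfl]
    have e : ∀ z, S.ramp (d m) z * S.ramp (d m) z = S.ramp (2 * d m) z := fun z => by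
      simp only [ramp, ContinuousMap.coe_mk]; ring
    simp only [e]
    rw [integral_ramp]
    push_cast
    ring
  · rw [if_neg h, if_neg h]

theorem integrable_modeFun_mul (m : ℤ) {g : ℝ → ℝ} (hg : Continuous g) (f : S.L2) :
    Integrable (fun p => modeFun m g p * f p) (volume.restrict S.cell) := by
  simp only [mul_comm (modeFun _ _ _)]
  exact S.integrable_L2_mul f (continuous_modeFun m hg)

/-- The trace can be computed with any power of the ramp, by integration by parts. -/
theorem traceRight_eq (u : S.H1per) (m : ℤ) (k : ℕ) :
    S.traceRight u m = 1 / (2 * Real.pi) * (inner ℂ (S.mode m (S.ramp (k + 1))) (S.component 2 u)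
      + ((k + 1 : ℕ) / (2 * S.L) : ℝ) * inner ℂ (S.mode m (S.ramp k)) (S.component 0 u)) := by
  have hr : ∀ k, Continuous (S.ramp k) := fun k => (S.ramp k).continuous
  have hi := fun (k : ℕ) (f : S.L2) => S.integrable_modeFun_mul (-m) (hr k) f
  have h0 : S.traceRight u m = 1 / (2 * Real.pi) *
      ((∫ p in S.cell, modeFun (-m) (S.ramp 1) p * u.1 2 p)
        + (1 / (2 * S.L) : ℝ) * ∫ p in S.cell, modeFun (-m) (S.ramp 0) p * u.1 0 p) := by
    rw [traceRight, ← integral_const_mul ((1 / (2 * S.L) : ℝ) : ℂ)]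
    rw [← integral_add (hi _ _) ((hi _ _).const_mul _)]
    congr 1
    refine integral_congr_ae (.of_forall fun p => ?_)
    simp only [modeFun, ramp, ContinuousMap.coe_mk, pow_one, pow_zero]
    push_cast
    rw [show -Complex.I * m * p.1 = Complex.I * -m * p.1 by ring]
    ring
  have h1 := S.integral_modeFun_dz u (-m) (g := fun z => S.ramp (k + 1) z - S.ramp 1 z)
    ((S.contDiff_ramp _).sub (S.contDiff_ramp _))
    (by rw [ramp_L, ramp_L, sub_self]) (by rw [ramp_neg_L, S.ramp_neg_L 0, sub_self])
  have h2 : deriv (fun z => S.ramp (k + 1) z - S.ramp 1 z)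
      = fun z => (k + 1 : ℕ) / (2 * S.L) * S.ramp k z - 1 / (2 * S.L) * S.ramp 0 z := by
    funext z
    have h : HasDerivAt (fun z => S.ramp (k + 1) z - S.ramp 1 z) _ z :=
      (S.hasDerivAt_ramp (k + 1) z).sub (S.hasDerivAt_ramp 1 z)
    rw [h.deriv]
    simp
  have h3 : ∫ p in S.cell, modeFun (-m) (fun z => S.ramp (k + 1) z - S.ramp 1 z) p * u.1 2 p
      = (∫ p in S.cell, modeFun (-m) (S.ramp (k + 1)) p * u.1 2 p)
        - ∫ p in S.cell, modeFun (-m) (S.ramp 1) p * u.1 2 p := by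
    rw [← integral_sub (hi _ _) (hi _ _)]
    refine integral_congr_ae (.of_forall fun p => ?_)
    simp only [modeFun]
    push_cast
    ring
  have h4 : ∫ p in S.cell, modeFun (-m) (fun z => (k + 1 : ℕ) / (2 * S.L) * S.ramp k z
        - 1 / (2 * S.L) * S.ramp 0 z) p * u.1 0 p
      = ((k + 1 : ℕ) / (2 * S.L) : ℝ) * (∫ p in S.cell, modeFun (-m) (S.ramp k) p * u.1 0 p)
        - (1 / (2 * S.L) : ℝ) * ∫ p in S.cell, modeFun (-m) (S.ramp 0) p * u.1 0 p := by
    rw [← integral_const_mul, ← integral_const_mul,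
      ← integral_sub ((hi _ _).const_mul _) ((hi _ _).const_mul _)]
    refine integral_congr_ae (.of_forall fun p => ?_)
    simp only [modeFun]
    push_cast
    ring
  rw [h2, h3, h4] at h1
  rw [h0, inner_mode, inner_mode, component_apply, component_apply]
  congr 1
  linear_combination -h1

theorem traceRight_add (u v : S.H1per) (m : ℤ) :
    S.traceRight (u + v) m = S.traceRight u m + S.traceRight v m := by
  simp only [S.traceRight_eq _ m 0, map_add, inner_add_right]
  ring

theorem traceRight_smul (c : ℂ) (u : S.H1per) (m : ℤ) :
    S.traceRight (c • u) m = c * S.traceRight u m := by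
  simp only [S.traceRight_eq _ m 0, map_smul, inner_smul_right]
  ring

/-- The traces lie in `H^{1/2}`. In the `m`-th Fourier coefficient the trace is computed with the
power `|m| + 1` of the ramp, and the sum is bounded by Bessel's inequality. -/
theorem sum_norm_traceRight_sq_le (u : S.H1per) (s : Finset ℤ) :
    ∑ m ∈ s, (1 + |(m : ℝ)|) * ‖S.traceRight u m‖ ^ 2
      ≤ 2 * S.L / Real.pi * (1 + 1 / (2 * S.L ^ 2)) * ‖u‖ ^ 2 := by
  have hL := S.L_pos
  have hpi := Real.pi_pos
  have b2 := sum_norm_inner_sq_div_le (S.inner_rampMode fun m => m.natAbs + 1) (S.component 2 u) s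
  have b0 := sum_norm_inner_sq_div_le (S.inner_rampMode fun m => m.natAbs) (S.component 0 u) s
  have b1 := sum_norm_inner_sq_div_le (S.inner_rampMode fun m => m.natAbs) (S.component 1 u) s
  have key : ∀ m : ℤ, (1 + |(m : ℝ)|) * ‖S.traceRight u m‖ ^ 2 ≤ 2 * S.L / Real.pi *
      (‖inner ℂ (S.mode m (S.ramp (m.natAbs + 1))) (S.component 2 u)‖ ^ 2
        / (4 * Real.pi * S.L / (2 * (m.natAbs + 1 : ℕ) + 1))
      + 1 / (2 * S.L ^ 2) * (‖inner ℂ (S.mode m (S.ramp m.natAbs)) (S.component 0 u)‖ ^ 2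
        / (4 * Real.pi * S.L / (2 * m.natAbs + 1))
      + ‖inner ℂ (S.mode m (S.ramp m.natAbs)) (S.component 1 u)‖ ^ 2
        / (4 * Real.pi * S.L / (2 * m.natAbs + 1)))) := by
    intro m
    have hm : |(m : ℝ)| = m.natAbs := by rw [Nat.cast_natAbs, Int.cast_abs]
    have h1 : ‖inner ℂ (S.mode m (S.ramp m.natAbs)) (S.component 1 u)‖
        = m.natAbs * ‖inner ℂ (S.mode m (S.ramp m.natAbs)) (S.component 0 u)‖ := by
      rw [inner_mode, component_apply, S.integral_modeFun_dx u _ (S.contDiff_ramp _),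
        inner_mode, norm_mul, component_apply, ← hm]
      congr 1
      simp
    rw [h1, hm, S.traceRight_eq u m m.natAbs]
    set k : ℝ := (m.natAbs : ℝ) with hk
    have hk0 : 0 ≤ k := Nat.cast_nonneg _
    set x := ‖inner ℂ (S.mode m (S.ramp (m.natAbs + 1))) (S.component 2 u)‖
    set y := ‖inner ℂ (S.mode m (S.ramp m.natAbs)) (S.component 0 u)‖ with hy
    have h2 : ‖1 / (2 * (Real.pi : ℂ)) * (inner ℂ (S.mode m (S.ramp (m.natAbs + 1))) (S.component 2 u)
        + (((m.natAbs + 1 : ℕ) / (2 * S.L) : ℝ) : ℂ)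
          * inner ℂ (S.mode m (S.ramp m.natAbs)) (S.component 0 u))‖
        ≤ 1 / (2 * Real.pi) * (x + (k + 1) / (2 * S.L) * y) := by
      rw [norm_mul]
      have e : ‖1 / (2 * (Real.pi : ℂ))‖ = 1 / (2 * Real.pi) := by
        rw [norm_div, norm_mul, Complex.norm_real, Real.norm_of_nonneg hpi.le]; simp
      rw [e]
      refine mul_le_mul_of_nonneg_left ((norm_add_le _ _).trans ?_) (by positivity)
      rw [norm_mul, Complex.norm_real, Real.norm_of_nonneg (by positivity)]
      push_cast
      exact le_rfl
    have h3 : (1 / (2 * Real.pi) * (x + (k + 1) / (2 * S.L) * y)) ^ 2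
        ≤ 1 / (2 * Real.pi ^ 2) * (x ^ 2 + (k + 1) ^ 2 / (4 * S.L ^ 2) * y ^ 2) := by
      have : (x + (k + 1) / (2 * S.L) * y) ^ 2
          ≤ 2 * (x ^ 2 + ((k + 1) / (2 * S.L) * y) ^ 2) := add_sq_le
      calc (1 / (2 * Real.pi) * (x + (k + 1) / (2 * S.L) * y)) ^ 2
          = (1 / (2 * Real.pi)) ^ 2 * (x + (k + 1) / (2 * S.L) * y) ^ 2 := by ring
        _ ≤ (1 / (2 * Real.pi)) ^ 2 * (2 * (x ^ 2 + ((k + 1) / (2 * S.L) * y) ^ 2)) := by gcongr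
        _ = _ := by ring
    have h4 := (pow_le_pow_left₀ (norm_nonneg _) h2 2).trans h3
    refine (mul_le_mul_of_nonneg_left h4 (by positivity)).trans ?_
    have e1 : 2 * S.L / Real.pi * (x ^ 2 / (4 * Real.pi * S.L / (2 * (m.natAbs + 1 : ℕ) + 1))
        + 1 / (2 * S.L ^ 2) * (y ^ 2 / (4 * Real.pi * S.L / (2 * k + 1))
          + (k * y) ^ 2 / (4 * Real.pi * S.L / (2 * k + 1))))
        = 1 / (2 * Real.pi ^ 2) * ((2 * k + 3) * x ^ 2
          + (2 * k + 1) * ((1 + k ^ 2) / (2 * S.L ^ 2)) * y ^ 2) := by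
      push_cast
      rw [← hk]
      field_simp
      ring
    rw [e1, mul_left_comm, mul_add]
    refine mul_le_mul_of_nonneg_left (add_le_add ?_ ?_) (by positivity)
    · exact mul_le_mul_of_nonneg_right (by linarith) (by positivity)
    · rw [← mul_assoc]
      refine mul_le_mul_of_nonneg_right (mul_le_mul (by linarith) ?_ (by positivity) (by positivity))
        (by positivity)
      rw [div_le_div_iff₀ (by positivity) (by positivity)]
      nlinarith [mul_nonneg (sq_nonneg (k - 1)) (sq_nonneg S.L)]
  refine (Finset.sum_le_sum fun m _ => key m).trans ?_
  rw [← Finset.mul_sum, Finset.sum_add_distrib, ← Finset.mul_sum, Finset.sum_add_distrib,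
    mul_assoc (2 * S.L / Real.pi)]
  refine mul_le_mul_of_nonneg_left ?_ (by positivity)
  have h3 := S.norm_sq_eq u
  have h4 : 0 ≤ 1 / (2 * S.L ^ 2) := by positivity
  refine (add_le_add b2 (mul_le_mul_of_nonneg_left (add_le_add b0 b1) h4)).trans ?_
  rw [h3]
  have h5 := mul_nonneg h4 (sq_nonneg ‖S.component 2 u‖)
  have h6 := sq_nonneg ‖S.component 0 u‖
  have h7 := sq_nonneg ‖S.component 1 u‖
  linear_combination h5 + h6 + h7

/-- The sequence space `ℓ²(ℤ)`. -/
abbrev ell2 : Type := lp (fun _ : ℤ => ℂ) 2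

theorem sum_norm_rpow_traceRight_le (u : S.H1per) (s : Finset ℤ) :
    ∑ m ∈ s, ‖((√(1 + |(m : ℝ)|) : ℝ) : ℂ) * S.traceRight u m‖ ^ (2 : ENNReal).toReal
      ≤ 2 * S.L / Real.pi * (1 + 1 / (2 * S.L ^ 2)) * ‖u‖ ^ 2 := by
  refine le_trans (le_of_eq (Finset.sum_congr rfl fun m _ => ?_)) (S.sum_norm_traceRight_sq_le u s)
  rw [norm_mul, Complex.norm_real, Real.norm_of_nonneg (Real.sqrt_nonneg _),
    ENNReal.toReal_ofNat, Real.rpow_ofNat, mul_pow, Real.sq_sqrt (by positivity)]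

/-- The traces on `z = L` as an operator from `H¹_per` to `ℓ²`: the Fourier coefficients are
multiplied by `√(1 + |m|)`. -/
def traceOpRight : S.H1per →L[ℂ] ell2 :=
  LinearMap.mkContinuous
    { toFun := fun u => ⟨fun m => ((√(1 + |(m : ℝ)|) : ℝ) : ℂ) * S.traceRight u m,
        memℓp_gen' fun s => S.sum_norm_rpow_traceRight_le u s⟩
      map_add' := fun u v => by
        ext m
        simp only [traceRight_add, mul_add]
        rfl
      map_smul' := fun c u => by
        ext m
        simp only [traceRight_smul]
        exact mul_left_comm _ _ _ }
    (√(2 * S.L / Real.pi * (1 + 1 / (2 * S.L ^ 2)))) fun u => by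
      have hL := S.L_pos
      have hpi := Real.pi_pos
      refine lp.norm_le_of_forall_sum_le (by simp) (by positivity) fun s => ?_
      refine (S.sum_norm_rpow_traceRight_le u s).trans (le_of_eq ?_)
      have e : (2 : ENNReal).toReal = (2 : ℕ) := by simp
      rw [e, Real.rpow_natCast, mul_pow, Real.sq_sqrt (by positivity)]

theorem traceOpRight_apply (u : S.H1per) (m : ℤ) :
    S.traceOpRight u m = ((√(1 + |(m : ℝ)|) : ℝ) : ℂ) * S.traceRight u m := rfl

/-! ### The reflection about the `x`-axis -/

theorem measurePreserving_reflect :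
    MeasurePreserving (fun p : ℝ × ℝ => (p.1, -p.2)) (volume.restrict S.cell)
      (volume.restrict S.cell) := by
  rw [volume_restrict_cell]
  refine (MeasurePreserving.id _).prod ?_
  have h := (Measure.measurePreserving_neg (volume : Measure ℝ)).restrict_preimage
    (measurableSet_Ioo (a := -S.L) (b := S.L))
  simpa using h

/-- The reflection of functions in `L²`. -/
def reflectL2 : S.L2 →ₗᵢ[ℂ] S.L2 := Lp.compMeasurePreservingₗᵢ ℂ _ S.measurePreserving_reflect

theorem reflectL2_ae (f : S.L2) :
    (S.reflectL2 f : ℝ × ℝ → ℂ) =ᵐ[volume.restrict S.cell] fun p => f (p.1, -p.2) :=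
  Lp.coeFn_compMeasurePreserving f S.measurePreserving_reflect

theorem integral_reflect (F : ℝ × ℝ → ℂ) :
    ∫ p in S.cell, F (p.1, -p.2) = ∫ p in S.cell, F p := by
  refine S.measurePreserving_reflect.integral_comp ?_ F
  exact ((MeasurableEquiv.refl ℝ).prodCongr (MeasurableEquiv.neg ℝ)).measurableEmbedding

theorem integral_reflectL2_mul (f : S.L2) (ψ : ℝ × ℝ → ℂ) :
    ∫ p in S.cell, S.reflectL2 f p * ψ p = ∫ p in S.cell, f p * ψ (p.1, -p.2) := by
  rw [← S.integral_reflect (fun p => f p * ψ (p.1, -p.2))]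
  refine integral_congr_ae ?_
  filter_upwards [S.reflectL2_ae f] with p hp
  rw [hp, neg_neg]

variable {S} in
theorem IsTest.reflect {φ : ℝ × ℝ → ℂ} (h : S.IsTest φ) : S.IsTest fun p => φ (p.1, -p.2) where
  smooth := h.smooth.comp (contDiff_fst.prodMk contDiff_snd.neg)
  periodic x z := h.periodic x (-z)
  support := by
    obtain ⟨δ, hδ, h0⟩ := h.support
    exact ⟨δ, hδ, fun x z hz => h0 x (-z) (by rwa [abs_neg])⟩

variable {S} in
theorem IsTest.fderiv_reflect {φ : ℝ × ℝ → ℂ} (h : S.IsTest φ) (p v : ℝ × ℝ) :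
    fderiv ℝ (fun p : ℝ × ℝ => φ (p.1, -p.2)) p v = fderiv ℝ φ (p.1, -p.2) (v.1, -v.2) := by
  have h1 : HasFDerivAt (fun p : ℝ × ℝ => (p.1, -p.2))
      ((ContinuousLinearMap.fst ℝ ℝ ℝ).prod (-ContinuousLinearMap.snd ℝ ℝ ℝ)) p :=
    hasFDerivAt_fst.prodMk hasFDerivAt_snd.neg
  have h2 := (h.smooth.differentiable (by simp) (p.1, -p.2)).hasFDerivAt.comp p h1
  have h3 : fderiv ℝ (fun p : ℝ × ℝ => φ (p.1, -p.2)) p = _ := h2.fderiv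
  rw [h3]
  rfl

/-- The reflection `u(x, z) ↦ u(x, -z)` of `H¹_per`. -/
def reflect (u : S.H1per) : S.H1per :=
  ⟨WithLp.toLp 2 ![S.reflectL2 (u.1 0), S.reflectL2 (u.1 1), -S.reflectL2 (u.1 2)], by
    intro φ hφ
    have h1 := u.2 _ hφ.reflect
    have e0 : (WithLp.toLp 2 ![S.reflectL2 (u.1 0), S.reflectL2 (u.1 1), -S.reflectL2 (u.1 2)] :
      PiLp 2 (fun _ : Fin 3 => S.L2)) 0 = S.reflectL2 (u.1 0) := rfl
    have e1 : (WithLp.toLp 2 ![S.reflectL2 (u.1 0), S.reflectL2 (u.1 1), -S.reflectL2 (u.1 2)] :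
      PiLp 2 (fun _ : Fin 3 => S.L2)) 1 = S.reflectL2 (u.1 1) := rfl
    have e2 : (WithLp.toLp 2 ![S.reflectL2 (u.1 0), S.reflectL2 (u.1 1), -S.reflectL2 (u.1 2)] :
      PiLp 2 (fun _ : Fin 3 => S.L2)) 2 = -S.reflectL2 (u.1 2) := rfl
    rw [e0, e1, e2]
    have hneg : ∫ p in S.cell, (-S.reflectL2 (u.1 2) : S.L2) p * φ p
        = -∫ p in S.cell, S.reflectL2 (u.1 2) p * φ p := by
      rw [← integral_neg]
      refine integral_congr_ae ?_
      filter_upwards [Lp.coeFn_neg (S.reflectL2 (u.1 2))] with p hp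
      rw [hp, Pi.neg_apply, neg_mul]
    rw [hneg, S.integral_reflectL2_mul _ (fun p => fderiv ℝ φ p (1, 0)),
      S.integral_reflectL2_mul _ (fun p => fderiv ℝ φ p (0, 1)), S.integral_reflectL2_mul,
      S.integral_reflectL2_mul]
    simp only [hφ.fderiv_reflect, neg_zero] at h1
    refine ⟨h1.1, ?_⟩
    rw [neg_neg, ← neg_inj, ← h1.2, ← integral_neg]
    refine integral_congr_ae (.of_forall fun p => ?_)
    simp only
    rw [show ((0 : ℝ), (-1 : ℝ)) = -((0 : ℝ), (1 : ℝ)) by simp, map_neg, mul_neg]⟩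

theorem component_reflect (u : S.H1per) :
    S.component 0 (S.reflect u) = S.reflectL2 (S.component 0 u) ∧
    S.component 1 (S.reflect u) = S.reflectL2 (S.component 1 u) ∧
    S.component 2 (S.reflect u) = -S.reflectL2 (S.component 2 u) := ⟨rfl, rfl, rfl⟩

/-- The reflection of `H¹_per` as an isometric linear operator. -/
def reflectOp : S.H1per →ₗᵢ[ℂ] S.H1per where
  toFun := S.reflect
  map_add' u v := by
    refine Subtype.ext (PiLp.ext fun i => ?_)
    fin_cases i
    · exact map_add S.reflectL2 _ _
    · exact map_add S.reflectL2 _ _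
    · exact (congrArg Neg.neg (map_add S.reflectL2 _ _)).trans (neg_add _ _)
  map_smul' c u := by
    refine Subtype.ext (PiLp.ext fun i => ?_)
    fin_cases i
    · exact map_smul S.reflectL2 _ _
    · exact map_smul S.reflectL2 _ _
    · exact (congrArg Neg.neg (map_smul S.reflectL2 _ _)).trans (smul_neg _ _).symm
  norm_map' u := by
    have h := S.norm_sq_eq (S.reflect u)
    obtain ⟨h0, h1, h2⟩ := S.component_reflect u
    rw [h0, h1, h2, norm_neg, LinearIsometry.norm_map, LinearIsometry.norm_map,
      LinearIsometry.norm_map, ← S.norm_sq_eq u] at h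
    exact (pow_left_inj₀ (norm_nonneg _) (norm_nonneg _) two_ne_zero).1 h

theorem traceRight_reflect (u : S.H1per) (m : ℤ) :
    S.traceRight (S.reflect u) m = S.traceLeft u m := by
  rw [traceRight, traceLeft, ← S.integral_reflect (fun p => Complex.exp (-Complex.I * m * p.1) *
    ((1 / (2 * S.L) : ℝ) * u.1 0 p - ((S.L - p.2) / (2 * S.L) : ℝ) * u.1 2 p))]
  congr 1
  refine integral_congr_ae ?_
  have e0 : (S.reflect u).1 0 = S.reflectL2 (u.1 0) := rfl
  have e2 : (S.reflect u).1 2 = -S.reflectL2 (u.1 2) := rfl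
  rw [e0, e2]
  filter_upwards [S.reflectL2_ae (u.1 0), S.reflectL2_ae (u.1 2),
    Lp.coeFn_neg (S.reflectL2 (u.1 2))] with p h0 h2 h3
  rw [h3, Pi.neg_apply, h0, h2, sub_neg_eq_add, add_comm S.L]
  ring

theorem reflect_reflect (u : S.H1per) : S.reflect (S.reflect u) = u := by
  have h : ∀ f : S.L2, S.reflectL2 (S.reflectL2 f) = f := fun f => by
    refine Lp.ext ?_
    filter_upwards [S.reflectL2_ae (S.reflectL2 f),
      S.measurePreserving_reflect.quasiMeasurePreserving.ae (S.reflectL2_ae f)] with p h1 h2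
    rw [h1, h2, neg_neg]
  refine Subtype.ext (PiLp.ext fun i => ?_)
  fin_cases i
  · exact h _
  · exact h _
  · exact (congrArg Neg.neg (map_neg S.reflectL2 _)).trans ((neg_neg _).trans (h _))

theorem traceLeft_reflect (u : S.H1per) (m : ℤ) :
    S.traceLeft (S.reflect u) m = S.traceRight u m := by
  rw [← traceRight_reflect, reflect_reflect]

/-- The traces on `z = -L` as an operator from `H¹_per` to `ℓ²`. -/
def traceOpLeft : S.H1per →L[ℂ] ell2 := S.traceOpRight.comp S.reflectOp.toContinuousLinearMap

theorem traceOpLeft_apply (u : S.H1per) (m : ℤ) :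
    S.traceOpLeft u m = ((√(1 + |(m : ℝ)|) : ℝ) : ℂ) * S.traceLeft u m := by
  rw [← traceRight_reflect]
  rfl

end PeriodicSlab

/-! ### The exponents `η_m` as an analytic family in `ℓ^∞` -/

/-- A continuous square root of an analytic family in a commutative Banach algebra is analytic where
it is invertible. -/
theorem IsComplexAnalyticAt.of_sq {𝒜 : Type*} [NormedCommRing 𝒜] [NormedAlgebra ℂ 𝒜]
    [CompleteSpace 𝒜] {s M : ℝ × ℝ → 𝒜} {p : ℝ × ℝ} (hM : IsComplexAnalyticAt M p)
    (hs : ContinuousAt s p) (hu : IsUnit (s p)) (hsq : ∀ᶠ q in 𝓝 p, s q * s q = M q) :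
    IsComplexAnalyticAt s p := by
  set a := s p with ha
  obtain ⟨w, hw⟩ := hu
  let D : 𝒜 ≃L[ℂ] 𝒜 := ContinuousLinearEquiv.equivOfInverse
    ((2 : ℂ) • ContinuousLinearMap.mul ℂ 𝒜 (w : 𝒜))
    ((2 : ℂ)⁻¹ • ContinuousLinearMap.mul ℂ 𝒜 ((w⁻¹ : 𝒜ˣ) : 𝒜))
    (fun x => by simp [smul_smul]) (fun x => by simp [smul_smul])
  have hD : ∀ x, D x = (2 : ℂ) • (a * x) := fun x => by rw [← hw]; rfl
  have hcd : ContDiffAt ℂ ⊤ (fun x : 𝒜 => x * x) a := contDiffAt_id.mul contDiffAt_id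
  have hn : (⊤ : WithTop ℕ∞) ≠ 0 := by simp
  have hder : HasFDerivAt (fun x : 𝒜 => x * x) (D : 𝒜 →L[ℂ] 𝒜) a := by
    have h1 := (hasFDerivAt_id (𝕜 := ℂ) a).mul (hasFDerivAt_id (𝕜 := ℂ) a)
    refine h1.congr_fderiv ?_
    ext x
    simp only [ContinuousLinearEquiv.coe_coe, hD, two_smul]
    simp [mul_comm]
  have hinv := (hcd.to_localInverse hder hn).analyticAt
  have hleft := (hcd.hasStrictFDerivAt' hder hn).eventually_left_inverse
  have hMp : M p = a * a := hsq.self_of_nhds.symm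
  refine (hM.comp (Φ := hcd.localInverse hder hn) (by rw [hMp]; exact hinv)).congr ?_
  filter_upwards [hsq, hs.eventually hleft] with q h1 h2
  rw [← h1]
  exact h2

/-- The sequence space `ℓ^∞(ℤ)`. -/
abbrev ellInf : Type := lp (fun _ : ℤ => ℂ) ⊤

theorem memℓp_top_of_norm_le {f : ℤ → ℂ} {C : ℝ} (h : ∀ m, ‖f m‖ ≤ C) : Memℓp f ⊤ :=
  memℓp_infty ⟨C, by rintro _ ⟨m, rfl⟩; exact h m⟩

theorem isUnit_ellInf {x : ellInf} {δ : ℝ} (hδ : 0 < δ) (h : ∀ m, δ ≤ ‖x m‖) : IsUnit x := by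
  have hx : ∀ m, x m ≠ 0 := fun m => norm_pos_iff.1 (hδ.trans_le (h m))
  let y : ellInf := ⟨fun m => (x m)⁻¹, memℓp_top_of_norm_le (C := δ⁻¹) fun m => by
    rw [norm_inv]; exact inv_anti₀ hδ (h m)⟩
  refine IsUnit.of_mul_eq_one y ?_
  ext m
  rw [lp.infty_coeFn_mul]
  exact mul_inv_cancel₀ (hx m)

namespace PeriodicSlab

variable (S : PeriodicSlab)

/-- The action of `ℓ^∞(ℤ)` on `ℓ²(ℤ)` by multiplication. -/
def mulOp : ellInf →L[ℂ] ell2 →L[ℂ] ell2 :=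
  lp.holderL 2 (fun _ : ℤ => ContinuousLinearMap.mul ℂ ℂ) (K := 1) fun _ =>
    ContinuousLinearMap.opNorm_mul_le ℂ ℂ

theorem mulOp_apply (a : ellInf) (x : ell2) (m : ℤ) : mulOp a x m = a m * x m := rfl

theorem eta_sq (p : ℝ × ℝ) (m : ℤ) :
    S.eta p m * S.eta p m = ((S.ε₀ * S.μ₀ * p.2 ^ 2 - (m + p.1) ^ 2 : ℝ) : ℂ) := by
  rw [eta]
  split_ifs with h
  · rw [← Complex.ofReal_mul, Real.mul_self_sqrt h]
  · have h' : 0 ≤ (m + p.1) ^ 2 - S.ε₀ * S.μ₀ * p.2 ^ 2 := by linarith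
    rw [mul_mul_mul_comm, ← Complex.ofReal_mul, Real.mul_self_sqrt h', Complex.I_mul_I]
    push_cast
    ring

theorem norm_eta_sq (p : ℝ × ℝ) (m : ℤ) :
    ‖S.eta p m‖ ^ 2 = |S.ε₀ * S.μ₀ * p.2 ^ 2 - (m + p.1) ^ 2| := by
  rw [sq, ← norm_mul, eta_sq, Complex.norm_real, Real.norm_eq_abs]

theorem eta_re_nonneg (p : ℝ × ℝ) (m : ℤ) : 0 ≤ (S.eta p m).re := by
  rw [eta]
  split_ifs with h
  · rw [Complex.ofReal_re]; exact Real.sqrt_nonneg _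
  · simp

theorem eta_im_nonneg (p : ℝ × ℝ) (m : ℤ) : 0 ≤ (S.eta p m).im := by
  rw [eta]
  split_ifs with h
  · simp
  · simp [Real.sqrt_nonneg]

/-- The sequence `η_m / (1 + |m|)`. The weight `1 + |m|` makes it bounded and is compensated by the
weights `√(1 + |m|)` in the trace operators. -/
def symbol (p : ℝ × ℝ) : ellInf :=
  ⟨fun m => S.eta p m / (1 + |(m : ℝ)| : ℝ), by
    refine memℓp_top_of_norm_le (C := √(|S.ε₀ * S.μ₀| * p.2 ^ 2 + (1 + |p.1|) ^ 2)) fun m => ?_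
    have hm := abs_nonneg (m : ℝ)
    have hκ := abs_nonneg p.1
    rw [norm_div, Complex.norm_real, Real.norm_of_nonneg (by positivity), div_le_iff₀ (by positivity)]
    refine abs_le_of_sq_le_sq' ?_ (by positivity) |>.2
    rw [norm_eta_sq, mul_pow, Real.sq_sqrt (by positivity)]
    have h1 : |(m : ℝ) + p.1| ≤ (1 + |p.1|) * (1 + |(m : ℝ)|) :=
      (abs_add_le _ _).trans (by nlinarith)
    have h2 : ((m : ℝ) + p.1) ^ 2 ≤ ((1 + |p.1|) * (1 + |(m : ℝ)|)) ^ 2 :=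
      sq_le_sq.2 (h1.trans (le_abs_self _))
    calc |S.ε₀ * S.μ₀ * p.2 ^ 2 - (m + p.1) ^ 2|
        ≤ |S.ε₀ * S.μ₀ * p.2 ^ 2| + |((m : ℝ) + p.1) ^ 2| := abs_sub _ _
      _ ≤ |S.ε₀ * S.μ₀| * p.2 ^ 2 * (1 + |(m : ℝ)|) ^ 2 + ((1 + |p.1|) * (1 + |(m : ℝ)|)) ^ 2 := by
          rw [abs_mul, abs_of_nonneg (sq_nonneg p.2), abs_of_nonneg (sq_nonneg ((m : ℝ) + p.1))]
          refine add_le_add (le_mul_of_one_le_right (by positivity) ?_) h2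
          nlinarith
      _ = _ := by ring⟩

theorem symbol_apply (p : ℝ × ℝ) (m : ℤ) : S.symbol p m = S.eta p m / (1 + |(m : ℝ)| : ℝ) := rfl

/-- The sequences `1 / (1 + |m|)²`, `m / (1 + |m|)²` and `m² / (1 + |m|)²`. -/
def weightSeq (k : Fin 3) : ellInf :=
  ⟨fun m => ((m ^ (k : ℕ) / (1 + |(m : ℝ)|) ^ 2 : ℝ) : ℂ), by
    refine memℓp_top_of_norm_le (C := 1) fun m => ?_
    have hm := abs_nonneg (m : ℝ)
    rw [Complex.norm_real, Real.norm_eq_abs, abs_div, abs_of_pos (by positivity : 0 < (1 + |(m : ℝ)|) ^ 2),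
      div_le_one (by positivity), abs_pow]
    calc |(m : ℝ)| ^ (k : ℕ) ≤ (1 + |(m : ℝ)|) ^ (k : ℕ) := by gcongr; linarith
      _ ≤ (1 + |(m : ℝ)|) ^ 2 := pow_le_pow_right₀ (by linarith) (by omega)⟩

theorem weightSeq_apply (k : Fin 3) (m : ℤ) :
    weightSeq k m = ((m ^ (k : ℕ) / (1 + |(m : ℝ)|) ^ 2 : ℝ) : ℂ) := rfl

/-- The square of the symbol, a polynomial in `(κ, ω)`. -/
def symbolSq (p : ℝ × ℝ) : ellInf :=
  ((S.ε₀ * S.μ₀ : ℂ) * (p.2 * p.2) - p.1 * p.1) • weightSeq 0 - (2 * (p.1 : ℂ)) • weightSeq 1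
    - weightSeq 2

theorem symbolSq_apply (p : ℝ × ℝ) (m : ℤ) : S.symbolSq p m
    = ((S.ε₀ * S.μ₀ * p.2 ^ 2 - (m + p.1) ^ 2) / (1 + |(m : ℝ)|) ^ 2 : ℝ) := by
  have e : S.symbolSq p m = ((S.ε₀ * S.μ₀ : ℂ) * (p.2 * p.2) - p.1 * p.1) * weightSeq 0 m
    - (2 * (p.1 : ℂ)) * weightSeq 1 m - weightSeq 2 m := rfl
  rw [e, weightSeq_apply, weightSeq_apply, weightSeq_apply]
  push_cast
  simp only [Fin.val_zero, Fin.val_one, Fin.val_two]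
  ring

theorem symbol_mul_self (p : ℝ × ℝ) : S.symbol p * S.symbol p = S.symbolSq p := by
  ext m
  rw [lp.infty_coeFn_mul, Pi.mul_apply, symbol_apply, symbolSq_apply, div_mul_div_comm, eta_sq]
  push_cast
  ring

theorem isComplexAnalyticAt_symbolSq (p : ℝ × ℝ) : IsComplexAnalyticAt S.symbolSq p := by
  have h1 := IsComplexAnalyticAt.ofReal_fst (p := p)
  have h2 := IsComplexAnalyticAt.ofReal_snd (p := p)
  exact (((((h2.mul h2).const_mul _).sub (h1.mul h1)).smul (.const _)).sub
    ((h1.const_mul 2).smul (.const _))).sub (.const _)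

/-- In the diamond the exponents are bounded away from zero, uniformly after division by
`1 + |m|`. -/
theorem exists_le_norm_symbol {p : ℝ × ℝ} (hp : p ∈ S.diamond) :
    ∃ δ > 0, ∀ m, δ ≤ ‖S.symbol p m‖ := by
  obtain ⟨-, h1, h2⟩ := hp
  set w := p.2 * √(S.ε₀ * S.μ₀) with hw
  have hκ := abs_nonneg p.1
  have hw0 : 0 < w := hκ.trans_lt h1
  have hc : 0 ≤ S.ε₀ * S.μ₀ := by
    by_contra hc
    rw [hw, Real.sqrt_eq_zero_of_nonpos (not_le.1 hc).le, mul_zero] at hw0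
    exact lt_irrefl _ hw0
  have hw2 : S.ε₀ * S.μ₀ * p.2 ^ 2 = w ^ 2 := by rw [hw, mul_pow, Real.sq_sqrt hc]; ring
  set g := 1 - |p.1| - w with hg
  have hg0 : 0 < g := by linarith
  have hg1 : g < 1 := by linarith
  have hd : 0 < w ^ 2 - |p.1| ^ 2 := by nlinarith
  refine ⟨√(min (w ^ 2 - |p.1| ^ 2) (g ^ 2 / 4)), Real.sqrt_pos.2 (lt_min hd (by positivity)),
    fun m => ?_⟩
  have hm := abs_nonneg (m : ℝ)
  refine Real.sqrt_le_iff.2 ⟨norm_nonneg _, ?_⟩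
  rw [symbol_apply, norm_div, div_pow, norm_eta_sq, Complex.norm_real,
    Real.norm_of_nonneg (by positivity), hw2]
  by_cases h : m = 0
  · subst h
    refine (min_le_left _ _).trans (le_of_eq ?_)
    simp only [Int.cast_zero, zero_add, abs_zero, add_zero, one_pow, div_one]
    rw [sq_abs p.1] at hd ⊢
    rw [abs_of_pos hd]
  · refine (min_le_right _ _).trans ?_
    have hm1 : 1 ≤ |(m : ℝ)| := by exact_mod_cast Int.one_le_abs h
    have h3 : |(m : ℝ)| - |p.1| ≤ |(m : ℝ) + p.1| := by
      have := abs_sub_abs_le_abs_sub (m : ℝ) (-p.1)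
      rwa [abs_neg, sub_neg_eq_add] at this
    have h4 : g * |(m : ℝ)| ≤ |(m : ℝ) + p.1| - w := by
      nlinarith [mul_nonneg (sub_nonneg.2 hm1) (sub_nonneg.2 hg1.le)]
    have h5 : (g * |(m : ℝ)|) ^ 2 ≤ ((m : ℝ) + p.1) ^ 2 - w ^ 2 := by
      rw [← sq_abs ((m : ℝ) + p.1)]
      nlinarith [mul_nonneg hg0.le hm]
    rw [abs_sub_comm, abs_of_nonneg ((sq_nonneg _).trans h5), div_le_div_iff₀ (by norm_num) (by positivity)]
    nlinarith [mul_nonneg (sq_nonneg g) (sub_nonneg.2 (by nlinarith : (1 + |(m : ℝ)|) ^ 2 ≤ (2 * |(m : ℝ)|) ^ 2))]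

/-- The symbol is a square root of a polynomial in `(κ, ω)` with values in `ℓ^∞`. The chosen branch is
continuous, as both parts of every `η_m` are nonnegative. -/
theorem isComplexAnalyticAt_symbol {p : ℝ × ℝ} (hp : p ∈ S.diamond) :
    IsComplexAnalyticAt S.symbol p := by
  obtain ⟨δ, hδ, h⟩ := S.exists_le_norm_symbol hp
  refine (S.isComplexAnalyticAt_symbolSq p).of_sq ?_ (isUnit_ellInf hδ h)
    (.of_forall S.symbol_mul_self)
  -- The real and imaginary parts are nonnegative, so that `|η_m + η_m'| ≥ |η_m'|`.
  have hb : ∀ q, ‖S.symbol q - S.symbol p‖ ≤ ‖S.symbolSq q - S.symbolSq p‖ / δ := by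
    intro q
    refine lp.norm_le_of_forall_le (by positivity) fun m => ?_
    rw [le_div_iff₀ hδ]
    have e : (S.symbol q - S.symbol p) m * (S.symbol q m + S.symbol p m)
        = (S.symbolSq q - S.symbolSq p) m := by
      rw [← symbol_mul_self, ← symbol_mul_self, lp.coeFn_sub, lp.coeFn_sub, lp.infty_coeFn_mul,
        lp.infty_coeFn_mul]
      simp only [Pi.sub_apply, Pi.mul_apply]
      ring
    have hpos : ∀ r, 0 ≤ (S.symbol r m).re ∧ 0 ≤ (S.symbol r m).im := fun r => by
      rw [symbol_apply, Complex.div_ofReal_re, Complex.div_ofReal_im]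
      exact ⟨div_nonneg (S.eta_re_nonneg r m) (by positivity),
        div_nonneg (S.eta_im_nonneg r m) (by positivity)⟩
    have h1 : ‖S.symbol p m‖ ≤ ‖S.symbol q m + S.symbol p m‖ := by
      refine abs_le_of_sq_le_sq' ?_ (norm_nonneg _) |>.2
      rw [← Complex.normSq_eq_norm_sq, ← Complex.normSq_eq_norm_sq, Complex.normSq_apply,
        Complex.normSq_apply, Complex.add_re, Complex.add_im]
      obtain ⟨a1, a2⟩ := hpos p
      obtain ⟨b1, b2⟩ := hpos q
      nlinarith [mul_nonneg a1 b1, mul_nonneg a2 b2]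
    calc ‖(S.symbol q - S.symbol p) m‖ * δ
        ≤ ‖(S.symbol q - S.symbol p) m‖ * ‖S.symbol q m + S.symbol p m‖ := by
          gcongr; exact (h m).trans h1
      _ = ‖(S.symbolSq q - S.symbolSq p) m‖ := by rw [← norm_mul, e]
      _ ≤ _ := lp.norm_apply_le_norm (by simp) _ m
  have hc := (S.isComplexAnalyticAt_symbolSq p).continuousAt
  rw [ContinuousAt, tendsto_iff_norm_sub_tendsto_zero] at hc ⊢
  refine squeeze_zero (fun _ => norm_nonneg _) hb ?_
  simpa using hc.div_const δ

/-- Evaluation at `m = 0` of a sequence in `ℓ^∞`. -/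
def evalInf : ellInf →L[ℂ] ℂ := lp.evalCLM ℂ (fun _ : ℤ => ℂ) ⊤ 0

theorem isComplexAnalyticAt_eta {p : ℝ × ℝ} (hp : p ∈ S.diamond) :
    IsComplexAnalyticAt (fun q => S.eta q 0) p := by
  have h := (S.isComplexAnalyticAt_symbol hp).clm_comp evalInf
  refine h.congr (.of_forall fun q => ?_)
  change S.symbol q 0 = _
  rw [symbol_apply]
  simp

end PeriodicSlab

/-! ### The operators of the variational problem -/

theorem IsComplexAnalyticAt.comp_comp {V V' X W : Type*} [NormedAddCommGroup V] [NormedSpace ℂ V]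
    [NormedAddCommGroup V'] [NormedSpace ℂ V'] [NormedAddCommGroup X] [NormedSpace ℂ X]
    [NormedAddCommGroup W] [NormedSpace ℂ W] {F : ℝ × ℝ → V →L[ℂ] V'} {p : ℝ × ℝ}
    (h : IsComplexAnalyticAt F p) (Λ : V' →L[ℂ] W) (Λ' : X →L[ℂ] V) :
    IsComplexAnalyticAt (fun q => Λ.comp ((F q).comp Λ')) p :=
  (h.clm_comp ((ContinuousLinearMap.compL ℂ X V V').flip Λ')).clm_comp
    (ContinuousLinearMap.compL ℂ X V' W Λ)

namespace PeriodicSlab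

variable (S : PeriodicSlab)

/-- Multiplication by a bounded real function. -/
def mulWeight {w : ℝ × ℝ → ℝ} (hw : MemLp (fun p => (w p : ℂ)) ⊤ (volume.restrict S.cell)) :
    S.L2 →L[ℂ] S.L2 :=
  (ContinuousLinearMap.mul ℂ ℂ).holderL (volume.restrict S.cell) ⊤ 2 2 hw.toLp

theorem mulWeight_ae {w : ℝ × ℝ → ℝ} (hw : MemLp (fun p => (w p : ℂ)) ⊤ (volume.restrict S.cell))
    (f : S.L2) : S.mulWeight hw f =ᵐ[volume.restrict S.cell] fun p => (w p : ℂ) * f p := by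
  have h1 := (ContinuousLinearMap.mul ℂ ℂ).coeFn_holder (r := 2) hw.toLp f
  filter_upwards [h1, hw.coeFn_toLp] with p h1 h2
  refine Eq.trans h1 ?_
  rw [h2]
  rfl

theorem inner_mulWeight {w : ℝ × ℝ → ℝ} (hw : MemLp (fun p => (w p : ℂ)) ⊤ (volume.restrict S.cell))
    (f g : S.L2) :
    inner ℂ g (S.mulWeight hw f) = ∫ p in S.cell, (w p : ℂ) * (f p * star (g p)) := by
  rw [L2.inner_def]
  refine integral_congr_ae ?_
  filter_upwards [S.mulWeight_ae hw f] with p h3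
  rw [h3, RCLike.inner_apply, mul_assoc]
  rfl

theorem integrable_weight {w : ℝ × ℝ → ℝ}
    (hw : MemLp (fun p => (w p : ℂ)) ⊤ (volume.restrict S.cell)) (f g : S.L2) :
    Integrable (fun p => (w p : ℂ) * (f p * star (g p))) (volume.restrict S.cell) := by
  refine (L2.integrable_inner (𝕜 := ℂ) g (S.mulWeight hw f)).congr ?_
  filter_upwards [S.mulWeight_ae hw f] with p h3
  rw [h3, RCLike.inner_apply, mul_assoc]
  rfl

theorem star_inner_mulWeight {w : ℝ × ℝ → ℝ}
    (hw : MemLp (fun p => (w p : ℂ)) ⊤ (volume.restrict S.cell)) (f g : S.L2) :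
    star (inner ℂ f (S.mulWeight hw g)) = inner ℂ g (S.mulWeight hw f) := by
  rw [inner_mulWeight, inner_mulWeight, Complex.star_def, ← integral_conj]
  refine integral_congr_ae (.of_forall fun p => ?_)
  simp only [map_mul, Complex.conj_ofReal, Complex.conj_conj]
  ring

theorem le_re_inner_mulWeight {w : ℝ × ℝ → ℝ}
    (hw : MemLp (fun p => (w p : ℂ)) ⊤ (volume.restrict S.cell)) {c : ℝ} (hc : ∀ p, c ≤ w p)
    (f : S.L2) : c * ‖f‖ ^ 2 ≤ (inner ℂ f (S.mulWeight hw f)).re := by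
  have h1 : ‖f‖ ^ 2 = ∫ p in S.cell, ‖f p‖ ^ 2 := by
    have := inner_self_eq_norm_sq (𝕜 := ℂ) f
    rw [← this, L2.inner_def]
    rw [show RCLike.re (∫ a in S.cell, inner ℂ (f a) (f a)) = ∫ a in S.cell, RCLike.re (inner ℂ (f a) (f a))
      from (integral_re (L2.integrable_inner f f)).symm]
    refine integral_congr_ae (.of_forall fun p => ?_)
    exact inner_self_eq_norm_sq (𝕜 := ℂ) (f p)
  have hi1 : Integrable (fun p => ‖f p‖ ^ 2) (volume.restrict S.cell) :=
    (Lp.memLp f).integrable_norm_pow two_ne_zero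
  have e : ∀ p, (w p : ℂ) * (f p * star (f p)) = ((w p * ‖f p‖ ^ 2 : ℝ) : ℂ) := fun p => by
    rw [Complex.star_def, Complex.mul_conj']; push_cast; rfl
  have hi2 := S.integrable_weight hw f f
  rw [inner_mulWeight]
  simp only [e] at hi2 ⊢
  rw [integral_complex_ofReal, Complex.ofReal_re, h1, ← integral_const_mul]
  have hi3 : Integrable (fun p => w p * ‖f p‖ ^ 2) (volume.restrict S.cell) := by
    exact hi2.re.congr (.of_forall fun p => Complex.ofReal_re _)
  exact integral_mono (hi1.const_mul c) hi3 fun p =>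
    mul_le_mul_of_nonneg_right (hc p) (by positivity)

theorem memLp_ε : MemLp (fun p => (S.ε p : ℂ)) ⊤ (volume.restrict S.cell) := by
  obtain ⟨m, M, hm, h⟩ := S.bounds_ε
  refine memLp_top_of_bound (Complex.measurable_ofReal.comp S.measurable_ε).aestronglyMeasurable M
    (.of_forall fun p => ?_)
  rw [Complex.norm_real, Real.norm_of_nonneg (hm.trans (h p).1).le]
  exact (h p).2.le

theorem memLp_μ_inv : MemLp (fun p => (((S.μ p)⁻¹ : ℝ) : ℂ)) ⊤ (volume.restrict S.cell) := by
  obtain ⟨m, M, hm, h⟩ := S.bounds_μ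
  refine memLp_top_of_bound (Complex.measurable_ofReal.comp S.measurable_μ.inv).aestronglyMeasurable
    m⁻¹ (.of_forall fun p => ?_)
  rw [Complex.norm_real, Real.norm_of_nonneg (inv_nonneg.2 (hm.trans (h p).1).le)]
  exact inv_anti₀ hm (h p).1.le

theorem ε₀_pos : 0 < S.ε₀ := by
  obtain ⟨m, M, hm, h⟩ := S.bounds_ε
  rw [← S.ε_outside 0 S.L (le_abs_self _)]
  exact hm.trans (h _).1

theorem μ₀_pos : 0 < S.μ₀ := by
  obtain ⟨m, M, hm, h⟩ := S.bounds_μ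
  rw [← S.μ_outside 0 S.L (le_abs_self _)]
  exact hm.trans (h _).1

/-- The operator of the form `∫ ε u v̄`. -/
def bOp : S.H1per →L[ℂ] S.H1per :=
  (S.component 0).adjoint.comp ((S.mulWeight S.memLp_ε).comp (S.component 0))

theorem inner_bOp (u v : S.H1per) : inner ℂ v (S.bOp u) = S.bForm u v := by
  rw [bOp, ContinuousLinearMap.comp_apply, ContinuousLinearMap.adjoint_inner_right,
    ContinuousLinearMap.comp_apply, inner_mulWeight]
  rfl

/-- The operator of the form `∫ μ⁻¹ uⱼ v̄ᵢ` in the components of `u` and `v`. -/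
def stiffnessOp (i j : Fin 3) : S.H1per →L[ℂ] S.H1per :=
  (S.component i).adjoint.comp ((S.mulWeight S.memLp_μ_inv).comp (S.component j))

theorem inner_stiffnessOp (i j : Fin 3) (u v : S.H1per) : inner ℂ v (S.stiffnessOp i j u)
    = inner ℂ (S.component i v) (S.mulWeight S.memLp_μ_inv (S.component j u)) := by
  rw [stiffnessOp, ContinuousLinearMap.comp_apply, ContinuousLinearMap.adjoint_inner_right,
    ContinuousLinearMap.comp_apply]

/-- The part `∫ μ⁻¹ (∇ + iκ)u · (∇ - iκ)v̄` of the form `h`. -/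
def volumeForm (κ : ℝ) (u v : S.H1per) : ℂ :=
  inner ℂ (S.component 1 v + (Complex.I * κ) • S.component 0 v)
    (S.mulWeight S.memLp_μ_inv (S.component 1 u + (Complex.I * κ) • S.component 0 u))
  + inner ℂ (S.component 2 v) (S.mulWeight S.memLp_μ_inv (S.component 2 u))

theorem hForm_eq (p : ℝ × ℝ) (u v : S.H1per) :
    S.hForm p u v = S.volumeForm p.1 u v + (S.μ₀⁻¹ : ℂ) * S.dtnForm p u v := by
  rw [hForm, volumeForm, inner_mulWeight, inner_mulWeight,
    ← integral_add (S.integrable_weight S.memLp_μ_inv _ _) (S.integrable_weight S.memLp_μ_inv _ _)]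
  congr 1
  refine integral_congr_ae ?_
  filter_upwards [Lp.coeFn_add (S.component 1 u) ((Complex.I * p.1) • S.component 0 u),
    Lp.coeFn_add (S.component 1 v) ((Complex.I * p.1) • S.component 0 v),
    Lp.coeFn_smul (Complex.I * p.1) (S.component 0 u),
    Lp.coeFn_smul (Complex.I * p.1) (S.component 0 v)] with q h1 h2 h3 h4
  rw [h1, h2, Pi.add_apply, Pi.add_apply, h3, h4, Pi.smul_apply, Pi.smul_apply, smul_eq_mul,
    smul_eq_mul]
  simp only [component_apply]
  push_cast
  ring

/-- `inner_smul_right` for the scalar multiplication of the submodule `H¹_per`. -/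
theorem inner_smul_H1per (c : ℂ) (u v : S.H1per) : inner ℂ v (c • u) = c * inner ℂ v u :=
  inner_smul_right (𝕜 := ℂ) (E := S.H1per) v u c

/-- The operator of the form `(2π)⁻¹ ∫_Γ (N u) v̄`. It factors through the weighted traces in `ℓ²`,
which carries the dependence on `(κ, ω)` over to the multiplier in `ℓ^∞`. -/
def dtnOp (p : ℝ × ℝ) : S.H1per →L[ℂ] S.H1per :=
  (-Complex.I) • ((S.traceOpRight.adjoint.comp ((mulOp (S.symbol p)).comp S.traceOpRight))
    + (S.traceOpLeft.adjoint.comp ((mulOp (S.symbol p)).comp S.traceOpLeft)))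

theorem inner_dtnOp (p : ℝ × ℝ) (u v : S.H1per) : inner ℂ v (S.dtnOp p u)
    = -Complex.I * (inner ℂ (S.traceOpRight v) (mulOp (S.symbol p) (S.traceOpRight u))
      + inner ℂ (S.traceOpLeft v) (mulOp (S.symbol p) (S.traceOpLeft u))) := by
  have e : S.dtnOp p u = (-Complex.I) • (S.traceOpRight.adjoint (mulOp (S.symbol p) (S.traceOpRight u))
    + S.traceOpLeft.adjoint (mulOp (S.symbol p) (S.traceOpLeft u))) := rfl
  rw [e, inner_smul_H1per, inner_add_right, ContinuousLinearMap.adjoint_inner_right,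
    ContinuousLinearMap.adjoint_inner_right]

theorem isComplexAnalyticAt_dtnOp {p : ℝ × ℝ} (hp : p ∈ S.diamond) :
    IsComplexAnalyticAt S.dtnOp p := by
  have h : IsComplexAnalyticAt (fun q => mulOp (S.symbol q)) p :=
    (S.isComplexAnalyticAt_symbol hp).clm_comp mulOp
  have hR := h.comp_comp S.traceOpRight.adjoint S.traceOpRight
  have hL := h.comp_comp S.traceOpLeft.adjoint S.traceOpLeft
  exact (IsComplexAnalyticAt.const (-Complex.I)).smul (hR.add hL)

/-- The terms of the series in the form of the Dirichlet-to-Neumann map. -/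
def dtnTerm (p : ℝ × ℝ) (u v : S.H1per) (m : ℤ) : ℂ :=
  (-Complex.I * S.eta p m) *
    (S.traceRight u m * star (S.traceRight v m) + S.traceLeft u m * star (S.traceLeft v m))

theorem dtnTerm_eq (p : ℝ × ℝ) (u v : S.H1per) (m : ℤ) : S.dtnTerm p u v m
    = -Complex.I * (inner ℂ (S.traceOpRight v m) (mulOp (S.symbol p) (S.traceOpRight u) m)
      + inner ℂ (S.traceOpLeft v m) (mulOp (S.symbol p) (S.traceOpLeft u) m)) := by
  have hw : (0 : ℝ) < 1 + |(m : ℝ)| := by positivity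
  have hw' : ((1 + |(m : ℝ)| : ℝ) : ℂ) ≠ 0 := by exact_mod_cast hw.ne'
  have hs : ((√(1 + |(m : ℝ)|) : ℝ) : ℂ) * ((√(1 + |(m : ℝ)|) : ℝ) : ℂ) = ((1 + |(m : ℝ)| : ℝ) : ℂ) := by
    rw [← Complex.ofReal_mul, Real.mul_self_sqrt hw.le]
  rw [mulOp_apply, mulOp_apply, symbol_apply, traceOpRight_apply, traceOpRight_apply,
    traceOpLeft_apply, traceOpLeft_apply, RCLike.inner_apply, RCLike.inner_apply, map_mul, map_mul,
    Complex.conj_ofReal, dtnTerm, Complex.star_def]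
  set w := ((1 + |(m : ℝ)| : ℝ) : ℂ)
  set s := ((√(1 + |(m : ℝ)|) : ℝ) : ℂ)
  field_simp
  rw [show s ^ 2 = w by rw [← hs, sq]]

theorem hasSum_dtnTerm (p : ℝ × ℝ) (u v : S.H1per) :
    HasSum (S.dtnTerm p u v) (inner ℂ v (S.dtnOp p u)) := by
  rw [inner_dtnOp]
  have hR := lp.hasSum_inner (𝕜 := ℂ) (S.traceOpRight v) (mulOp (S.symbol p) (S.traceOpRight u))
  have hL := lp.hasSum_inner (𝕜 := ℂ) (S.traceOpLeft v) (mulOp (S.symbol p) (S.traceOpLeft u))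
  have h := (hR.add hL).mul_left (-Complex.I)
  rw [show S.dtnTerm p u v = _ from funext (S.dtnTerm_eq p u v)]
  exact h

theorem dtnForm_eq (p : ℝ × ℝ) (u v : S.H1per) :
    S.dtnForm p u v = 2 * Real.pi * inner ℂ v (S.dtnOp p u) := by
  rw [← (S.hasSum_dtnTerm p u v).tsum_eq]
  rfl

theorem opOfForm_eq {c : S.H1per → S.H1per → ℂ} {C : S.H1per →L[ℂ] S.H1per}
    (h : ∀ u v, inner ℂ v (C u) = c u v) : S.opOfForm c = C := by
  have hex : ∃ C : S.H1per →L[ℂ] S.H1per, ∀ u v, inner ℂ v (C u) = c u v := ⟨C, h⟩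
  rw [opOfForm, dif_pos hex]
  ext1 u
  refine ext_inner_left ℂ fun v => ?_
  rw [hex.choose_spec, h]

/-- The operator of the form `h + b`, as a polynomial in `κ` up to the boundary term. -/
def formOp (p : ℝ × ℝ) : S.H1per →L[ℂ] S.H1per :=
  S.stiffnessOp 1 1 + S.stiffnessOp 2 2
    + (p.1 : ℂ) • (Complex.I • (S.stiffnessOp 1 0 - S.stiffnessOp 0 1))
    + ((p.1 : ℂ) * p.1) • S.stiffnessOp 0 0 + S.bOp
    + (2 * Real.pi * (S.μ₀⁻¹ : ℂ)) • S.dtnOp p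

theorem inner_formOp (p : ℝ × ℝ) (u v : S.H1per) :
    inner ℂ v (S.formOp p u) = S.hForm p u v + S.bForm u v := by
  rw [formOp, hForm_eq, volumeForm, dtnForm_eq]
  simp only [_root_.add_apply, _root_.smul_apply, _root_.sub_apply, inner_add_right,
    inner_stiffnessOp, inner_bOp, inner_add_left, inner_smul_left, map_add,
    map_mul, Complex.conj_I, Complex.conj_ofReal]
  simp only [inner_smul_H1per, inner_sub_right]
  simp only [inner_stiffnessOp, map_smul, inner_smul_right]
  linear_combination ((p.1 : ℂ) ^ 2 * inner ℂ (S.component 0 v)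
    (S.mulWeight S.memLp_μ_inv (S.component 0 u))) * Complex.I_sq

theorem opC₁_eq (p : ℝ × ℝ) : S.opC₁ p = S.formOp p := S.opOfForm_eq (S.inner_formOp p)

theorem inner_opC₁ (p : ℝ × ℝ) (u v : S.H1per) :
    inner ℂ v (S.opC₁ p u) = S.hForm p u v + S.bForm u v := by
  rw [opC₁_eq, inner_formOp]

theorem opC₂_eq (p : ℝ × ℝ) : S.opC₂ p = (-((p.2 : ℂ) * p.2 + 1)) • S.bOp := by
  refine S.opOfForm_eq fun u v => ?_
  rw [_root_.smul_apply, inner_smul_right, inner_bOp, sq]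

theorem isComplexAnalyticAt_opC₁ {p : ℝ × ℝ} (hp : p ∈ S.diamond) :
    IsComplexAnalyticAt S.opC₁ p := by
  have h1 := IsComplexAnalyticAt.ofReal_fst (p := p)
  have h2 := S.isComplexAnalyticAt_dtnOp hp
  have h := ((((IsComplexAnalyticAt.const (S.stiffnessOp 1 1 + S.stiffnessOp 2 2)).add
    (h1.smul (.const (Complex.I • (S.stiffnessOp 1 0 - S.stiffnessOp 0 1))))).add
    ((h1.mul h1).smul (.const (S.stiffnessOp 0 0)))).add (.const S.bOp)).add
    ((IsComplexAnalyticAt.const (2 * Real.pi * (S.μ₀⁻¹ : ℂ))).smul h2)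
  exact h.congr (.of_forall fun q => (S.opC₁_eq q).symm)

theorem isComplexAnalyticAt_opC₂ (p : ℝ × ℝ) : IsComplexAnalyticAt S.opC₂ p := by
  have h2 := IsComplexAnalyticAt.ofReal_snd (p := p)
  refine IsComplexAnalyticAt.congr ((((h2.mul h2).add (.const 1)).const_mul (-1)).smul (.const S.bOp))
    (.of_forall fun q => ?_)
  simp only [opC₂_eq, neg_one_mul]

theorem re_dtnForm_nonneg (p : ℝ × ℝ) (u : S.H1per) : 0 ≤ (S.dtnForm p u u).re := by
  have h := Complex.reCLM.hasSum (S.hasSum_dtnTerm p u u)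
  have h0 : 0 ≤ (inner ℂ u (S.dtnOp p u)).re := by
    refine h.nonneg fun m => ?_
    simp only [dtnTerm, Complex.star_def, Complex.mul_conj', Complex.reCLM_apply]
    rw [← Complex.ofReal_pow, ← Complex.ofReal_pow, ← Complex.ofReal_add, Complex.re_mul_ofReal]
    refine mul_nonneg ?_ (by positivity)
    simpa using S.eta_im_nonneg p m
  rw [dtnForm_eq]
  have e : (2 * Real.pi : ℂ) = ((2 * Real.pi : ℝ) : ℂ) := by push_cast; rfl
  rw [e, Complex.re_ofReal_mul]
  exact mul_nonneg (by positivity) h0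

/-- The form `h + b` is coercive: the boundary term has a nonnegative real part because
`Im η_m ≥ 0`, and `|κ| < 1/2` keeps the shifted gradient under control. -/
theorem exists_le_re_inner_opC₁ {p : ℝ × ℝ} (hp : |p.1| < 1 / 2) :
    ∃ c > 0, ∀ u, c * ‖u‖ ^ 2 ≤ (inner ℂ u (S.opC₁ p u)).re := by
  obtain ⟨m, M, hm, h⟩ := S.bounds_ε
  obtain ⟨m', M', hm', h'⟩ := S.bounds_μ
  have hM' : 0 < M' := (hm'.trans (h' 0).1).trans (h' 0).2
  refine ⟨min m M'⁻¹ / 2, by positivity, fun u => ?_⟩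
  set c := min m M'⁻¹ with hc
  have hc0 : 0 < c := by positivity
  have hε := S.le_re_inner_mulWeight S.memLp_ε (c := c) (fun p => (min_le_left _ _).trans (h p).1.le)
  have hμ := S.le_re_inner_mulWeight S.memLp_μ_inv (c := c)
    (fun p => (min_le_right _ _).trans (inv_anti₀ (hm'.trans (h' p).1) (h' p).2.le))
  have h1 := hε (S.component 0 u)
  have h2 := hμ (S.component 1 u + (Complex.I * p.1) • S.component 0 u)
  have h3 := hμ (S.component 2 u)
  have h4 : 0 ≤ ((S.μ₀⁻¹ : ℂ) * S.dtnForm p u u).re := by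
    rw [← Complex.ofReal_inv, Complex.re_ofReal_mul]
    exact mul_nonneg (inv_nonneg.2 S.μ₀_pos.le) (S.re_dtnForm_nonneg p u)
  have h5 : ‖S.component 1 u‖ ≤ ‖S.component 1 u + (Complex.I * p.1) • S.component 0 u‖
      + 1 / 2 * ‖S.component 0 u‖ := by
    have e : S.component 1 u = (S.component 1 u + (Complex.I * p.1) • S.component 0 u)
      - (Complex.I * p.1) • S.component 0 u := by abel
    conv_lhs => rw [e]
    refine (norm_sub_le _ _).trans (add_le_add le_rfl ?_)
    rw [norm_smul, norm_mul, Complex.norm_I, one_mul, Complex.norm_real, Real.norm_eq_abs]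
    gcongr
  have h6 : ‖S.component 1 u‖ ^ 2 ≤ 2 * ‖S.component 1 u + (Complex.I * p.1) • S.component 0 u‖ ^ 2
      + 1 / 2 * ‖S.component 0 u‖ ^ 2 := by
    refine (pow_le_pow_left₀ (norm_nonneg _) h5 2).trans ?_
    nlinarith [sq_nonneg (‖S.component 1 u + (Complex.I * p.1) • S.component 0 u‖
      - 1 / 2 * ‖S.component 0 u‖)]
  have hb : S.bForm u u = inner ℂ (S.component 0 u) (S.mulWeight S.memLp_ε (S.component 0 u)) := by
    rw [inner_mulWeight]; rfl
  rw [inner_opC₁, hForm_eq, volumeForm, hb, Complex.add_re, Complex.add_re, Complex.add_re,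
    S.norm_sq_eq u]
  nlinarith [mul_le_mul_of_nonneg_left h6 hc0.le, mul_nonneg hc0.le (sq_nonneg ‖S.component 2 u‖),
    mul_nonneg hc0.le (sq_nonneg ‖S.component 0 u‖)]

theorem isUnit_opC₁ {p : ℝ × ℝ} (hp : |p.1| < 1 / 2) : IsUnit (S.opC₁ p) := by
  obtain ⟨c, hc, h⟩ := S.exists_le_re_inner_opC₁ hp
  refine ContinuousLinearMap.isUnit_of_forall_le_norm_inner_map _ (c := ⟨c, hc.le⟩) hc fun u => ?_
  rw [← inner_conj_symm, RCLike.norm_conj, mul_comm]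
  exact (h u).trans (Complex.re_le_norm _)

theorem isCompactOperator_bOp : IsCompactOperator S.bOp := by
  have h1 := S.isCompactOperator_component_zero.clm_comp
    ((S.component 0).adjoint.comp (S.mulWeight S.memLp_ε))
  exact h1

theorem eq_zero_of_bOp {u : S.H1per} (h : S.bOp u = 0) : u = 0 := by
  obtain ⟨m, M, hm, hb⟩ := S.bounds_ε
  refine S.eq_zero_of_component_zero ?_
  have h1 := S.le_re_inner_mulWeight S.memLp_ε (fun p => (hb p).1.le) (S.component 0 u)
  have h2 : inner ℂ (S.component 0 u) (S.mulWeight S.memLp_ε (S.component 0 u)) = 0 := by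
    have := S.inner_bOp u u
    rw [h, inner_zero_right] at this
    rw [inner_mulWeight]
    exact this.symm
  rw [h2, Complex.zero_re] at h1
  have h3 : ‖S.component 0 u‖ ^ 2 ≤ 0 := by
    by_contra h4
    nlinarith [not_le.1 h4]
  exact norm_eq_zero.1 (pow_eq_zero_iff two_ne_zero |>.1 (le_antisymm h3 (sq_nonneg _)))

/-- The operator `C₁⁻¹ C₂`. -/
def compactPart (p : ℝ × ℝ) : S.H1per →L[ℂ] S.H1per := Ring.inverse (S.opC₁ p) * S.opC₂ p

theorem opA_eq (p : ℝ × ℝ) : S.opA p = 1 + S.compactPart p := rfl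

theorem isCompactOperator_compactPart (p : ℝ × ℝ) : IsCompactOperator (S.compactPart p) := by
  have h1 : IsCompactOperator (S.opC₂ p) := by
    rw [opC₂_eq]
    exact S.isCompactOperator_bOp.smul (-((p.2 : ℂ) * p.2 + 1) : ℂ)
  exact h1.clm_comp (Ring.inverse (S.opC₁ p))

theorem eq_zero_of_compactPart {p : ℝ × ℝ} (hp : |p.1| < 1 / 2) {u : S.H1per}
    (h : S.compactPart p u = 0) : u = 0 := by
  have h1 : S.opC₁ p (S.compactPart p u) = S.opC₂ p u :=
    apply_ringInverse (S.isUnit_opC₁ hp) (S.opC₂ p u)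
  rw [h, map_zero, opC₂_eq, _root_.smul_apply, eq_comm, smul_eq_zero] at h1
  rcases h1 with h1 | h1
  · exfalso
    have h2 : (p.2 * p.2 + 1 : ℝ) ≠ 0 := (by nlinarith [mul_self_nonneg p.2] : (0 : ℝ) < _).ne'
    refine h2 ?_
    have h3 := neg_eq_zero.1 h1
    exact_mod_cast h3
  · exact S.eq_zero_of_bOp h1

theorem isComplexAnalyticAt_opA {p : ℝ × ℝ} (hp : p ∈ S.diamond) :
    IsComplexAnalyticAt S.opA p := by
  have h1 : IsComplexAnalyticAt (fun q => Ring.inverse (S.opC₁ q)) p :=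
    IsComplexAnalyticAt.inverse (𝒜 := S.H1per →L[ℂ] S.H1per) (S.isComplexAnalyticAt_opC₁ hp)
      (S.isUnit_opC₁ hp.1)
  have h2 : IsComplexAnalyticAt (fun q => Ring.inverse (S.opC₁ q) * S.opC₂ q) p :=
    IsComplexAnalyticAt.mul (𝒜 := S.H1per →L[ℂ] S.H1per) h1 (S.isComplexAnalyticAt_opC₂ p)
  exact (IsComplexAnalyticAt.const (1 : S.H1per →L[ℂ] S.H1per)).add h2

/-- The form `h - ω² b` of the scattering problem. -/
def scatteringForm (p : ℝ × ℝ) (u v : S.H1per) : ℂ := S.hForm p u v - (p.2 : ℂ) ^ 2 * S.bForm u v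

theorem inner_opC₁_opA {p : ℝ × ℝ} (hp : |p.1| < 1 / 2) (u v : S.H1per) :
    inner ℂ v (S.opC₁ p (S.opA p u)) = S.scatteringForm p u v := by
  have h1 : S.opC₁ p (S.compactPart p u) = S.opC₂ p u :=
    apply_ringInverse (S.isUnit_opC₁ hp) (S.opC₂ p u)
  rw [opA_eq, _root_.add_apply, map_add, h1, inner_add_right, opC₂_eq, _root_.smul_apply,
    inner_smul_right, inner_bOp]
  rw [show (1 : S.H1per →L[ℂ] S.H1per) u = u from rfl, inner_opC₁, scatteringForm]
  ring

end PeriodicSlab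

/-! ### Conservation of energy, guided modes and the scattering problem -/

namespace PeriodicSlab

variable (S : PeriodicSlab)

theorem mul_sqrt_sq (p : ℝ × ℝ) : S.ε₀ * S.μ₀ * p.2 ^ 2 = (p.2 * √(S.ε₀ * S.μ₀)) ^ 2 := by
  rw [mul_pow, Real.sq_sqrt (mul_pos S.ε₀_pos S.μ₀_pos).le, mul_comm]

/-- In the diamond the order `m = 0` propagates. -/
theorem eta_zero_eq {p : ℝ × ℝ} (hp : p ∈ S.diamond) :
    ∃ a : ℝ, 0 < a ∧ S.eta p 0 = a := by
  obtain ⟨-, h1, -⟩ := hp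
  have h : 0 < S.ε₀ * S.μ₀ * p.2 ^ 2 - (((0 : ℤ) : ℝ) + p.1) ^ 2 := by
    rw [mul_sqrt_sq, Int.cast_zero, zero_add, sub_pos, sq_lt_sq]
    exact h1.trans_le (le_abs_self _)
  exact ⟨_, Real.sqrt_pos.2 h, by rw [eta, if_pos h.le]⟩

/-- In the diamond all orders `m ≠ 0` are evanescent. -/
theorem eta_eq_I_mul {p : ℝ × ℝ} (hp : p ∈ S.diamond) {m : ℤ} (hm : m ≠ 0) :
    ∃ a : ℝ, S.eta p m = Complex.I * a := by
  obtain ⟨-, h1, h2⟩ := hp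
  have hm1 : 1 ≤ |(m : ℝ)| := by exact_mod_cast Int.one_le_abs hm
  have h3 : |(m : ℝ)| - |p.1| ≤ |(m : ℝ) + p.1| := by
    have := abs_sub_abs_le_abs_sub (m : ℝ) (-p.1)
    rwa [abs_neg, sub_neg_eq_add] at this
  have h : ¬ 0 ≤ S.ε₀ * S.μ₀ * p.2 ^ 2 - ((m : ℝ) + p.1) ^ 2 := by
    rw [mul_sqrt_sq, sub_nonneg, not_le, sq_lt_sq, abs_of_pos ((abs_nonneg _).trans_lt h1)]
    linarith
  exact ⟨_, by rw [eta, if_neg h]⟩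

/-- The constant `-2 i η₀ (2π / μ₀)` in the energy identity. -/
def fluxConst (p : ℝ × ℝ) : ℂ := -2 * Complex.I * S.eta p 0 * (2 * Real.pi * (S.μ₀⁻¹ : ℂ))

theorem star_fluxConst {p : ℝ × ℝ} (hp : p ∈ S.diamond) :
    star (S.fluxConst p) = -S.fluxConst p := by
  obtain ⟨a, -, ha⟩ := S.eta_zero_eq hp
  rw [fluxConst, ha]
  simp

theorem fluxConst_ne_zero {p : ℝ × ℝ} (hp : p ∈ S.diamond) : S.fluxConst p ≠ 0 := by
  obtain ⟨a, h0, ha⟩ := S.eta_zero_eq hp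
  rw [fluxConst, ha]
  have h1 := S.μ₀_pos.ne'
  have h2 := h0.ne'
  have h3 := Real.pi_ne_zero
  simp [h1, h2, h3]

theorem star_volumeForm (κ : ℝ) (u v : S.H1per) :
    star (S.volumeForm κ v u) = S.volumeForm κ u v := by
  rw [volumeForm, star_add, star_inner_mulWeight, star_inner_mulWeight, ← volumeForm]

theorem bForm_eq (u v : S.H1per) : S.bForm u v
    = inner ℂ (S.component 0 v) (S.mulWeight S.memLp_ε (S.component 0 u)) := by
  rw [inner_mulWeight]; rfl

theorem star_bForm (u v : S.H1per) : star (S.bForm v u) = S.bForm u v := by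
  rw [bForm_eq, star_inner_mulWeight, ← bForm_eq]

theorem dtnForm_sub_star {p : ℝ × ℝ} (hp : p ∈ S.diamond) (u v : S.H1per) :
    S.dtnForm p u v - star (S.dtnForm p v u)
      = 2 * Real.pi * (-2 * Complex.I * S.eta p 0 *
        (S.traceRight u 0 * star (S.traceRight v 0) + S.traceLeft u 0 * star (S.traceLeft v 0))) := by
  have h1 := (S.hasSum_dtnTerm p u v).sub (S.hasSum_dtnTerm p v u).star
  have h2 : ∀ m : ℤ, m ≠ 0 → S.dtnTerm p u v m - star (S.dtnTerm p v u m) = 0 := by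
    intro m hm
    obtain ⟨a, ha⟩ := S.eta_eq_I_mul hp hm
    rw [dtnTerm, dtnTerm, ha]
    simp only [star_mul', star_add, star_neg, Complex.star_def, Complex.conj_I,
      Complex.conj_ofReal, Complex.conj_conj]
    ring
  have h3 := h1.unique (hasSum_single 0 h2)
  rw [dtnForm_eq, dtnForm_eq, star_mul', show star (2 * (Real.pi : ℂ)) = 2 * Real.pi by simp,
    ← mul_sub, h3]
  obtain ⟨a, -, ha⟩ := S.eta_zero_eq hp
  rw [dtnTerm, dtnTerm, ha]
  simp only [star_mul', star_add, star_neg, Complex.star_def, Complex.conj_I,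
    Complex.conj_ofReal, Complex.conj_conj]
  ring

/-- The energy identity: the antihermitian part of the form comes from the propagating order. -/
theorem scatteringForm_sub_star {p : ℝ × ℝ} (hp : p ∈ S.diamond) (u v : S.H1per) :
    S.scatteringForm p u v - star (S.scatteringForm p v u) = S.fluxConst p *
      (S.traceRight u 0 * star (S.traceRight v 0) + S.traceLeft u 0 * star (S.traceLeft v 0)) := by
  have h := S.dtnForm_sub_star hp u v
  have h1 : star ((p.2 : ℂ) ^ 2) = (p.2 : ℂ) ^ 2 := by simp
  have h2 : star ((S.μ₀ : ℂ)⁻¹) = (S.μ₀ : ℂ)⁻¹ := by simp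
  rw [scatteringForm, scatteringForm, hForm_eq, hForm_eq, star_sub, star_add, star_mul', star_mul',
    star_volumeForm, star_bForm, h1, h2, fluxConst]
  linear_combination (S.μ₀ : ℂ)⁻¹ * h

theorem eq_zero_and_eq_zero_of_mul_star_add {a b : ℂ} (h : a * star a + b * star b = 0) :
    a = 0 ∧ b = 0 := by
  rw [Complex.star_def, Complex.mul_conj, Complex.mul_conj, ← Complex.ofReal_add,
    Complex.ofReal_eq_zero, add_eq_zero_iff_of_nonneg (Complex.normSq_nonneg _)
      (Complex.normSq_nonneg _)] at h
  exact ⟨Complex.normSq_eq_zero.1 h.1, Complex.normSq_eq_zero.1 h.2⟩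

/-- A guided mode has no component in the propagating order. -/
theorem trace_eq_zero_of_opA {p : ℝ × ℝ} (hp : p ∈ S.diamond) {v : S.H1per} (hv : S.opA p v = 0) :
    S.traceRight v 0 = 0 ∧ S.traceLeft v 0 = 0 := by
  have h := S.scatteringForm_sub_star hp v v
  rw [← S.inner_opC₁_opA hp.1, hv, map_zero, inner_zero_right, star_zero, sub_zero, eq_comm,
    mul_eq_zero] at h
  exact eq_zero_and_eq_zero_of_mul_star_add (h.resolve_left (S.fluxConst_ne_zero hp))

/-- A guided mode also solves the adjoint problem. -/
theorem scatteringForm_eq_zero_of_opA {p : ℝ × ℝ} (hp : p ∈ S.diamond) {v : S.H1per}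
    (hv : S.opA p v = 0) (w : S.H1per) : S.scatteringForm p w v = 0 := by
  have h := S.scatteringForm_sub_star hp w v
  obtain ⟨h1, h2⟩ := S.trace_eq_zero_of_opA hp hv
  rwa [h1, h2, ← S.inner_opC₁_opA hp.1 v w, hv, map_zero, inner_zero_right, star_zero, sub_zero,
    mul_zero, mul_zero, add_zero, mul_zero] at h

theorem im_scatteringForm_eq_zero {p : ℝ × ℝ} (hp : p ∈ S.diamond) {u : S.H1per}
    (hR : S.traceRight u 0 = 0) (hL : S.traceLeft u 0 = 0) : (S.scatteringForm p u u).im = 0 := by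
  have h := S.scatteringForm_sub_star hp u u
  rw [hR, hL, zero_mul, add_zero, mul_zero, sub_eq_zero, Complex.star_def] at h
  exact Complex.conj_eq_iff_im.1 h.symm

/-! ### Symmetry -/

theorem inner_mulWeight_reflect {w : ℝ × ℝ → ℝ}
    (hw : MemLp (fun p => (w p : ℂ)) ⊤ (volume.restrict S.cell))
    (hs : ∀ p : ℝ × ℝ, w (p.1, -p.2) = w p) (f g : S.L2) :
    inner ℂ (S.reflectL2 g) (S.mulWeight hw (S.reflectL2 f)) = inner ℂ g (S.mulWeight hw f) := by
  rw [inner_mulWeight, inner_mulWeight,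
    ← S.integral_reflect fun p => (w p : ℂ) * (f p * star (g p))]
  refine integral_congr_ae ?_
  filter_upwards [S.reflectL2_ae f, S.reflectL2_ae g] with p h1 h2
  rw [h1, h2, hs]

variable {S} in
theorem IsSymmetric.scatteringForm_reflect (hS : S.IsSymmetric) (p : ℝ × ℝ) (u v : S.H1per) :
    S.scatteringForm p (S.reflect u) (S.reflect v) = S.scatteringForm p u v := by
  have hε := S.inner_mulWeight_reflect S.memLp_ε fun p => (hS p.1 p.2).1
  have hμ := S.inner_mulWeight_reflect S.memLp_μ_inv fun p => congrArg Inv.inv (hS p.1 p.2).2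
  obtain ⟨u0, u1, u2⟩ := S.component_reflect u
  obtain ⟨v0, v1, v2⟩ := S.component_reflect v
  have hd : S.dtnForm p (S.reflect u) (S.reflect v) = S.dtnForm p u v := by
    simp only [dtnForm, traceRight_reflect, traceLeft_reflect, add_comm]
  rw [scatteringForm, scatteringForm, hForm_eq, hForm_eq, hd, bForm_eq, bForm_eq, volumeForm,
    volumeForm, u0, u1, u2, v0, v1, v2, hε, map_neg, inner_neg_neg, hμ, ← map_smul S.reflectL2,
    ← map_smul S.reflectL2, ← map_add S.reflectL2, ← map_add S.reflectL2, hμ]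

/-! ### The source and the solutions -/

/-- The phase factor `e^{-iη₀L}`. -/
def phase (p : ℝ × ℝ) : ℂ := Complex.exp (-Complex.I * S.eta p 0 * S.L)

theorem isComplexAnalyticAt_phase {p : ℝ × ℝ} (hp : p ∈ S.diamond) :
    IsComplexAnalyticAt S.phase p := by
  have h := ((S.isComplexAnalyticAt_eta hp).const_mul (-Complex.I * S.L))
  have h1 := IsComplexAnalyticAt.comp (Φ := Complex.exp) analyticAt_cexp h
  refine h1.congr (.of_forall fun q => ?_)
  simp only [phase]
  congr 1
  ring

theorem phase_mul_star {p : ℝ × ℝ} (hp : p ∈ S.diamond) : S.phase p * star (S.phase p) = 1 := by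
  obtain ⟨a, -, ha⟩ := S.eta_zero_eq hp
  rw [phase, Complex.star_def, ← Complex.exp_conj, ← Complex.exp_add, ha]
  simp

theorem sourceForm_eq (p : ℝ × ℝ) (v : S.H1per) :
    S.sourceForm p v = S.fluxConst p * S.phase p * star (S.traceLeft v 0) := by
  rw [sourceForm, fluxConst, phase]
  ring

theorem refl_eq (p : ℝ × ℝ) :
    S.refl p = S.phase p * (S.traceLeft (S.scatteringSolution p) 0 - S.phase p) := rfl

theorem trans_eq (p : ℝ × ℝ) :
    S.trans p = S.phase p * S.traceRight (S.scatteringSolution p) 0 := rfl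

/-- The zeroth Fourier coefficient on `z = L` as a functional. -/
def meanRight : S.H1per →L[ℂ] ℂ := (lp.evalCLM ℂ (fun _ : ℤ => ℂ) 2 0).comp S.traceOpRight

/-- The zeroth Fourier coefficient on `z = -L` as a functional. -/
def meanLeft : S.H1per →L[ℂ] ℂ := (lp.evalCLM ℂ (fun _ : ℤ => ℂ) 2 0).comp S.traceOpLeft

theorem meanRight_apply (u : S.H1per) : S.meanRight u = S.traceRight u 0 := by
  refine (S.traceOpRight_apply u 0).trans ?_
  simp

theorem meanLeft_apply (u : S.H1per) : S.meanLeft u = S.traceLeft u 0 := by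
  refine (S.traceOpLeft_apply u 0).trans ?_
  simp

/-- The right-hand side of the scattering problem in the form `A u = g`. -/
def source (p : ℝ × ℝ) : S.H1per :=
  Ring.inverse (S.opC₁ p)
    ((S.fluxConst p * S.phase p) • (InnerProductSpace.toDual ℂ S.H1per).symm S.meanLeft)

theorem inner_opC₁_source {p : ℝ × ℝ} (hp : |p.1| < 1 / 2) (v : S.H1per) :
    inner ℂ v (S.opC₁ p (S.source p)) = S.sourceForm p v := by
  rw [source, apply_ringInverse (S.isUnit_opC₁ hp), inner_smul_H1per, sourceForm_eq,
    ← inner_conj_symm (𝕜 := ℂ) (E := S.H1per), InnerProductSpace.toDual_symm_apply, meanLeft_apply]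
  rfl

theorem isScatteringSolution_iff {p : ℝ × ℝ} (hp : |p.1| < 1 / 2) (u : S.H1per) :
    S.IsScatteringSolution p u ↔ S.opA p u = S.source p := by
  refine ⟨fun h => ?_, fun h v => ?_⟩
  · have h1 : S.opC₁ p (S.opA p u) = S.opC₁ p (S.source p) := by
      refine ext_inner_left ℂ fun v => ?_
      rw [inner_opC₁_source S hp, inner_opC₁_opA S hp]
      exact h v
    rw [← ringInverse_apply_self (S.isUnit_opC₁ hp) (S.opA p u), h1,
      ringInverse_apply_self (S.isUnit_opC₁ hp)]
  · rw [← inner_opC₁_source S hp, ← h, inner_opC₁_opA S hp, scatteringForm]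

theorem isComplexAnalyticAt_source {p : ℝ × ℝ} (hp : p ∈ S.diamond) :
    IsComplexAnalyticAt S.source p := by
  have h1 : IsComplexAnalyticAt (fun q => Ring.inverse (S.opC₁ q)) p :=
    IsComplexAnalyticAt.inverse (𝒜 := S.H1per →L[ℂ] S.H1per) (S.isComplexAnalyticAt_opC₁ hp)
      (S.isUnit_opC₁ hp.1)
  have h2 : IsComplexAnalyticAt S.fluxConst p :=
    (((S.isComplexAnalyticAt_eta hp).const_mul (-2 * Complex.I)).mul (.const _))
  exact h1.clm_apply ((h2.mul (S.isComplexAnalyticAt_phase hp)).smul (.const _))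

section Solution

variable {S} {p : ℝ × ℝ} {u : S.H1per}

/-- Conservation of energy `|R|² + |T|² = 1`: the energy identity for `u` with itself. -/
theorem IsScatteringSolution.norm_sq_add (hp : p ∈ S.diamond) (hu : S.IsScatteringSolution p u) :
    ‖S.phase p * (S.traceLeft u 0 - S.phase p)‖ ^ 2 + ‖S.phase p * S.traceRight u 0‖ ^ 2 = 1 := by
  have h := S.scatteringForm_sub_star hp u u
  have h0 : S.scatteringForm p u u = _ := (hu u).trans (S.sourceForm_eq p u)
  rw [h0, star_mul', star_mul', star_star, S.star_fluxConst hp] at h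
  have h1 := mul_left_cancel₀ (S.fluxConst_ne_zero hp) (b := S.phase p * star (S.traceLeft u 0)
    + star (S.phase p) * S.traceLeft u 0) (Eq.trans (by ring) h)
  have h2 := S.phase_mul_star hp
  have h3 : ∀ z : ℂ, ((‖z‖ ^ 2 : ℝ) : ℂ) = z * star z := fun z => by
    rw [Complex.star_def, Complex.mul_conj']; push_cast; rfl
  have h4 : ((‖S.phase p * (S.traceLeft u 0 - S.phase p)‖ ^ 2
      + ‖S.phase p * S.traceRight u 0‖ ^ 2 : ℝ) : ℂ) = 1 := by
    rw [Complex.ofReal_add, h3, h3, star_mul', star_mul', star_sub]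
    linear_combination ((S.traceLeft u 0 - S.phase p) * (star (S.traceLeft u 0) - star (S.phase p))
      + S.traceRight u 0 * star (S.traceRight u 0)) * h2 - h1 + h2
  exact_mod_cast h4

/-- The phase relation `Re(R T̄) = 0`: the energy identity for `u` with its mirror image. -/
theorem IsScatteringSolution.re_mul_star (hS : S.IsSymmetric) (hp : p ∈ S.diamond)
    (hu : S.IsScatteringSolution p u) :
    (S.phase p * (S.traceLeft u 0 - S.phase p) * star (S.phase p * S.traceRight u 0)).re = 0 := by
  have h := S.scatteringForm_sub_star hp u (S.reflect u)
  have h0 : S.scatteringForm p u (S.reflect u) = _ :=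
    (hu (S.reflect u)).trans (S.sourceForm_eq p (S.reflect u))
  have h5 : S.scatteringForm p (S.reflect u) u = S.scatteringForm p u (S.reflect u) := by
    rw [← hS.scatteringForm_reflect p (S.reflect u) u, reflect_reflect]
  rw [h5, h0, star_mul', star_mul', star_star, S.star_fluxConst hp, traceLeft_reflect,
    traceRight_reflect] at h
  have h1 := mul_left_cancel₀ (S.fluxConst_ne_zero hp) (b := S.phase p * star (S.traceRight u 0)
    + star (S.phase p) * S.traceRight u 0) (Eq.trans (by ring) h)
  have h2 := S.phase_mul_star hp
  set z := S.phase p * (S.traceLeft u 0 - S.phase p) * star (S.phase p * S.traceRight u 0) with hz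
  have h4 : z + star z = 0 := by
    simp only [hz, star_mul', star_sub, star_star]
    linear_combination ((S.traceLeft u 0 - S.phase p) * star (S.traceRight u 0)
      + (star (S.traceLeft u 0) - star (S.phase p)) * S.traceRight u 0) * h2 - h1
  have h6 := congrArg Complex.re h4
  rw [Complex.add_re, Complex.star_def, Complex.conj_re, Complex.zero_re] at h6
  linarith

end Solution

end PeriodicSlab

/-! ### The eigenvalue branch and the scattering coefficients -/

namespace PeriodicSlab

variable {S : PeriodicSlab} {U : Set (ℝ × ℝ)} {lam : ℝ × ℝ → ℂ} {p : ℝ × ℝ}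

theorem IsSimpleEigenvalueBranch.exists_borderedOp (hlam : S.IsSimpleEigenvalueBranch U lam)
    (hUD : U ⊆ S.diamond) (hp : p ∈ U) :
    ∃ (u : S.H1per) (φ : S.H1per →L[ℂ] ℂ), S.opA p u = lam p • u ∧ φ u = 1 ∧
      IsUnit (borderedOp (S.opA p) φ u (lam p)) :=
  exists_isUnit_borderedOp (S.isCompactOperator_compactPart p)
    (fun _ h => S.eq_zero_of_compactPart (hUD hp).1 h) (hlam.simple p hp)

theorem IsSimpleEigenvalueBranch.exists_eigenvector (hlam : S.IsSimpleEigenvalueBranch U lam)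
    (hUD : U ⊆ S.diamond) (hp : p ∈ U) : ∃ v ≠ 0, S.opA p v = lam p • v := by
  obtain ⟨u, φ, h1, h2, -⟩ := hlam.exists_borderedOp hUD hp
  exact ⟨u, fun h => by rw [h, map_zero] at h2; exact zero_ne_one h2, h1⟩

theorem IsSimpleEigenvalueBranch.analytic (hlam : S.IsSimpleEigenvalueBranch U lam) (hU : IsOpen U)
    (hUD : U ⊆ S.diamond) (hp : p ∈ U) : IsComplexAnalyticAt lam p := by
  obtain ⟨u, φ, h1, h2, h3⟩ := hlam.exists_borderedOp hUD hp
  refine (S.isComplexAnalyticAt_opA (hUD hp)).eigenvalue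
    (hlam.continuousOn.continuousAt (hU.mem_nhds hp)) ?_ h1 h2 h3
  filter_upwards [hU.mem_nhds hp] with q hq
  exact hlam.exists_eigenvector hUD hq

theorem IsSimpleEigenvalueBranch.exists_simpleZeroEigenvalue
    (hlam : S.IsSimpleEigenvalueBranch U lam) (hU : IsOpen U) (hUD : U ⊆ S.diamond) (hp : p ∈ U)
    (h0 : lam p = 0) : ∃ (u : S.H1per) (φ : S.H1per →L[ℂ] ℂ),
      SimpleZeroEigenvalue S.opA lam p u φ := by
  obtain ⟨u, φ, h1, h2, h3⟩ := hlam.exists_borderedOp hUD hp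
  rw [h0, zero_smul] at h1
  rw [h0] at h3
  refine ⟨u, φ, S.isComplexAnalyticAt_opA (hUD hp), hlam.analytic hU hUD hp, ?_, h0, h1, h2, h3⟩
  filter_upwards [hU.mem_nhds hp] with q hq
  exact hlam.exists_eigenvector hUD hq

/-- Away from the zeros of the eigenvalue branch the Fredholm alternative gives unique solutions. -/
theorem IsSimpleEigenvalueBranch.isUnit_opA (hlam : S.IsSimpleEigenvalueBranch U lam) (hp : p ∈ U)
    (h0 : lam p ≠ 0) : IsUnit (S.opA p) := by
  have h := (S.isCompactOperator_compactPart p).isUnit_smul_one_add one_ne_zero fun v hv => ?_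
  · rwa [one_smul, ← opA_eq] at h
  · by_contra hv0
    refine h0 (hlam.unique p hp ?_)
    refine Module.End.hasEigenvalue_of_hasEigenvector
      (x := v) (Module.End.hasEigenvector_iff.2 ⟨Module.End.mem_eigenspace_iff.2 ?_, hv0⟩)
    rw [zero_smul]
    rw [one_smul] at hv
    exact hv

theorem inner_opC₁_ne_zero (hp : |p.1| < 1 / 2) {u : S.H1per} (hu : u ≠ 0) :
    inner ℂ u (S.opC₁ p u) ≠ 0 := by
  obtain ⟨c, hc, h⟩ := S.exists_le_re_inner_opC₁ hp
  intro h0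
  have h1 := h u
  rw [h0, Complex.zero_re] at h1
  have := norm_pos_iff.2 hu
  exact absurd h1 (not_le.2 (by positivity))

/-- At a guided-mode pair the scattering problem is solvable, because the source is orthogonal to
the guided mode, which also spans the kernel of the adjoint problem. -/
theorem IsSimpleEigenvalueBranch.exists_solution_of_eq_zero
    (hlam : S.IsSimpleEigenvalueBranch U lam) (hUD : U ⊆ S.diamond) (hp : p ∈ U) (h0 : lam p = 0) :
    ∃ y, S.opA p y = S.source p := by
  obtain ⟨u, φ, h1, h2, h3⟩ := hlam.exists_borderedOp hUD hp
  have hu : u ≠ 0 := fun h => by rw [h, map_zero] at h2; exact zero_ne_one h2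
  have hD := hUD hp
  rw [h0, zero_smul] at h1
  rw [h0] at h3
  set y := Ring.inverse (borderedOp (S.opA p) φ u 0) (S.source p)
  have hy : S.opA p y = S.source p - φ y • u := apply_eq_sub_smul h3 _
  have h4 : inner ℂ u (S.opC₁ p (S.opA p y)) = 0 := by
    rw [S.inner_opC₁_opA hD.1]
    exact S.scatteringForm_eq_zero_of_opA hD h1 y
  have h5 : inner ℂ u (S.opC₁ p (S.source p)) = 0 := by
    rw [S.inner_opC₁_source hD.1, sourceForm_eq, (S.trace_eq_zero_of_opA hD h1).2, star_zero,
      mul_zero]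
  rw [hy, map_sub, map_smul, inner_sub_right, inner_smul_H1per, h5, zero_sub, neg_eq_zero,
    mul_eq_zero] at h4
  have h6 := h4.resolve_right (inner_opC₁_ne_zero hD.1 hu)
  exact ⟨y, by rw [hy, h6, zero_smul, sub_zero]⟩

theorem IsSimpleEigenvalueBranch.isScatteringSolution (hlam : S.IsSimpleEigenvalueBranch U lam)
    (hUD : U ⊆ S.diamond) (hp : p ∈ U) : S.IsScatteringSolution p (S.scatteringSolution p) := by
  have hex : ∃ u, S.IsScatteringSolution p u := by
    simp only [S.isScatteringSolution_iff (hUD hp).1]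
    by_cases h0 : lam p = 0
    · exact hlam.exists_solution_of_eq_zero hUD hp h0
    · exact ⟨_, apply_ringInverse (hlam.isUnit_opA hp h0) _⟩
  rw [scatteringSolution, dif_pos hex]
  exact hex.choose_spec

theorem IsSimpleEigenvalueBranch.opA_scatteringSolution (hlam : S.IsSimpleEigenvalueBranch U lam)
    (hUD : U ⊆ S.diamond) (hp : p ∈ U) : S.opA p (S.scatteringSolution p) = S.source p :=
  (S.isScatteringSolution_iff (hUD hp).1 _).1 (hlam.isScatteringSolution hUD hp)

/-- `lam τ(u)` is analytic for the solution `u` of the scattering problem and a functional `τ` that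
vanishes on guided modes. -/
theorem IsSimpleEigenvalueBranch.analytic_mul (hlam : S.IsSimpleEigenvalueBranch U lam)
    (hU : IsOpen U) (hUD : U ⊆ S.diamond) (hp : p ∈ U) {τ : S.H1per →L[ℂ] ℂ}
    (hτ : ∀ q ∈ U, ∀ v, S.opA q v = 0 → τ v = 0) :
    IsComplexAnalyticAt (fun q => lam q * τ (S.scatteringSolution q)) p := by
  have hsource := S.isComplexAnalyticAt_source (hUD hp)
  have han := hlam.analytic hU hUD hp
  by_cases h0 : lam p = 0
  · obtain ⟨u, φ, h⟩ := hlam.exists_simpleZeroEigenvalue hU hUD hp h0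
    refine h.analytic_mul_solution hsource ?_ ?_
    · filter_upwards [hU.mem_nhds hp] with q hq using hτ q hq
    · filter_upwards [hU.mem_nhds hp] with q hq
      exact fun _ => hlam.opA_scatteringSolution hUD hq
  · have h1 : IsComplexAnalyticAt (fun q => Ring.inverse (S.opA q)) p :=
      IsComplexAnalyticAt.inverse (𝒜 := S.H1per →L[ℂ] S.H1per) (S.isComplexAnalyticAt_opA (hUD hp))
        (hlam.isUnit_opA hp h0)
    refine (han.mul ((h1.clm_apply hsource).clm_comp τ)).congr ?_
    filter_upwards [hU.mem_nhds hp, han.continuousAt.eventually_ne h0] with q hq hq0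
    rw [← hlam.opA_scatteringSolution hUD hq, ringInverse_apply_self (hlam.isUnit_opA hq hq0)]

theorem IsSimpleEigenvalueBranch.analytic_mul_refl (hlam : S.IsSimpleEigenvalueBranch U lam)
    (hU : IsOpen U) (hUD : U ⊆ S.diamond) (hp : p ∈ U) :
    IsComplexAnalyticAt (fun q => lam q * S.refl q) p := by
  have h1 := hlam.analytic_mul hU hUD hp (τ := S.meanLeft) fun q hq v hv => by
    rw [meanLeft_apply]; exact (S.trace_eq_zero_of_opA (hUD hq) hv).2
  have h2 := S.isComplexAnalyticAt_phase (hUD hp)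
  have h3 := hlam.analytic hU hUD hp
  refine ((h2.mul h1).sub (h3.mul (h2.mul h2))).congr (.of_forall fun q => ?_)
  simp only [refl_eq, meanLeft_apply]
  ring

theorem IsSimpleEigenvalueBranch.analytic_mul_trans (hlam : S.IsSimpleEigenvalueBranch U lam)
    (hU : IsOpen U) (hUD : U ⊆ S.diamond) (hp : p ∈ U) :
    IsComplexAnalyticAt (fun q => lam q * S.trans q) p := by
  have h1 := hlam.analytic_mul hU hUD hp (τ := S.meanRight) fun q hq v hv => by
    rw [meanRight_apply]; exact (S.trace_eq_zero_of_opA (hUD hq) hv).1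
  have h2 := S.isComplexAnalyticAt_phase (hUD hp)
  refine (h2.mul h1).congr (.of_forall fun q => ?_)
  simp only [trans_eq, meanRight_apply]
  ring

/-- To first order at a guided-mode pair, the eigenvalue is real up to a constant factor. -/
theorem IsSimpleEigenvalueBranch.isLittleO_im (hlam : S.IsSimpleEigenvalueBranch U lam)
    (hU : IsOpen U) (hUD : U ⊆ S.diamond) (hp : p ∈ U) (h0 : lam p = 0) :
    ∃ c ≠ 0, (fun q => (c * lam q).im) =o[𝓝 p] fun q => ‖q - p‖ := by
  obtain ⟨u, φ, h⟩ := hlam.exists_simpleZeroEigenvalue hU hUD hp h0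
  have hu : u ≠ 0 := fun hu => by
    have := h.apply_eq_one
    rw [hu, map_zero] at this; exact zero_ne_one this
  have hD := hUD hp
  obtain ⟨hR, hL⟩ := S.trace_eq_zero_of_opA hD h.apply_eq_zero
  refine ⟨_, inner_opC₁_ne_zero hD.1 hu, h.isLittleO_im (S.isComplexAnalyticAt_opC₁ hD) ?_ ?_⟩
  · filter_upwards [hU.mem_nhds hp] with q hq
    rw [S.inner_opC₁_opA (hUD hq).1]
    exact S.im_scatteringForm_eq_zero (hUD hq) hR hL
  · intro v
    rw [S.inner_opC₁_opA hD.1]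
    exact S.scatteringForm_eq_zero_of_opA hD h.apply_eq_zero v

theorem IsSimpleEigenvalueBranch.tendsto_trans (hlam : S.IsSimpleEigenvalueBranch U lam)
    (hU : IsOpen U) (hUD : U ⊆ S.diamond) {κ₀ ω₀ : ℝ} (hp : (κ₀, ω₀) ∈ U) (h0 : lam (κ₀, ω₀) = 0)
    (hd : deriv (fun ω : ℝ => lam (κ₀, ω)) ω₀ ≠ 0) :
    Tendsto (fun ω => S.trans (κ₀, ω)) (𝓝[≠] ω₀) (𝓝 (S.trans (κ₀, ω₀))) := by
  obtain ⟨u, φ, h⟩ := hlam.exists_simpleZeroEigenvalue hU hUD hp h0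
  have hD := hUD hp
  have hτ : S.meanRight u = 0 := by
    rw [meanRight_apply]; exact (S.trace_eq_zero_of_opA hD h.apply_eq_zero).1
  have h1 := h.tendsto_solution (S.isComplexAnalyticAt_source hD) hτ (sol := S.scatteringSolution)
    (by
      filter_upwards [hU.mem_nhds hp] with q hq
      exact fun _ => hlam.opA_scatteringSolution hUD hq)
    (hlam.opA_scatteringSolution hUD hp) hd
  have h2 : Tendsto (fun ω : ℝ => S.phase (κ₀, ω)) (𝓝[≠] ω₀) (𝓝 (S.phase (κ₀, ω₀))) :=
    ((S.isComplexAnalyticAt_phase hD).continuousAt.tendsto.comp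
      (by fun_prop : Continuous fun ω : ℝ => (κ₀, ω)).continuousAt.tendsto).mono_left
      nhdsWithin_le_nhds
  refine (h2.mul h1).congr' (.of_forall fun ω => ?_) |>.trans ?_
  · rw [trans_eq, meanRight_apply]
  · rw [trans_eq, meanRight_apply]

/-! ### The diamond -/

variable (S) in
theorem sqrt_pos : 0 < √(S.ε₀ * S.μ₀) := Real.sqrt_pos.2 (mul_pos S.ε₀_pos S.μ₀_pos)

theorem abs_le_of_mem_diamond (hp : p ∈ S.diamond) :
    |p.1| ≤ max (1 / 2) (1 / √(S.ε₀ * S.μ₀)) ∧ |p.2| ≤ max (1 / 2) (1 / √(S.ε₀ * S.μ₀)) := by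
  obtain ⟨h1, h2, h3⟩ := hp
  have hs := S.sqrt_pos
  have h4 := abs_nonneg p.1
  have h5 : 0 < p.2 := (mul_pos_iff_of_pos_right hs).1 (h4.trans_lt h2)
  refine ⟨h1.le.trans (le_max_left _ _), le_max_of_le_right ?_⟩
  rw [abs_of_pos h5, le_div_iff₀ hs]
  linarith

/-- On a vertical line the two nonstrict inequalities that hold on the closure become strict between
two points; they also give `|κ| < 1/2`. -/
theorem mem_diamond_of_mem_closure {κ α ω β : ℝ} (hα : (κ, α) ∈ closure S.diamond)
    (hβ : (κ, β) ∈ closure S.diamond) (h1 : α < ω) (h2 : ω < β) : (κ, ω) ∈ S.diamond := by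
  have hcl : closure S.diamond ⊆ {p : ℝ × ℝ | |p.1| ≤ p.2 * √(S.ε₀ * S.μ₀) ∧
      p.2 * √(S.ε₀ * S.μ₀) ≤ 1 - |p.1|} := by
    refine closure_minimal (fun q hq => ⟨hq.2.1.le, hq.2.2.le⟩) ?_
    have hf : Continuous fun q : ℝ × ℝ => |q.1| := continuous_fst.abs
    have hg : Continuous fun q : ℝ × ℝ => q.2 * √(S.ε₀ * S.μ₀) := continuous_snd.mul_const _
    exact (isClosed_le hf hg).inter (isClosed_le hg (continuous_const.sub hf))
  have ha := (hcl hα).1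
  have hb := (hcl hβ).2
  simp only at ha hb
  have h3 := mul_lt_mul_of_pos_right h1 S.sqrt_pos
  have h4 := mul_lt_mul_of_pos_right h2 S.sqrt_pos
  refine ⟨?_, ha.trans_lt h3, h4.trans_le hb⟩
  simp only
  linarith

end PeriodicSlab

end

theorem theorem3p3 (S : PeriodicSlab) (hS : S.IsSymmetric)
    -- the eigenvalue branch, over a neighbourhood of the guided-mode pair in the diamond
    (U : Set (ℝ × ℝ)) (hU : IsOpen U) (hUD : U ⊆ S.diamond)
    (lam : ℝ × ℝ → ℂ) (hlam : S.IsSimpleEigenvalueBranch U lam)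
    (κ₀ ω₀ : ℝ) (h₀ : (κ₀, ω₀) ∈ U) (hmode : lam (κ₀, ω₀) = 0)
    -- the generic conditions
    (hgl : deriv (fun ω : ℝ => lam (κ₀, ω)) ω₀ ≠ 0)
    (hga : deriv (fun ω : ℝ => lam (κ₀, ω) * S.refl (κ₀, ω)) ω₀ ≠ 0)
    (hgb : deriv (fun ω : ℝ => lam (κ₀, ω) * S.trans (κ₀, ω)) ω₀ ≠ 0) :
    -- the normalised functions `ℓ = C ℓ̃`, `a = ℓ R`, `b = ℓ T` and their expansions
    ∃ (C : ℂ) (ℓ a b : ℝ × ℝ → ℂ) (l r t : ℕ → ℂ) (r₀ t₀ γ : ℝ),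
      C ≠ 0 ∧ (∀ p, ℓ p = C * lam p) ∧ (∀ p, a p = ℓ p * S.refl p) ∧
      (∀ p, b p = ℓ p * S.trans p) ∧
      0 < r₀ ∧ r₀ < 1 ∧ 0 < |t₀| ∧ |t₀| < 1 ∧
      HasWeierstrassExpansion ℓ κ₀ ω₀ l 1 ∧
      HasWeierstrassExpansion a κ₀ ω₀ r (r₀ * Complex.exp (Complex.I * γ)) ∧
      HasWeierstrassExpansion b κ₀ ω₀ t (Complex.I * t₀ * Complex.exp (Complex.I * γ)) ∧
      (0 < (l 2).im →
        -- the alternative for the transmittance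
        (ContinuousAt (fun p => ‖S.trans p‖ ^ 2) (κ₀, ω₀) ∨
          ∃ f₁ f₂ : ℝ → ℝ, AnalyticAt ℝ f₁ κ₀ ∧ AnalyticAt ℝ f₂ κ₀ ∧
            f₁ κ₀ = ω₀ ∧ f₂ κ₀ = ω₀ ∧ deriv f₁ κ₀ = deriv f₂ κ₀ ∧
            iteratedDeriv 2 f₁ κ₀ ≠ iteratedDeriv 2 f₂ κ₀ ∧
            ∀ᶠ κ in 𝓝[≠] κ₀,
              ‖S.trans (κ, f₁ κ)‖ ^ 2 = 1 ∧ ‖S.trans (κ, f₂ κ)‖ ^ 2 = 0) ∧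
        -- (i) and (ii)
        (r 2 ≠ t 2 →
          (∀ n, 1 ≤ n → (r n).im = 0 ∧ (t n).im = 0) ∧ r 1 = l 1 ∧ t 1 = l 1 ∧
          (∀ᶠ ω in 𝓝 ω₀, ContinuousAt (Function.update (fun ω => a (κ₀, ω) / ℓ (κ₀, ω)) ω₀
            (r₀ * Complex.exp (Complex.I * γ))) ω) ∧
          (∀ᶠ ω in 𝓝 ω₀, ContinuousAt (Function.update (fun ω => b (κ₀, ω) / ℓ (κ₀, ω)) ω₀
            (Complex.I * t₀ * Complex.exp (Complex.I * γ))) ω) ∧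
          ∃ fa fb : ℝ → ℝ,
            IsZeroCurve a κ₀ ω₀ r fa ∧ IsZeroCurve b κ₀ ω₀ t fb ∧
            (∀ᶠ κ in 𝓝[≠] κ₀, fa κ ≠ fb κ) ∧
            (∀ᶠ p : ℝ × ℝ in 𝓝[≠] (κ₀, ω₀),
              (‖S.trans p‖ ^ 2 = 1 ↔ p.2 = fa p.1) ∧ (‖S.trans p‖ ^ 2 = 0 ↔ p.2 = fb p.1)) ∧
            -- `W` may be the whole diamond if the eigenvalue branch is given there
            ∀ W : Set (ℝ × ℝ), IsOpen W → (κ₀, ω₀) ∈ W → W ⊆ U →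
              closure W ∩ S.diamond ⊆ U →
              ExtendsToBoundaryOrDegeneracy a W κ₀ fa ∧
              ExtendsToBoundaryOrDegeneracy b W κ₀ fb) ∧
        -- (iii)
        (r 2 = t 2 →
          (∀ᶠ p in 𝓝 (κ₀, ω₀),
            ContinuousAt (Function.update (fun p => ‖a p / ℓ p‖) (κ₀, ω₀) |r₀|) p) ∧
          (∀ᶠ p in 𝓝 (κ₀, ω₀),
            ContinuousAt (Function.update (fun p => ‖b p / ℓ p‖) (κ₀, ω₀) |t₀|) p))) := by
  refine exists_anomaly_expansion hU hUD (fun p hp => PeriodicSlab.abs_le_of_mem_diamond hp)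
    (fun _ _ _ _ hα hβ => PeriodicSlab.mem_diamond_of_mem_closure hα hβ) h₀ hmode
    (fun p hp => hlam.analytic hU hUD hp) (fun p hp => hlam.analytic_mul_refl hU hUD hp)
    (fun p hp => hlam.analytic_mul_trans hU hUD hp) (fun p hp _ => ?_) (fun p hp _ => ?_)
    (hlam.isLittleO_im hU hUD h₀ hmode) (hlam.tendsto_trans hU hUD h₀ hmode hgl) hgl hga hgb
  · exact (hlam.isScatteringSolution hUD hp).norm_sq_add (hUD hp)
  · exact (hlam.isScatteringSolution hUD hp).re_mul_star hS (hUD hp)
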